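/- **Setting.** Let $g$ be a probability density on $\mathbf R$, real analytic, with a meromorphic continuation (again denoted $g$) to the upper half plane, such that for every $\gamma>0$ there is $C>0$ with $|g(z)|<Ce^{-\gamma|z|}$ for all $z\in\mathbf R$, and, for some fixed $\delta>0$, the same holds for all $z$ in the sectors $|\arg z|\le\delta$, $|\arg z-\pi|\le\delta$. For integers $\beta\ge 0$, $n\ge 1$ let $\mathrm{Exp}_+(\beta,n)$ be the Banach space of functions $\phi$ that are holomorphic on $\mathrm{Im}\,z>-1/n$, continuous on $\mathrm{Im}\,z\ge-1/n$, with $\|\phi\|_{\beta,n}=\sup_{\mathrm{Im} z\ge -1/n}e^{-\beta|z|}|\phi(z)|<\infty$, and let $\mathrm{Exp}_+=\bigcup_{\beta,n}\mathrm{Exp}_+(\beta,n)$ with the inductive limit topology ($U$ is open iff $U\cap \mathrm{Exp}_+(\beta,n)$ is open for all $\beta,n$). Let $\mathrm{Exp}_+'$ be the space of continuous linear functionals $\phi\mapsto\langle\phi\,|\,\mu\rangle$ on $\mathrm{Exp}_+$. Its weak dual topology is that of pointwise convergence, its strong dual topology that of uniform convergence on bounded sets, and its projective topology the coarsest one making all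 restriction maps $\mathrm{Exp}_+'\to\mathrm{Exp}_+(\beta,n)'$ continuous for the dual norms $\|\cdot\|^*_{\beta,n}$. Put $$d_\beta(\mu,\nu)=\sum_{n\ge1}\frac1{2^n}\frac{\|\mu-\nu\|^*_{\beta,n}}{1+\|\mu-\nu\|^*_{\beta,n}},\qquad d(\mu,\nu)=\sum_{\beta\ge0}\frac1{2^\beta}\frac{d_\beta(\mu,\nu)}{1+d_\beta(\mu,\nu)}.$$ Let $i:\mathrm{Exp}_+\to\mathrm{Exp}_+'$, $i(\psi)(\phi)=\int_{\mathbf R}\phi\,\psi\,g\,d\omega$, and for $C\ge1$, $\alpha\ge0$ let $V_{C,\alpha}=\{\phi\in\mathrm{Exp}_+ : |\phi(z)|e^{-\alpha|z|}\le C \text{ for } \mathrm{Im}\,z\ge0\}$. Let $K\in\mathbf R$ and $D(\lambda)=\int_{\mathbf R}\frac{g(\omega)}{\lambda-\sqrt{-1}\,\omega}d\omega$. A *resonance pole* is a root $\lambda$ of $D(\lambda)+2\pi g(-\sqrt{-1}\lambda)=2/K$ with $\mathrm{Re}\,\lambda<0$, or a point $\lambda$ of the imaginary axis at which $D$ has the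 limit $2/K$ from the right and $D+2\pi g(-\sqrt{-1}\,\cdot)$ has the limit $2/K$ from the left along the horizontal line through $\lambda$. It is *simple* if the limit $D_\lambda=\lim_{z\to\lambda,\ \mathrm{Re}z<0}\frac{1}{z-\lambda}\bigl(1-\frac K2D(z)-\pi Kg(-\sqrt{-1}z)\bigr)$ exists and is nonzero. The set $\mathcal K_1\subset\mathbf C\cup\{\infty\}$ consists of $0$, $\infty$ and all $K$ such that $D(\lambda)+2\pi g(-\sqrt{-1}\lambda)=\frac2K+o(|\lambda|^{-n})$ for every $n=0,1,2,\dots$ along some path tending to $\infty$ inside $\pi/2+\delta<\arg\lambda<3\pi/2-\delta$. The generalized eigenfunction $\mu_\lambda$ of a resonance pole $\lambda$ is given by $\langle\phi\,|\,\mu_\lambda\rangle=\int_{\mathbf R}\frac{\phi(\omega)g(\omega)}{\lambda-\sqrt{-1}\omega}d\omega+2\pi\phi(-\sqrt{-1}\lambda)g(-\sqrt{-1}\lambda)$ if $\mathrm{Re}\,\lambda<0$, and by $\langle\phi\,|\,\mu_\lambda\rangle=\lim_{x\to+0}\int_{\mathbf R}\frac{\phi(\omega)g(\omega)}{\lambda+x-\sqrt{-1}\omega}d\omega$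 if $\mathrm{Re}\,\lambda=0$. **Theorem.** For all $C\ge1$ and $\alpha\ge0$: (i) On $i(V_{C,\alpha})\subset\mathrm{Exp}_+'$ the weak dual topology, the projective topology and the strong dual topology coincide. (ii) For each of these three topologies, the closure of $i(V_{C,\alpha})$ in $\mathrm{Exp}_+'$ is connected and compact, and its topology is induced by the metric $d$. (iii) If $K\notin\mathcal K_1$, then for every simple resonance pole $\lambda$, $\mu_\lambda$ is a well-defined element of $\mathrm{Exp}_+'$, and the projection $$\Pi_\lambda:i(V_{C,\alpha})\to\mathrm{Exp}_+',\qquad \Pi_\lambda\, i(\psi)=\frac{K}{2D_\lambda}\langle\psi\,|\,\mu_\lambda\rangle\,\mu_\lambda ,$$ is well defined, continuous with respect to the projective topology, and sequentially continuous with respect to the weak dual topology. (iv) Let $h$ be a probability measure on the circle $\mathbf R/2\pi\mathbf Z$, and let $\rho_t(\cdot,\omega)$ ($t\ge0$, $\omega\in\mathbf R$) be probability measures on the circle, measurable in $\omega$, with $\rho_0(\cdot,\omega)=h$, whose moments $Z_j(t,\omega)=\int e^{\sqrt{-1}j\theta}d\rho_t(\theta,\omega)$ solve $$\frac{dZ_j}{dt}=\sqrt{-1}\,j\omega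 Z_j+\frac{jK}{2}\bigl(\eta(t)Z_{j-1}-\overline{\eta(t)}Z_{j+1}\bigr),\quad j\ge1,\qquad \eta(t)=\int_{\mathbf R}Z_1(t,\omega)g(\omega)d\omega,$$ for $t\ge 0$ (the continuous Kuramoto model; note $Z_0=1$). Then for all $t\ge0$ and $j\ge1$, $Z_j(t,\cdot)$ is the restriction to $\mathbf R$ of a function in $V_{1,0}$. -/

import Mathlib

open MeasureTheory ProbabilityTheory Filter Topology Asymptotics

namespace Kuramoto

noncomputable section

/-! ### The natural frequency density -/

/-- `g` is a probability density on `ℝ`, real analytic, with meromorphic continuation `G` to the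
upper half plane; `g` decays faster than every exponential on `ℝ`, and so does `G` in the sectors
of opening `δ` around the real axis.

`G` is used only on the closed upper half plane, which is why the sectors `|arg z| ≤ δ` and
`|arg z - π| ≤ δ` are cut down to it: the continuation to the lower half plane is the reflection
`conj (G (conj z))`, of the same modulus. Normal form means that `G` has no removable singularities
(and that Lean assigns it the value `0` at its poles). -/
structure IsGaussianType (g : ℝ → ℝ) (G : ℂ → ℂ) (δ : ℝ) : Prop where
  nonneg : ∀ ω, 0 ≤ g ω
  integral_eq_one : ∫ ω, g ω = 1
  continuation : ∀ ω : ℝ, G ω = g ω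
  analyticAt_real : ∀ ω : ℝ, AnalyticAt ℂ G ω
  meromorphic : MeromorphicNFOn G {z : ℂ | 0 < z.im}
  decay : ∀ γ : ℝ, 0 < γ → ∃ C : ℝ, 0 < C ∧ ∀ ω : ℝ, |g ω| < C * Real.exp (-γ * |ω|)
  delta_pos : 0 < δ
  sector_decay : ∀ γ : ℝ, 0 < γ → ∃ C : ℝ, 0 < C ∧ ∀ z : ℂ, 0 ≤ z.im →
    (|z.arg| ≤ δ ∨ |z.arg - Real.pi| ≤ δ) → ‖G z‖ < C * Real.exp (-γ * ‖z‖)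

/-- `D(lam) = ∫ g(ω) / (lam - iω) dω`. -/
def resolventFunction (g : ℝ → ℝ) (lam : ℂ) : ℂ :=
  ∫ ω : ℝ, (g ω : ℂ) / (lam - Complex.I * ω)

/-- `D(lam) + 2π g(-i lam)`: the continuation of `D` from the right to the left half plane. -/
def continuedResolvent (g : ℝ → ℝ) (G : ℂ → ℂ) (lam : ℂ) : ℂ :=
  resolventFunction g lam + 2 * Real.pi * G (-Complex.I * lam)

/-! ### The exceptional set of coupling constants -/

/-- The finite numbers `K` such that, along some path tending to infinity inside the angular domain
`π/2 + δ < arg lam < 3π/2 - δ`, the function `D(lam) + 2π g(-i lam)` converges to `2/K` faster than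
every power of `1/|lam|`. -/
def asymptoticCouplings (g : ℝ → ℝ) (G : ℂ → ℂ) (δ : ℝ) : Set ℂ :=
  {K | ∃ path : ℝ → ℂ, ContinuousOn path (Set.Ici 0) ∧
    Tendsto (fun s => ‖path s‖) atTop atTop ∧
    (∀ s : ℝ, 0 ≤ s → ∃ r ϑ : ℝ, 0 < r ∧ Real.pi / 2 + δ < ϑ ∧ ϑ < 3 * Real.pi / 2 - δ ∧
      path s = r * Complex.exp (Complex.I * ϑ)) ∧
    ∀ n : ℕ, (fun s => continuedResolvent g G (path s) - 2 / K)
      =o[atTop] (fun s => 1 / ‖path s‖ ^ n)}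

/-- The set `𝒦₁` in the Riemann sphere: the values above together with `0` and `∞`. -/
def exceptionalCouplings (g : ℝ → ℝ) (G : ℂ → ℂ) (δ : ℝ) : Set (OnePoint ℂ) :=
  ((fun K : ℂ => (K : OnePoint ℂ)) '' asymptoticCouplings g G δ) ∪ {((0 : ℂ) : OnePoint ℂ)} ∪
    {OnePoint.infty}

/-! ### Resonance poles -/

/-- Resonance poles: the roots of `D(lam) + 2π g(-i lam) = 2/K` on the left half plane, and of the
boundary version of the equation on the imaginary axis. At a root `-i lam` is not a pole of `g`. -/
def IsResonancePole (K : ℝ) (g : ℝ → ℝ) (G : ℂ → ℂ) (lam : ℂ) : Prop :=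
  (lam.re < 0 ∧ AnalyticAt ℂ G (-Complex.I * lam) ∧
    continuedResolvent g G lam = 2 / (K : ℂ)) ∨
  (lam.re = 0 ∧
    Tendsto (fun x : ℝ => resolventFunction g (lam + x)) (𝓝[>] 0) (𝓝 (2 / (K : ℂ))) ∧
    Tendsto (fun x : ℝ => continuedResolvent g G (lam + x)) (𝓝[<] 0) (𝓝 (2 / (K : ℂ))))

/-- `Dn = lim (1 - (K/2) D(z) - π K g(-iz)) / (z - lam)` as `z → lam`, the limit being taken in the
left half plane, where the formula gives the continuation. A resonance pole is simple iff
`Dn ≠ 0`. -/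
def HasPoleConstant (K : ℝ) (g : ℝ → ℝ) (G : ℂ → ℂ) (lam Dn : ℂ) : Prop :=
  Tendsto (fun z : ℂ => (1 - K / 2 * resolventFunction g z - Real.pi * K * G (-Complex.I * z)) /
      (z - lam))
    (𝓝[{z : ℂ | z.re < 0 ∧ z ≠ lam}] lam) (𝓝 Dn)

/-! ### The Banach spaces `Exp₊(β, n)`

The index `n : ℕ` here stands for `n + 1` in the usual indexing by `n = 1, 2, …`. -/

/-- The region `Im z ≥ -1/(n+1)`. -/
def region (n : ℕ) : Set ℂ := {z | -(1 / ((n : ℝ) + 1)) ≤ z.im}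

/-- Functions which are holomorphic in `Im z > -1/(n+1)`, continuous on `Im z ≥ -1/(n+1)`, and
bounded there by a multiple of `exp (β |z|)`. A function on the region is represented by its
extension by `0` to `ℂ`. -/
def expSubmodule (β n : ℕ) : Submodule ℂ (ℂ → ℂ) where
  carrier := {f | DifferentiableOn ℂ f {z | -(1 / ((n : ℝ) + 1)) < z.im} ∧
    ContinuousOn f (region n) ∧ (∀ z ∉ region n, f z = 0) ∧
    ∃ C : ℝ, ∀ z ∈ region n, Real.exp (-(β : ℝ) * ‖z‖) * ‖f z‖ ≤ C}
  add_mem' := by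
    rintro f h ⟨f1, f2, f3, C, f4⟩ ⟨h1, h2, h3, C', h4⟩
    refine ⟨f1.add h1, f2.add h2, fun z hz => by simp [f3 z hz, h3 z hz], C + C', fun z hz => ?_⟩
    calc Real.exp (-(β : ℝ) * ‖z‖) * ‖(f + h) z‖
        ≤ Real.exp (-(β : ℝ) * ‖z‖) * (‖f z‖ + ‖h z‖) := by
          gcongr; exact norm_add_le _ _
      _ ≤ C + C' := by rw [mul_add]; exact add_le_add (f4 z hz) (h4 z hz)
  zero_mem' := ⟨differentiableOn_const 0, continuousOn_const, fun _ _ => rfl, 0, by simp⟩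
  smul_mem' := by
    rintro c f ⟨f1, f2, f3, C, f4⟩
    refine ⟨f1.const_smul c, f2.const_smul c, fun z hz => by simp [f3 z hz], ‖c‖ * C,
      fun z hz => ?_⟩
    have := mul_le_mul_of_nonneg_left (f4 z hz) (norm_nonneg c)
    simp only [Pi.smul_apply, smul_eq_mul, norm_mul]
    linarith

/-- The space `Exp₊(β, n)`. -/
def ExpBanach (β n : ℕ) : Type := ↥(expSubmodule β n)

instance (β n : ℕ) : AddCommGroup (ExpBanach β n) :=
  inferInstanceAs (AddCommGroup ↥(expSubmodule β n))

instance (β n : ℕ) : Module ℂ (ExpBanach β n) :=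
  inferInstanceAs (Module ℂ ↥(expSubmodule β n))

/-- The norm `sup_{Im z ≥ -1/(n+1)} exp (-β |z|) |f z|`. -/
instance (β n : ℕ) : Norm (ExpBanach β n) :=
  ⟨fun f => ⨆ z : region n, Real.exp (-(β : ℝ) * ‖(z : ℂ)‖) * ‖f.1 z‖⟩

theorem expBanach_norm_def {β n : ℕ} (f : ExpBanach β n) :
    ‖f‖ = ⨆ z : region n, Real.exp (-(β : ℝ) * ‖(z : ℂ)‖) * ‖f.1 z‖ := rfl

theorem real_mem_region (n : ℕ) (z : ℂ) (hz : 0 ≤ z.im) : z ∈ region n := by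
  have : (0 : ℝ) < 1 / ((n : ℝ) + 1) := by positivity
  simp only [region, Set.mem_ofPred_eq]
  linarith

theorem expBanach_le_norm {β n : ℕ} (f : ExpBanach β n) {z : ℂ} (hz : z ∈ region n) :
    Real.exp (-(β : ℝ) * ‖z‖) * ‖f.1 z‖ ≤ ‖f‖ := by
  obtain ⟨C, hC⟩ := f.2.2.2.2
  exact le_ciSup (f := fun z : region n => Real.exp (-(β : ℝ) * ‖(z : ℂ)‖) * ‖f.1 z‖)
    ⟨C, by rintro _ ⟨w, rfl⟩; exact hC w w.2⟩ ⟨z, hz⟩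

theorem expBanach_norm_le {β n : ℕ} (f : ExpBanach β n) {C : ℝ}
    (h : ∀ z ∈ region n, Real.exp (-(β : ℝ) * ‖z‖) * ‖f.1 z‖ ≤ C) : ‖f‖ ≤ C := by
  have : Nonempty (region n) := ⟨⟨0, real_mem_region n 0 (by simp)⟩⟩
  exact ciSup_le fun z => h z z.2

theorem expBanach_core (β n : ℕ) : NormedSpace.Core ℂ (ExpBanach β n) where
  norm_nonneg f := Real.iSup_nonneg fun z => by positivity
  norm_smul c f := by
    rw [expBanach_norm_def, expBanach_norm_def, Real.mul_iSup_of_nonneg (norm_nonneg c)]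
    congr 1
    ext z
    have : (c • f).1 z = c * f.1 z := rfl
    rw [this, norm_mul]
    ring
  norm_triangle f h := by
    refine expBanach_norm_le _ fun z hz => ?_
    have e : (f + h).1 z = f.1 z + h.1 z := rfl
    rw [e]
    calc Real.exp (-(β : ℝ) * ‖z‖) * ‖f.1 z + h.1 z‖
        ≤ Real.exp (-(β : ℝ) * ‖z‖) * (‖f.1 z‖ + ‖h.1 z‖) := by
          gcongr; exact norm_add_le _ _
      _ ≤ ‖f‖ + ‖h‖ := by
          rw [mul_add]; exact add_le_add (expBanach_le_norm f hz) (expBanach_le_norm h hz)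
  norm_eq_zero_iff f := by
    constructor
    · intro h
      apply Subtype.ext
      funext z
      by_cases hz : z ∈ region n
      · have h1 := expBanach_le_norm f hz
        rw [h] at h1
        have h2 : ‖f.1 z‖ ≤ 0 := by
          by_contra h3
          push Not at h3
          have := mul_pos (Real.exp_pos (-(β : ℝ) * ‖z‖)) h3
          linarith
        exact norm_le_zero_iff.1 h2
      · exact f.2.2.2.1 z hz
    · rintro rfl
      rw [expBanach_norm_def]
      have : ∀ z : region n,
          Real.exp (-(β : ℝ) * ‖(z : ℂ)‖) * ‖(0 : ExpBanach β n).1 z‖ = 0 := by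
        intro z
        have e : (0 : ExpBanach β n).1 z = 0 := rfl
        simp [e]
      simp only [this]
      exact Real.iSup_const_zero

instance (β n : ℕ) : NormedAddCommGroup (ExpBanach β n) :=
  NormedAddCommGroup.ofCore (expBanach_core β n)

instance (β n : ℕ) : NormedSpace ℂ (ExpBanach β n) :=
  NormedSpace.ofCore (expBanach_core β n)

/-! ### The inductive limit `Exp₊` -/

theorem expSubmodule_mono {β β' n n' : ℕ} (hβ : β ≤ β') (hn : n ≤ n') {f : ℂ → ℂ}
    (hf : f ∈ expSubmodule β n) :
    ∃ f' ∈ expSubmodule β' n', ∀ z : ℂ, 0 ≤ z.im → f' z = f z := by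
  classical
  obtain ⟨h1, h2, h3, C, h4⟩ := hf
  have hle : 1 / ((n' : ℝ) + 1) ≤ 1 / ((n : ℝ) + 1) := by gcongr
  have hsub : region n' ⊆ region n := fun z hz => by
    simp only [region, Set.mem_ofPred_eq] at hz ⊢; linarith
  have heq : Set.EqOn ((region n').indicator f) f (region n') :=
    fun z hz => Set.indicator_of_mem hz f
  refine ⟨(region n').indicator f, ⟨?_, ?_, ?_, C, ?_⟩, ?_⟩
  · refine (h1.mono ?_).congr fun z hz => heq ?_
    · intro z hz; simp only [Set.mem_ofPred_eq] at hz ⊢; linarith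
    · simp only [region, Set.mem_ofPred_eq] at hz ⊢; linarith
  · exact (h2.mono hsub).congr heq
  · exact fun z hz => Set.indicator_of_notMem hz f
  · intro z hz
    rw [heq hz]
    refine le_trans ?_ (h4 z (hsub hz))
    have : (β : ℝ) ≤ β' := by exact_mod_cast hβ
    gcongr
  · exact fun z hz => heq (real_mem_region n' z hz)

/-- The union of the spaces `Exp₊(β, n)`. An element, a holomorphic function near the closed upper
half plane, is represented by its restriction to `Im z ≥ 0` (which determines it, by the identity
theorem), extended by `0` to `ℂ`. -/
def expPlusSubmodule : Submodule ℂ (ℂ → ℂ) where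
  carrier := {f | (∀ z : ℂ, z.im < 0 → f z = 0) ∧
    ∃ β n : ℕ, ∃ F ∈ expSubmodule β n, ∀ z : ℂ, 0 ≤ z.im → f z = F z}
  add_mem' := by
    rintro f h ⟨f0, β, n, F, hF, hf⟩ ⟨h0, β', n', H, hH, hh⟩
    obtain ⟨F', hF', e1⟩ := expSubmodule_mono (le_max_left β β') (le_max_left n n') hF
    obtain ⟨H', hH', e2⟩ := expSubmodule_mono (le_max_right β β') (le_max_right n n') hH
    exact ⟨fun z hz => by simp [f0 z hz, h0 z hz], _, _, F' + H', add_mem hF' hH', fun z hz => by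
      simp [hf z hz, hh z hz, e1 z hz, e2 z hz]⟩
  zero_mem' := ⟨fun _ _ => rfl, 0, 0, 0, zero_mem _, fun _ _ => rfl⟩
  smul_mem' := by
    rintro c f ⟨f0, β, n, F, hF, hf⟩
    exact ⟨fun z hz => by simp [f0 z hz], β, n, c • F, Submodule.smul_mem _ c hF,
      fun z hz => by simp [hf z hz]⟩

/-- The space `Exp₊`. -/
def ExpPlus : Type := ↥expPlusSubmodule

instance : AddCommGroup ExpPlus := inferInstanceAs (AddCommGroup ↥expPlusSubmodule)

instance : Module ℂ ExpPlus := inferInstanceAs (Module ℂ ↥expPlusSubmodule)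

instance : CoeFun ExpPlus (fun _ => ℂ → ℂ) := ⟨fun f => f.1⟩

/-- The inclusion `Exp₊(β, n) → Exp₊`. -/
def inclusionLinear (β n : ℕ) : ExpBanach β n →ₗ[ℂ] ExpPlus where
  toFun f := ⟨{z : ℂ | 0 ≤ z.im}.indicator f.1,
    fun z hz => Set.indicator_of_notMem (by simpa using hz) _,
    β, n, f.1, f.2, fun z hz => Set.indicator_of_mem (by simpa using hz) _⟩
  map_add' f h := Subtype.ext (Set.indicator_add _ f.1 h.1)
  map_smul' c f := Subtype.ext (Set.indicator_const_smul _ c f.1)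

/-- The inductive limit topology: `U` is open iff its preimage in every `Exp₊(β, n)` is open. -/
instance : TopologicalSpace ExpPlus :=
  ⨆ β : ℕ, ⨆ n : ℕ, TopologicalSpace.coinduced (inclusionLinear β n) inferInstance

theorem continuous_inclusionLinear (β n : ℕ) : Continuous (inclusionLinear β n) := by
  rw [continuous_iff_coinduced_le]
  exact le_iSup_of_le β (le_iSup_of_le n le_rfl)

/-- A function on `Exp₊` is continuous iff it is on every `Exp₊(β, n)`. -/
theorem continuous_expPlus_iff {X : Type*} [TopologicalSpace X] {f : ExpPlus → X} :
    Continuous f ↔ ∀ β n : ℕ, Continuous (fun φ => f (inclusionLinear β n φ)) := by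
  constructor
  · exact fun h β n => h.comp (continuous_inclusionLinear β n)
  · intro h
    refine continuous_iSup_dom.2 fun β => continuous_iSup_dom.2 fun n => ?_
    exact continuous_coinduced_dom.2 (h β n)

/-- The inclusion `Exp₊(β, n) → Exp₊` as a continuous linear map. -/
def inclusion (β n : ℕ) : ExpBanach β n →L[ℂ] ExpPlus :=
  ⟨inclusionLinear β n, continuous_inclusionLinear β n⟩

/-! ### The dual space and its three topologies -/

/-- The dual space `Exp₊'`: the continuous linear functionals on `Exp₊`. -/
abbrev ExpPlusDual : Type := ExpPlus →L[ℂ] ℂ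

/-- The weak dual topology: pointwise convergence. -/
@[reducible]
def weakDualTopology : TopologicalSpace ExpPlusDual :=
  TopologicalSpace.induced (fun (μ : ExpPlusDual) (φ : ExpPlus) => μ φ) Pi.topologicalSpace

/-- The projective topology: the coarsest one for which all the restriction maps into the Banach
spaces `Exp₊(β, n)'` (with their operator norms) are continuous. -/
@[reducible]
def projectiveTopology : TopologicalSpace ExpPlusDual :=
  ⨅ β : ℕ, ⨅ n : ℕ, TopologicalSpace.induced
    (fun μ : ExpPlusDual => (μ.comp (inclusion β n) : ExpBanach β n →L[ℂ] ℂ)) inferInstance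

/-- The strong dual topology: uniform convergence on the (von Neumann) bounded subsets of `Exp₊`,
which is Mathlib's topology on spaces of continuous linear maps. -/
@[reducible]
def strongDualTopology : TopologicalSpace ExpPlusDual :=
  ContinuousLinearMap.topologicalSpace

/-- The metric `d_β = ∑_{n ≥ 1} 2^{-n} ‖μ - ν‖*_{β,n} / (1 + ‖μ - ν‖*_{β,n})`. -/
def distBeta (β : ℕ) (μ ν : ExpPlusDual) : ℝ :=
  ∑' n : ℕ, 1 / 2 ^ (n + 1) *
    (‖(μ - ν).comp (inclusion β n)‖ / (1 + ‖(μ - ν).comp (inclusion β n)‖))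

/-- The metric `d = ∑_{β ≥ 0} 2^{-β} d_β / (1 + d_β)`. -/
def dualDist (μ ν : ExpPlusDual) : ℝ :=
  ∑' β : ℕ, 1 / 2 ^ β * (distBeta β μ ν / (1 + distBeta β μ ν))

/-! ### The canonical inclusion -/

theorem IsGaussianType.continuous {g : ℝ → ℝ} {G : ℂ → ℂ} {δ : ℝ} (hg : IsGaussianType g G δ) :
    Continuous g := by
  have h1 : Continuous fun ω : ℝ => G ω := by
    rw [continuous_iff_continuousAt]
    intro ω
    exact ContinuousAt.comp (f := fun x : ℝ => (x : ℂ)) (hg.analyticAt_real ω).continuousAt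
      Complex.continuous_ofReal.continuousAt
  have h2 : g = fun ω : ℝ => (G ω).re := by
    funext ω; rw [hg.continuation ω, Complex.ofReal_re]
  rw [h2]
  exact Complex.continuous_re.comp h1

theorem expPlus_continuous (φ : ExpPlus) : Continuous fun ω : ℝ => φ ω := by
  obtain ⟨-, β, n, F, hF, h⟩ := φ.2
  have e : (fun ω : ℝ => φ ω) = fun ω : ℝ => F ω := by
    funext ω; exact h ω (by simp)
  rw [e]
  exact hF.2.1.comp_continuous Complex.continuous_ofReal fun ω => real_mem_region n _ (by simp)

theorem expPlus_bound (φ : ExpPlus) :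
    ∃ β : ℕ, ∃ C : ℝ, 0 ≤ C ∧ ∀ ω : ℝ, ‖φ ω‖ ≤ C * Real.exp (β * |ω|) := by
  obtain ⟨-, β, n, F, hF, h⟩ := φ.2
  obtain ⟨C, hC⟩ := hF.2.2.2
  refine ⟨β, C, ?_, fun ω => ?_⟩
  · exact le_trans (by positivity) (hC 0 (real_mem_region n 0 (by simp)))
  · have h1 := hC ω (real_mem_region n _ (by simp))
    have e : φ ω = F ω := h ω (by simp)
    rw [e]
    rw [Complex.norm_real, Real.norm_eq_abs, neg_mul, Real.exp_neg] at h1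
    have hp := Real.exp_pos ((β : ℝ) * |ω|)
    rwa [inv_mul_le_iff₀ hp, mul_comm] at h1

theorem integrable_exp_of_neg_abs : Integrable fun ω : ℝ => Real.exp (-|ω|) := by
  rw [← integrableOn_univ, ← Set.Iic_union_Ioi (a := (0 : ℝ))]
  refine IntegrableOn.union ?_ ?_
  · refine (integrableOn_exp_Iic 0).congr_fun (fun x hx => ?_) measurableSet_Iic
    simp only [Set.mem_Iic] at hx
    simp [abs_of_nonpos hx]
  · refine (integrableOn_exp_neg_Ioi 0).congr_fun (fun x hx => ?_) measurableSet_Ioi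
    simp only [Set.mem_Ioi] at hx
    simp [abs_of_pos hx]

theorem IsGaussianType.integrable_exp {g : ℝ → ℝ} {G : ℂ → ℂ} {δ : ℝ}
    (hg : IsGaussianType g G δ) (a : ℝ) : Integrable fun ω : ℝ => Real.exp (a * |ω|) * g ω := by
  obtain ⟨C, -, hC⟩ := hg.decay (|a| + 1) (by positivity)
  have hi : Integrable fun ω : ℝ => C * Real.exp (-|ω|) :=
    integrable_exp_of_neg_abs.const_mul C
  refine hi.mono' ?_ (Eventually.of_forall fun ω => ?_)
  · exact ((Real.continuous_exp.comp (continuous_const.mul continuous_abs)).mul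
      hg.continuous).aestronglyMeasurable
  · rw [norm_mul, Real.norm_eq_abs, Real.norm_eq_abs, Real.abs_exp]
    calc Real.exp (a * |ω|) * |g ω|
        ≤ Real.exp (|a| * |ω|) * (C * Real.exp (-(|a| + 1) * |ω|)) := by
          gcongr
          · exact le_abs_self a
          · exact (hC ω).le
      _ = C * Real.exp (-|ω|) := by
          rw [mul_left_comm, ← Real.exp_add]; congr 2; ring

theorem integrable_pairing {g : ℝ → ℝ} {G : ℂ → ℂ} {δ : ℝ} (hg : IsGaussianType g G δ)
    (ψ φ : ExpPlus) : Integrable fun ω : ℝ => φ ω * ψ ω * (g ω : ℂ) := by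
  obtain ⟨β, C, hC0, hC⟩ := expPlus_bound φ
  obtain ⟨β', C', hC0', hC'⟩ := expPlus_bound ψ
  refine ((hg.integrable_exp (β + β')).const_mul (C * C')).mono' ?_
    (Eventually.of_forall fun ω => ?_)
  · exact (((expPlus_continuous φ).mul (expPlus_continuous ψ)).mul
      (Complex.continuous_ofReal.comp hg.continuous)).aestronglyMeasurable
  · rw [norm_mul, norm_mul, Complex.norm_real, Real.norm_eq_abs, abs_of_nonneg (hg.nonneg ω)]
    calc ‖φ ω‖ * ‖ψ ω‖ * g ω
        ≤ (C * Real.exp (β * |ω|)) * (C' * Real.exp (β' * |ω|)) * g ω := by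
          gcongr
          · exact hg.nonneg ω
          · exact hC ω
          · exact hC' ω
      _ = C * C' * (Real.exp ((β + β') * |ω|) * g ω) := by
          rw [add_mul, Real.exp_add]; ring

/-- `φ ↦ ∫ φ ψ g`, as a linear form. -/
def pairingLinear {g : ℝ → ℝ} {G : ℂ → ℂ} {δ : ℝ} (hg : IsGaussianType g G δ) (ψ : ExpPlus) :
    ExpPlus →ₗ[ℂ] ℂ where
  toFun φ := ∫ ω : ℝ, φ ω * ψ ω * (g ω : ℂ)
  map_add' φ₁ φ₂ := by
    rw [← integral_add (integrable_pairing hg ψ φ₁) (integrable_pairing hg ψ φ₂)]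
    congr 1
    funext ω
    have e : (φ₁ + φ₂) ω = φ₁ ω + φ₂ ω := rfl
    rw [e]
    ring
  map_smul' c φ := by
    rw [RingHom.id_apply, smul_eq_mul, ← integral_const_mul]
    congr 1
    funext ω
    have e : (c • φ) ω = c * φ ω := rfl
    rw [e]
    ring

theorem continuous_pairingLinear {g : ℝ → ℝ} {G : ℂ → ℂ} {δ : ℝ} (hg : IsGaussianType g G δ)
    (ψ : ExpPlus) : Continuous (pairingLinear hg ψ) := by
  rw [continuous_expPlus_iff]
  intro β n
  obtain ⟨β', C', hC0', hC'⟩ := expPlus_bound ψ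
  let L : ExpBanach β n →ₗ[ℂ] ℂ := (pairingLinear hg ψ).comp (inclusionLinear β n)
  refine AddMonoidHomClass.continuous_of_bound L (C' * ∫ ω : ℝ, Real.exp ((β + β') * |ω|) * g ω) fun f => ?_
  have hb : ∀ ω : ℝ, ‖(inclusionLinear β n f) ω‖ ≤ ‖f‖ * Real.exp (β * |ω|) := by
    intro ω
    have e : (inclusionLinear β n f) ω = f.1 ω :=
      Set.indicator_of_mem (by simp) _
    have h1 := expBanach_le_norm f (real_mem_region n (ω : ℂ) (by simp))
    rw [Complex.norm_real, Real.norm_eq_abs, neg_mul, Real.exp_neg] at h1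
    have hp := Real.exp_pos ((β : ℝ) * |ω|)
    rw [e]
    rwa [inv_mul_le_iff₀ hp, mul_comm] at h1
  have hi : Integrable fun ω : ℝ => (C' * ‖f‖) * (Real.exp ((β + β') * |ω|) * g ω) :=
    (hg.integrable_exp (β + β')).const_mul _
  calc ‖∫ ω : ℝ, (inclusionLinear β n f) ω * ψ ω * (g ω : ℂ)‖
      ≤ ∫ ω : ℝ, (C' * ‖f‖) * (Real.exp ((β + β') * |ω|) * g ω) := by
        refine norm_integral_le_of_norm_le hi (Eventually.of_forall fun ω => ?_)
        rw [norm_mul, norm_mul, Complex.norm_real, Real.norm_eq_abs, abs_of_nonneg (hg.nonneg ω)]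
        calc ‖(inclusionLinear β n f) ω‖ * ‖ψ ω‖ * g ω
            ≤ (‖f‖ * Real.exp (β * |ω|)) * (C' * Real.exp (β' * |ω|)) * g ω := by
              gcongr
              · exact hg.nonneg ω
              · exact hb ω
              · exact hC' ω
          _ = (C' * ‖f‖) * (Real.exp ((β + β') * |ω|) * g ω) := by
              rw [add_mul, Real.exp_add]; ring
    _ = C' * (∫ ω : ℝ, Real.exp ((β + β') * |ω|) * g ω) * ‖f‖ := by
        rw [integral_const_mul]; ring

/-- The canonical inclusion `i : Exp₊ → Exp₊'`, `i(ψ)(φ) = ∫ φ(ω) ψ(ω) g(ω) dω`. -/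
def canonicalInclusion {g : ℝ → ℝ} {G : ℂ → ℂ} {δ : ℝ} (hg : IsGaussianType g G δ)
    (ψ : ExpPlus) : ExpPlusDual :=
  ⟨pairingLinear hg ψ, continuous_pairingLinear hg ψ⟩

/-- The set `V_{C,α}` of all `φ ∈ Exp₊` with `|φ(z)| exp (-α |z|) ≤ C` for `Im z ≥ 0`. -/
def boundedSet (C α : ℝ) : Set ExpPlus :=
  {φ | ∀ z : ℂ, 0 ≤ z.im → ‖φ z‖ * Real.exp (-α * ‖z‖) ≤ C}

/-- The set `i(V_{C,α})` in the dual space. -/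
def boundedImage {g : ℝ → ℝ} {G : ℂ → ℂ} {δ : ℝ} (hg : IsGaussianType g G δ) (C α : ℝ) :
    Set ExpPlusDual :=
  canonicalInclusion hg '' boundedSet C α

/-- The topology which a subset of the dual space inherits from the topology `τ`. -/
@[reducible]
def topologyOn (τ : TopologicalSpace ExpPlusDual) (S : Set ExpPlusDual) : TopologicalSpace S :=
  TopologicalSpace.induced ((↑) : S → ExpPlusDual) τ

/-! ### Generalized eigenfunctions -/

/-- `μ = μ(lam)`, the analytic continuation from right to left of the functional
`φ ↦ ∫ φ(ω) g(ω) / (lam - iω) dω`. -/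
def IsGeneralizedEigenfunction (g : ℝ → ℝ) (G : ℂ → ℂ) (lam : ℂ) (μ : ExpPlusDual) : Prop :=
  (lam.re < 0 → ∀ φ : ExpPlus,
    μ φ = (∫ ω : ℝ, φ ω * (g ω : ℂ) / (lam - Complex.I * ω)) +
      2 * Real.pi * φ (-Complex.I * lam) * G (-Complex.I * lam)) ∧
  (lam.re = 0 → ∀ φ : ExpPlus,
    Tendsto (fun x : ℝ => ∫ ω : ℝ, φ ω * (g ω : ℂ) / ((lam + x) - Complex.I * ω))
      (𝓝[>] 0) (𝓝 (μ φ)))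

/-! ### The Kuramoto model -/

/-- The moments `Z_j(t, ω) = ∫ e^{ijθ} dρ_t(θ, ω)` of a family of measures on `ℝ / 2πℤ`
(there, Mathlib's monomial `fourier j` is `θ ↦ e^{ijθ}`). -/
def circleMoment (ρ : ℝ → Kernel ℝ (AddCircle (2 * Real.pi))) (j : ℕ) (t ω : ℝ) : ℂ :=
  ∫ θ : AddCircle (2 * Real.pi), fourier (j : ℤ) θ ∂(ρ t ω)

/-- The order parameter `η(t) = ∫ Z_1(t, ω) g(ω) dω`. -/
def orderParameter (g : ℝ → ℝ) (ρ : ℝ → Kernel ℝ (AddCircle (2 * Real.pi))) (t : ℝ) : ℂ :=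
  ∫ ω : ℝ, circleMoment ρ 1 t ω * (g ω : ℂ)

/-- Weak solutions, for `t ≥ 0`, of the continuous Kuramoto model with coupling `K`, frequency
density `g` and initial distribution `h`: probability measures `ρ_t(·, ω)` on the circle, measurable
in `ω`, with `ρ_0(·, ω) = h`, the moments of which solve
`dZ_j/dt = ijω Z_j + (jK/2) (η Z_{j-1} - conj η Z_{j+1})`, `j ≥ 1` (note that `Z_0 = 1`). -/
structure IsKuramotoSolution (K : ℝ) (g : ℝ → ℝ) (h : Measure (AddCircle (2 * Real.pi)))
    (ρ : ℝ → Kernel ℝ (AddCircle (2 * Real.pi))) : Prop where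
  markov : ∀ t, 0 ≤ t → IsMarkovKernel (ρ t)
  initial : ∀ ω, ρ 0 ω = h
  moments : ∀ j : ℕ, 1 ≤ j → ∀ ω t : ℝ, 0 ≤ t →
    HasDerivWithinAt (fun s => circleMoment ρ j s ω)
      (j * Complex.I * ω * circleMoment ρ j t ω + j * K / 2 *
        (orderParameter g ρ t * circleMoment ρ (j - 1) t ω -
          (starRingEnd ℂ) (orderParameter g ρ t) * circleMoment ρ (j + 1) t ω))
      (Set.Ici 0) t

end

end Kuramoto

/-!
The functionals `i(ψ)`, `ψ ∈ V_{C,α}`, are dominated by the weighted `L¹`-norm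
`φ ↦ C ∫ exp (α |ω|) |φ(ω)| g(ω) dω`. By Cauchy's estimate and the decay of `g`, the unit ball of
each `Exp₊(β, n)` is precompact for this norm. So on the set of all functionals dominated in this
way, weak convergence is uniform on the unit ball of each `Exp₊(β, n)`; this set is weakly compact
because it is weakly closed and pointwise bounded. Every bounded subset of `Exp₊` lies in a ball of
one of the spaces `Exp₊(β, n)`, so that the projective topology is the strong one. The closure of
`i(V_{C,α})` is connected because `i(V_{C,α})` is balanced.

A rank one projection `i(ψ) ↦ c ⟨ψ | μ⟩ μ` is continuous as soon as `⟨ψₖ | μ⟩ → 0` whenever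
`i(ψₖ) → 0` weakly with `ψₖ` in a multiple of `V_{C,α}`. The functions `φ g`, `φ ∈ Exp₊`, are dense
in the space `L¹` with weight `exp (α |ω|)`, so such a sequence tends to zero when tested against
every function of this space. Carleman's formula, with a kernel which damps the part of the boundary
of a rectangle off the real axis, then gives `ψₖ → 0` pointwise on the open upper half plane. The
functional `μ_λ` is a combination of integrals over the real line, values in the upper half plane
and, when `λ` is imaginary, integrals along a contour which avoids the pole on the real axis.

For the Kuramoto model, the hierarchy of the moments is linear once `η` is given, and the energies
`∑ |X_j|² / j²` show that its bounded solution is unique. This solution consists of the moments of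
the image of `h` under the Möbius transformations of the disc which integrate the Riccati equation
`ζ' = iωζ + (K/2) (η - conj η ζ²)`. They depend holomorphically on `ω` and still map the disc into
itself for `Im ω ≥ 0`, so that the moments are bounded by `1` there.
-/

namespace Kuramoto

noncomputable section

/-! ### Bounded subsets of the inductive limit -/

theorem inclusionLinear_apply {β n : ℕ} (f : ExpBanach β n) {z : ℂ} (hz : 0 ≤ z.im) :
    inclusionLinear β n f z = f.1 z :=
  Set.indicator_of_mem (s := {z : ℂ | 0 ≤ z.im}) hz _

theorem ExpPlus.ext {φ ψ : ExpPlus} (h : ∀ z : ℂ, 0 ≤ z.im → φ z = ψ z) : φ = ψ := by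
  refine Subtype.ext (funext fun z => ?_)
  rcases le_or_gt 0 z.im with hz | hz
  · exact h z hz
  · rw [φ.2.1 z hz, ψ.2.1 z hz]

theorem ExpPlus.exists_inclusion_eq (φ : ExpPlus) :
    ∃ (β n : ℕ) (f : ExpBanach β n), inclusion β n f = φ := by
  obtain ⟨-, β, n, F, hF, h⟩ := φ.2
  exact ⟨β, n, ⟨F, hF⟩, ExpPlus.ext fun z hz =>
    (inclusionLinear_apply (⟨F, hF⟩ : ExpBanach β n) hz).trans (h z hz).symm⟩

theorem region_anti {n n' : ℕ} (hn : n ≤ n') : region n' ⊆ region n := fun z hz => by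
  have : 1 / ((n' : ℝ) + 1) ≤ 1 / ((n : ℝ) + 1) := by gcongr
  simp only [region, Set.mem_ofPred_eq] at hz ⊢
  linarith

theorem exists_inclusion_eq_of_le {β β' n n' : ℕ} (hβ : β ≤ β') (hn : n ≤ n')
    (f : ExpBanach β n) :
    ∃ f' : ExpBanach β' n', inclusion β' n' f' = inclusion β n f ∧ ‖f'‖ ≤ ‖f‖ := by
  have heq : Set.EqOn ((region n').indicator f.1) f.1 (region n') :=
    fun z hz => Set.indicator_of_mem hz f.1
  have hle : 1 / ((n' : ℝ) + 1) ≤ 1 / ((n : ℝ) + 1) := by gcongr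
  have hbound : ∀ z ∈ region n',
      Real.exp (-(β' : ℝ) * ‖z‖) * ‖(region n').indicator f.1 z‖ ≤ ‖f‖ := fun z hz => by
    have hβ' : (β : ℝ) ≤ β' := by exact_mod_cast hβ
    rw [heq hz]
    refine le_trans ?_ (expBanach_le_norm f (region_anti hn hz))
    gcongr
  let f' : ExpBanach β' n' := ⟨(region n').indicator f.1,
    (f.2.1.mono fun z hz => by simp only [Set.mem_ofPred_eq] at hz ⊢; linarith).congr
      fun z hz => heq (by simp only [region, Set.mem_ofPred_eq] at hz ⊢; linarith),
    (f.2.2.1.mono (region_anti hn)).congr heq,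
    fun z hz => Set.indicator_of_notMem hz f.1, ‖f‖, hbound⟩
  refine ⟨f', ExpPlus.ext fun z hz => ?_, expBanach_norm_le f' hbound⟩
  exact (inclusionLinear_apply f' hz).trans
    ((heq (real_mem_region n' z hz)).trans (inclusionLinear_apply f hz).symm)

theorem ExpBanach.eq_zero_of_eqOn_upperHalfPlane {β n : ℕ} {f : ExpBanach β n}
    (hf : ∀ z : ℂ, 0 ≤ z.im → f.1 z = 0) : f = 0 := by
  set U : Set ℂ := {z | -(1 / ((n : ℝ) + 1)) < z.im} with hU
  have hn : (0 : ℝ) < 1 / ((n : ℝ) + 1) := by positivity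
  have hopen : IsOpen U := isOpen_lt continuous_const Complex.continuous_im
  have hinterior : Set.EqOn f.1 0 U := by
    refine (f.2.1.analyticOnNhd hopen).eqOn_zero_of_preconnected_of_eventuallyEq_zero
      (convex_halfSpace_im_gt _).isPreconnected (z₀ := Complex.I) ?_ ?_
    · simp only [Set.mem_ofPred_eq, Complex.I_im]
      linarith
    · filter_upwards [(isOpen_lt continuous_const Complex.continuous_im).mem_nhds
        (show (0 : ℝ) < Complex.I.im by simp)] with z hz using hf z (le_of_lt hz)
  have hregion : Set.EqOn f.1 0 (region n) :=
    hinterior.of_subset_closure f.2.2.1 continuousOn_const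
      (fun z hz => by simp only [hU, region, Set.mem_ofPred_eq] at hz ⊢; exact hz.le)
      (by rw [hU, Complex.closure_setOfPred_lt_im]; exact fun z hz => hz)
  refine Subtype.ext (funext fun z => ?_)
  by_cases hz : z ∈ region n
  · exact hregion hz
  · exact f.2.2.2.1 z hz

theorem inclusion_injective (β n : ℕ) : Function.Injective (inclusion β n) := by
  rw [injective_iff_map_eq_zero]
  refine fun f hf => ExpBanach.eq_zero_of_eqOn_upperHalfPlane fun z hz => ?_
  rw [← inclusionLinear_apply f hz]
  exact congrFun (congrArg Subtype.val hf) z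

theorem isClosed_expPlus_iff {S : Set ExpPlus} :
    IsClosed S ↔ ∀ β n : ℕ, IsClosed (inclusion β n ⁻¹' S) := by
  refine ⟨fun h β n => h.preimage (inclusion β n).continuous, fun h => ?_⟩
  rw [← isOpen_compl_iff]
  exact isOpen_iSup_iff.2 fun β => isOpen_iSup_iff.2 fun n =>
    isOpen_coinduced.2 (h β n).isOpen_compl

theorem isClosed_range_of_lt_norm {x : ℕ → ExpPlus}
    (hx : ∀ (β n k : ℕ) (f : ExpBanach β n), β ≤ k → n ≤ k → inclusion β n f = x k → k < ‖f‖) :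
    IsClosed (Set.range x) := by
  refine isClosed_expPlus_iff.2 fun β n => ?_
  rw [← Set.iUnion_singleton_eq_range, Set.preimage_iUnion]
  refine LocallyFinite.isClosed_iUnion (fun f => ?_) fun k => Set.Subsingleton.isClosed
    fun f hf f' hf' => inclusion_injective β n (hf.trans hf'.symm)
  obtain ⟨N, hN⟩ := exists_nat_gt (‖f‖ + 1)
  refine ⟨Metric.ball f 1, Metric.ball_mem_nhds f one_pos,
    (Set.finite_lt_nat (max N (max β n))).subset ?_⟩
  rintro k ⟨f', hf', hdist⟩
  by_contra! hk
  simp only [Set.mem_ofPred_eq, not_lt, max_le_iff] at hk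
  have hlarge : (k : ℝ) < ‖f'‖ := hx β n k f' hk.2.1 hk.2.2 hf'
  have hNk : (N : ℝ) ≤ k := by exact_mod_cast hk.1
  rw [Metric.mem_ball, dist_eq_norm] at hdist
  linarith [norm_sub_norm_le f' f]

theorem exists_subset_image_closedBall {S : Set ExpPlus} (hS : Bornology.IsVonNBounded ℂ S) :
    ∃ k : ℕ, S ⊆ inclusion k k '' Metric.closedBall 0 ((k : ℝ) ^ 2) := by
  by_contra! hcon
  simp only [Set.not_subset] at hcon
  choose f hfS hf using hcon
  -- The rescaled sequence tends to `0` by boundedness, yet its range is closed and omits `0`.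
  set x : ℕ → ExpPlus := fun k => ((k : ℂ) + 1)⁻¹ • f (k + 1) with hx
  have hlarge : ∀ (β n k : ℕ) (u : ExpBanach β n), β ≤ k → n ≤ k →
      inclusion β n u = x k → k < ‖u‖ := by
    intro β n k u hβ hn hu
    by_contra! hle
    obtain ⟨u', hu', hle'⟩ := exists_inclusion_eq_of_le (hβ.trans k.le_succ) (hn.trans k.le_succ) u
    refine hf (k + 1) ⟨((k : ℂ) + 1) • u', ?_, ?_⟩
    · rw [mem_closedBall_zero_iff, norm_smul, show ‖(k : ℂ) + 1‖ = (k : ℝ) + 1 by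
        exact_mod_cast Complex.norm_natCast (k + 1)]
      push_cast
      nlinarith [norm_nonneg u']
    · rw [map_smul, hu', hu, hx, smul_inv_smul₀ (Nat.cast_add_one_ne_zero k)]
  have hzero : (0 : ExpPlus) ∉ Set.range x := by
    rintro ⟨k, hk⟩
    have := hlarge 0 0 k 0 k.zero_le k.zero_le (by rw [map_zero, hk])
    rw [norm_zero] at this
    exact absurd this (not_lt.2 (Nat.cast_nonneg k))
  have hscale : Tendsto (fun k : ℕ => ((k : ℂ) + 1)⁻¹) atTop (𝓝 0) := by
    simpa only [one_div] using tendsto_one_div_add_atTop_nhds_zero_nat (𝕜 := ℂ)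
  have hlim : Tendsto x atTop (𝓝 0) :=
    hS.smul_tendsto_zero (Eventually.of_forall fun k => hfS (k + 1)) hscale
  obtain ⟨k, hk⟩ := (hlim.eventually
    ((isClosed_range_of_lt_norm hlarge).isOpen_compl.mem_nhds hzero)).exists
  exact hk ⟨k, rfl⟩

/-! ### Comparison of the dual topologies -/

theorem tendsto_projective_iff {ι : Type*} {l : Filter ι} {u : ι → ExpPlusDual}
    {μ : ExpPlusDual} :
    Tendsto u l (@nhds _ projectiveTopology μ) ↔
      ∀ β n : ℕ, Tendsto (fun i => ‖(u i - μ).comp (inclusion β n)‖) l (𝓝 0) := by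
  simp only [nhds_iInf, nhds_induced, tendsto_iInf, tendsto_comap_iff]
  refine forall_congr' fun β => forall_congr' fun n => ?_
  rw [tendsto_iff_norm_sub_tendsto_zero]
  rfl

theorem tendsto_weak_iff {ι : Type*} {l : Filter ι} {u : ι → ExpPlusDual} {μ : ExpPlusDual} :
    Tendsto u l (@nhds _ weakDualTopology μ) ↔ ∀ φ, Tendsto (fun i => u i φ) l (𝓝 (μ φ)) := by
  rw [nhds_induced, tendsto_comap_iff, tendsto_pi_nhds]
  rfl

theorem projective_le_of_tendsto {τ : TopologicalSpace ExpPlusDual}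
    (h : ∀ (l : Filter ExpPlusDual) (μ : ExpPlusDual),
      (∀ β n : ℕ, Tendsto (fun ν : ExpPlusDual => ‖(ν - μ).comp (inclusion β n)‖) l (𝓝 0)) →
        Tendsto id l (@nhds _ τ μ)) :
    projectiveTopology ≤ τ :=
  le_of_nhds_le_nhds fun μ => h _ μ (tendsto_projective_iff.1 tendsto_id)

theorem norm_apply_inclusion_le (μ : ExpPlusDual) {β n : ℕ} (f : ExpBanach β n) :
    ‖μ (inclusion β n f)‖ ≤ ‖μ.comp (inclusion β n)‖ * ‖f‖ :=
  (μ.comp (inclusion β n)).le_opNorm f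

theorem projective_le_strong : projectiveTopology ≤ strongDualTopology := by
  refine projective_le_of_tendsto fun l μ h => ?_
  refine (UniformConvergenceCLM.tendsto_iff_tendstoUniformlyOn (RingHom.id ℂ) ℂ
    {S : Set ExpPlus | Bornology.IsVonNBounded ℂ S}).2 fun S hS => ?_
  obtain ⟨k, hk⟩ := exists_subset_image_closedBall hS
  rw [Metric.tendstoUniformlyOn_iff]
  intro ε hε
  have hlim := (h k k).mul_const ((k : ℝ) ^ 2)
  rw [zero_mul] at hlim
  filter_upwards [hlim.eventually_lt_const hε] with ν hν φ hφ
  obtain ⟨f, hf, rfl⟩ := hk hφ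
  rw [mem_closedBall_zero_iff] at hf
  rw [dist_comm, dist_eq_norm]
  calc ‖(ν - μ) (inclusion k k f)‖ ≤ ‖(ν - μ).comp (inclusion k k)‖ * ‖f‖ :=
        norm_apply_inclusion_le (ν - μ) f
    _ ≤ ‖(ν - μ).comp (inclusion k k)‖ * (k : ℝ) ^ 2 := by gcongr
    _ < ε := hν

theorem strong_le_projective : strongDualTopology ≤ projectiveTopology :=
  le_iInf fun β => le_iInf fun n =>
    continuous_iff_le_induced.1 (ContinuousLinearMap.precomp ℂ (inclusion β n)).continuous

theorem projective_eq_strong : projectiveTopology = strongDualTopology :=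
  le_antisymm projective_le_strong strong_le_projective

theorem projective_le_weak : projectiveTopology ≤ weakDualTopology := by
  refine projective_le_of_tendsto fun l μ h => tendsto_weak_iff.2 fun φ => ?_
  obtain ⟨β, n, f, rfl⟩ := φ.exists_inclusion_eq
  have hlim := (h β n).mul_const ‖f‖
  rw [zero_mul] at hlim
  exact tendsto_iff_norm_sub_tendsto_zero.2 <| squeeze_zero (fun _ => norm_nonneg _)
    (fun ν => norm_apply_inclusion_le (ν - μ) f) hlim

theorem t2Space_weak : @T2Space _ weakDualTopology :=
  @T2Space.of_injective_continuous _ _ weakDualTopology _ _ _ DFunLike.coe_injective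
    continuous_induced_dom

/-! ### The metric of a countable family of seminorms -/

section SaturatedSum

theorem div_one_add_le_one {a : ℝ} (ha : 0 ≤ a) : a / (1 + a) ≤ 1 :=
  div_le_one_of_le₀ (by linarith) (by positivity)

theorem div_one_add_mono {a b : ℝ} (ha : 0 ≤ a) (hab : a ≤ b) : a / (1 + a) ≤ b / (1 + b) := by
  rw [div_le_div_iff₀ (by positivity) (by linarith)]
  linarith

theorem div_one_add_le_add {a b c : ℝ} (ha : 0 ≤ a) (hb : 0 ≤ b) (hc : 0 ≤ c) (h : c ≤ a + b) :
    c / (1 + c) ≤ a / (1 + a) + b / (1 + b) := by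
  refine (div_one_add_mono hc h).trans ?_
  rw [add_div]
  gcongr <;> linarith

theorem tendsto_div_one_add_iff {α : Type*} {l : Filter α} {a : α → ℝ} (ha : ∀ x, 0 ≤ a x) :
    Tendsto (fun x => a x / (1 + a x)) l (𝓝 0) ↔ Tendsto a l (𝓝 0) := by
  constructor <;> intro h
  · have hinv := h.div (tendsto_const_nhds (x := (1 : ℝ)).sub h) (by norm_num)
    rw [zero_div] at hinv
    refine hinv.congr fun x => ?_
    have : 1 + a x ≠ 0 := by linarith [ha x]
    simp only [Pi.div_apply]
    field_simp
    ring
  · have := h.div (tendsto_const_nhds (x := (1 : ℝ)).add h) (by norm_num)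
    rwa [zero_div] at this

variable {ι : Type*} {w a b c : ι → ℝ}

/-- The series `∑ i, wᵢ aᵢ / (1 + aᵢ)`, by which the distances `aᵢ` are combined into one metric;
both `distBeta` and `dualDist` have this form. -/
def saturatedSum (w a : ι → ℝ) : ℝ := ∑' i, w i * (a i / (1 + a i))

theorem saturatedSum_nonneg (hw₀ : ∀ i, 0 < w i) (ha : ∀ i, 0 ≤ a i) : 0 ≤ saturatedSum w a :=
  tsum_nonneg fun i => mul_nonneg (hw₀ i).le (div_nonneg (ha i) (by linarith [ha i]))

theorem summable_saturatedSum (hw : Summable w) (hw₀ : ∀ i, 0 < w i) (ha : ∀ i, 0 ≤ a i) :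
    Summable fun i => w i * (a i / (1 + a i)) :=
  hw.of_nonneg_of_le (fun i => mul_nonneg (hw₀ i).le (div_nonneg (ha i) (by linarith [ha i])))
    fun i => mul_le_of_le_one_right (hw₀ i).le (div_one_add_le_one (ha i))

theorem saturatedSum_le_add (hw : Summable w) (hw₀ : ∀ i, 0 < w i) (ha : ∀ i, 0 ≤ a i)
    (hb : ∀ i, 0 ≤ b i) (hc : ∀ i, 0 ≤ c i) (h : ∀ i, c i ≤ a i + b i) :
    saturatedSum w c ≤ saturatedSum w a + saturatedSum w b := by
  have hsa := summable_saturatedSum hw hw₀ ha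
  have hsb := summable_saturatedSum hw hw₀ hb
  unfold saturatedSum
  rw [← hsa.tsum_add hsb]
  refine (summable_saturatedSum hw hw₀ hc).tsum_le_tsum (fun i => ?_) (hsa.add hsb)
  rw [← mul_add]
  exact mul_le_mul_of_nonneg_left (div_one_add_le_add (ha i) (hb i) (hc i) (h i)) (hw₀ i).le

theorem saturatedSum_eq_zero_iff (hw : Summable w) (hw₀ : ∀ i, 0 < w i) (ha : ∀ i, 0 ≤ a i) :
    saturatedSum w a = 0 ↔ ∀ i, a i = 0 := by
  rw [saturatedSum, ← (summable_saturatedSum hw hw₀ ha).hasSum_iff, hasSum_zero_iff_of_nonneg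
    fun i => mul_nonneg (hw₀ i).le (div_nonneg (ha i) (by linarith [ha i])), funext_iff]
  refine forall_congr' fun i => ?_
  have : 1 + a i ≠ 0 := by linarith [ha i]
  simp [(hw₀ i).ne', this]

theorem tendsto_saturatedSum_iff {α : Type*} {l : Filter α} {a : α → ι → ℝ} (hw : Summable w)
    (hw₀ : ∀ i, 0 < w i) (ha : ∀ x i, 0 ≤ a x i) :
    Tendsto (fun x => saturatedSum w (a x)) l (𝓝 0) ↔ ∀ i, Tendsto (fun x => a x i) l (𝓝 0) := by
  have hterm : ∀ x i, 0 ≤ a x i / (1 + a x i) := fun x i =>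
    div_nonneg (ha x i) (by linarith [ha x i])
  constructor <;> intro h
  · intro i
    rw [← tendsto_div_one_add_iff fun x => ha x i]
    have hlim := h.const_mul (w i)⁻¹
    rw [mul_zero] at hlim
    refine squeeze_zero (fun x => hterm x i) (fun x => ?_) hlim
    rw [le_inv_mul_iff₀ (hw₀ i)]
    exact (summable_saturatedSum hw hw₀ (ha x)).le_tsum i
      fun j _ => mul_nonneg (hw₀ j).le (hterm x j)
  · have hlim := tendsto_tsum_of_dominated_convergence
      (f := fun x i => w i * (a x i / (1 + a x i))) (𝓕 := l) (g := fun _ => (0 : ℝ)) hw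
      (fun i => by
        have := ((tendsto_div_one_add_iff fun x => ha x i).2 (h i)).const_mul (w i)
        rwa [mul_zero] at this)
      (Eventually.of_forall fun x i => by
        rw [Real.norm_of_nonneg (mul_nonneg (hw₀ i).le (hterm x i))]
        exact mul_le_of_le_one_right (hw₀ i).le (div_one_add_le_one (ha x i)))
    rwa [tsum_zero] at hlim

end SaturatedSum

theorem summable_one_div_two_pow : Summable fun n : ℕ => (1 : ℝ) / 2 ^ n := by
  simpa [one_div] using summable_geometric_two

theorem summable_one_div_two_pow_succ : Summable fun n : ℕ => (1 : ℝ) / 2 ^ (n + 1) :=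
  (summable_nat_add_iff 1).2 summable_one_div_two_pow

theorem distBeta_eq_saturatedSum (β : ℕ) (μ ν : ExpPlusDual) :
    distBeta β μ ν =
      saturatedSum (fun n => 1 / 2 ^ (n + 1)) fun n => ‖(μ - ν).comp (inclusion β n)‖ :=
  rfl

theorem dualDist_eq_saturatedSum (μ ν : ExpPlusDual) :
    dualDist μ ν = saturatedSum (fun β => 1 / 2 ^ β) fun β => distBeta β μ ν :=
  rfl

theorem distBeta_nonneg (β : ℕ) (μ ν : ExpPlusDual) : 0 ≤ distBeta β μ ν :=
  saturatedSum_nonneg (fun _ => by positivity) fun _ => norm_nonneg _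

theorem distBeta_eq_zero_iff {β : ℕ} {μ ν : ExpPlusDual} :
    distBeta β μ ν = 0 ↔ ∀ n, ‖(μ - ν).comp (inclusion β n)‖ = 0 :=
  saturatedSum_eq_zero_iff summable_one_div_two_pow_succ (fun _ => by positivity)
    fun _ => norm_nonneg _

theorem dualDist_eq_zero_iff {μ ν : ExpPlusDual} : dualDist μ ν = 0 ↔ μ = ν := by
  rw [dualDist_eq_saturatedSum, saturatedSum_eq_zero_iff summable_one_div_two_pow
    (fun _ => by positivity) fun β => distBeta_nonneg β μ ν]
  simp only [distBeta_eq_zero_iff]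
  constructor
  · intro h
    refine ContinuousLinearMap.ext fun φ => ?_
    obtain ⟨β, n, f, rfl⟩ := φ.exists_inclusion_eq
    have hle := norm_apply_inclusion_le (μ - ν) f
    rw [h β n, zero_mul, norm_le_zero_iff] at hle
    exact sub_eq_zero.1 hle
  · rintro rfl β n
    rw [sub_self, ContinuousLinearMap.zero_comp, norm_zero]

theorem dualDist_comm (μ ν : ExpPlusDual) : dualDist μ ν = dualDist ν μ := by
  simp only [dualDist, distBeta, ContinuousLinearMap.sub_comp, norm_sub_rev (μ.comp _)]

theorem dualDist_triangle (μ ν κ : ExpPlusDual) :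
    dualDist μ κ ≤ dualDist μ ν + dualDist ν κ := by
  refine saturatedSum_le_add summable_one_div_two_pow (fun _ => by positivity)
    (fun β => distBeta_nonneg β _ _) (fun β => distBeta_nonneg β _ _)
    (fun β => distBeta_nonneg β _ _) fun β => ?_
  refine saturatedSum_le_add summable_one_div_two_pow_succ (fun _ => by positivity)
    (fun _ => norm_nonneg _) (fun _ => norm_nonneg _) (fun _ => norm_nonneg _) fun n => ?_
  simp only [ContinuousLinearMap.sub_comp]
  exact norm_sub_le_norm_sub_add_norm_sub _ _ _

theorem tendsto_projective_iff_dualDist {ι : Type*} {l : Filter ι} {u : ι → ExpPlusDual}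
    {μ : ExpPlusDual} :
    Tendsto u l (@nhds _ projectiveTopology μ) ↔
      Tendsto (fun i => dualDist (u i) μ) l (𝓝 0) := by
  simp only [tendsto_projective_iff, dualDist_eq_saturatedSum]
  rw [tendsto_saturatedSum_iff summable_one_div_two_pow (fun _ => by positivity)
    fun i β => distBeta_nonneg β (u i) μ]
  refine forall_congr' fun β => ?_
  simp only [distBeta_eq_saturatedSum]
  exact (tendsto_saturatedSum_iff summable_one_div_two_pow_succ (fun _ => by positivity)
    fun i n => norm_nonneg _).symm

/-- The metric `d` on a set of functionals. -/
@[reducible]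
def dualMetricOn (S : Set ExpPlusDual) : MetricSpace S where
  dist x y := dualDist x y
  dist_self _ := dualDist_eq_zero_iff.2 rfl
  dist_comm _ _ := dualDist_comm _ _
  dist_triangle _ _ _ := dualDist_triangle _ _ _
  eq_of_dist_eq_zero h := Subtype.ext (dualDist_eq_zero_iff.1 h)

theorem dualMetricOn_topology (S : Set ExpPlusDual) :
    (dualMetricOn S).toUniformSpace.toTopologicalSpace = topologyOn projectiveTopology S := by
  have hiff : ∀ (l : Filter S) (x : S),
      l ≤ @nhds _ (dualMetricOn S).toUniformSpace.toTopologicalSpace x ↔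
        l ≤ @nhds _ (topologyOn projectiveTopology S) x := fun l x => by
    rw [@nhds_induced _ _ projectiveTopology, ← tendsto_id', ← tendsto_id', tendsto_comap_iff,
      tendsto_projective_iff_dualDist,
      @tendsto_iff_dist_tendsto_zero _ _ (dualMetricOn S).toPseudoMetricSpace]
    rfl
  exact TopologicalSpace.ext_nhds fun x =>
    le_antisymm ((hiff _ x).1 le_rfl) ((hiff _ x).2 le_rfl)

/-! ### Estimates in `Exp₊(β, n)` -/

theorem expBanach_norm_apply_le {β n : ℕ} (f : ExpBanach β n) {z : ℂ} (hz : z ∈ region n) :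
    ‖f.1 z‖ ≤ ‖f‖ * Real.exp (β * ‖z‖) := by
  have h := expBanach_le_norm f hz
  rwa [neg_mul, Real.exp_neg, inv_mul_le_iff₀ (Real.exp_pos _), mul_comm] at h

theorem norm_inclusion_ofReal_le {β n : ℕ} (f : ExpBanach β n) (ω : ℝ) :
    ‖inclusion β n f ω‖ ≤ ‖f‖ * Real.exp (β * |ω|) := by
  have h := expBanach_norm_apply_le f (real_mem_region n (ω : ℂ) (by simp))
  rwa [Complex.norm_real, Real.norm_eq_abs, ← inclusionLinear_apply f (by simp)] at h

theorem ExpPlus.continuousOn (φ : ExpPlus) : ContinuousOn (fun z => φ z) {z : ℂ | 0 ≤ z.im} := by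
  obtain ⟨-, β, n, F, hF, h⟩ := φ.2
  exact (hF.2.1.mono fun z hz => real_mem_region n z hz).congr fun z hz => h z hz

theorem ExpPlus.differentiableOn (φ : ExpPlus) :
    DifferentiableOn ℂ (fun z => φ z) {z : ℂ | 0 < z.im} := by
  obtain ⟨-, β, n, F, hF, h⟩ := φ.2
  refine (hF.1.mono fun z hz => ?_).congr fun z hz => h z (le_of_lt hz)
  have : (0 : ℝ) < 1 / ((n : ℝ) + 1) := by positivity
  simp only [Set.mem_ofPred_eq] at hz ⊢
  linarith

theorem ExpPlus.measurable (φ : ExpPlus) : Measurable fun z => φ z := by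
  classical
  have hs : MeasurableSet {z : ℂ | 0 ≤ z.im} :=
    (isClosed_le continuous_const Complex.continuous_im).measurableSet
  have h := φ.continuousOn.measurable_piecewise (g := fun _ => (0 : ℂ)) continuousOn_const hs
  convert h using 1
  funext z
  by_cases hz : 0 ≤ z.im
  · exact (Set.piecewise_eq_of_mem {z : ℂ | 0 ≤ z.im} _ _ hz).symm
  · exact (φ.2.1 z (not_le.1 hz)).trans
      (Set.piecewise_eq_of_notMem {z : ℂ | 0 ≤ z.im} (fun z => φ z) (fun _ => (0 : ℂ)) hz).symm

theorem ExpPlus.exists_bound (φ : ExpPlus) :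
    ∃ (β : ℕ) (C : ℝ), ∀ z : ℂ, 0 ≤ z.im → ‖φ z‖ ≤ C * Real.exp (β * ‖z‖) := by
  obtain ⟨β, n, f, rfl⟩ := φ.exists_inclusion_eq
  refine ⟨β, ‖f‖, fun z hz => ?_⟩
  have e : inclusion β n f z = f.1 z := inclusionLinear_apply f hz
  rw [e]
  exact expBanach_norm_apply_le f (real_mem_region n z hz)

theorem exists_lipschitz_unitBall (β n : ℕ) (R : ℝ) :
    ∃ M : ℝ, 0 ≤ M ∧ ∀ f : ExpBanach β n, ‖f‖ ≤ 1 → ∀ x y : ℝ, |x| ≤ R → |y| ≤ R →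
      ‖inclusion β n f x - inclusion β n f y‖ ≤ M * |x - y| := by
  set r : ℝ := 1 / ((n : ℝ) + 1) / 2 with hr
  have hr0 : 0 < r := by positivity
  have hr1 : 1 / ((n : ℝ) + 1) = 2 * r := by rw [hr]; ring
  refine ⟨Real.exp (β * (R + r)) / r, by positivity, fun f hf x y hx hy => ?_⟩
  have hball (c : ℝ) : Metric.closedBall (c : ℂ) r ⊆ {z : ℂ | -(1 / ((n : ℝ) + 1)) < z.im} := by
    intro z hz
    have hzc := (Complex.abs_im_le_norm (z - c)).trans (mem_closedBall_iff_norm.1 hz)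
    simp only [Complex.sub_im, Complex.ofReal_im, sub_zero, Set.mem_ofPred_eq] at hzc ⊢
    rw [hr1]
    linarith [(abs_le.1 hzc).1]
  have hderiv : ∀ c ∈ Set.Icc (-R) R, ‖deriv f.1 (c : ℂ)‖ ≤ Real.exp (β * (R + r)) / r := by
    intro c hc
    refine Complex.norm_deriv_le_of_forall_mem_sphere_norm_le hr0
      (DifferentiableOn.diffContOnCl_ball (f.2.1.mono (hball c)) subset_rfl) fun z hz => ?_
    have hz' : -(1 / ((n : ℝ) + 1)) < z.im := hball c (Metric.sphere_subset_closedBall hz)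
    have hzR : ‖z‖ ≤ R + r := by
      have hzc := norm_le_norm_add_norm_sub' z c
      rw [mem_sphere_iff_norm.1 hz, Complex.norm_real, Real.norm_eq_abs] at hzc
      linarith [abs_le.2 hc]
    calc ‖f.1 z‖ ≤ ‖f‖ * Real.exp (β * ‖z‖) := expBanach_norm_apply_le f hz'.le
      _ ≤ 1 * Real.exp (β * (R + r)) := by gcongr
      _ = _ := one_mul _
  have hdiff (c : ℝ) : HasDerivAt (fun t : ℝ => f.1 t) (deriv f.1 c) c :=
    (f.2.1.differentiableAt ((isOpen_lt continuous_const Complex.continuous_im).mem_nhds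
      (hball c (Metric.mem_closedBall_self hr0.le)))).hasDerivAt.comp_ofReal
  have hlip := (convex_Icc (-R) R).norm_image_sub_le_of_norm_hasDerivWithin_le
    (fun c _ => (hdiff c).hasDerivWithinAt) hderiv (abs_le.1 hy) (abs_le.1 hx)
  rwa [← inclusionLinear_apply f (by simp), ← inclusionLinear_apply f (by simp)] at hlip

section Weight

variable {g : ℝ → ℝ} {G : ℂ → ℂ} {δ : ℝ}

theorem IsGaussianType.integrable (hg : IsGaussianType g G δ) : Integrable g :=
  .of_integral_ne_zero (hg.integral_eq_one ▸ one_ne_zero)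

theorem IsGaussianType.eventually_tail_lt (hg : IsGaussianType g G δ) (a : ℝ) {ε : ℝ}
    (hε : 0 < ε) : ∀ᶠ R in atTop, ∫ ω in (Set.Icc (-R) R)ᶜ, Real.exp (a * |ω|) * g ω < ε := by
  have hi := hg.integrable_exp a
  have h := (aecover_Icc (μ := (volume : Measure ℝ)) tendsto_neg_atTop_atBot
    tendsto_id).integral_tendsto_of_countably_generated hi
  filter_upwards [(h.const_sub (∫ ω, Real.exp (a * |ω|) * g ω)).eventually_lt_const
    (show _ - _ < ε by rwa [sub_self])] with R hR
  rwa [setIntegral_compl measurableSet_Icc hi]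

/-- The `L¹`-norm of the restriction of `φ` to `ℝ`, for the weight `exp (α |ω|) g(ω)`. The
embedded sets `i(V_{C,α})` consist of functionals dominated by it. -/
def weightedNorm (g : ℝ → ℝ) (α : ℝ) (φ : ExpPlus) : ℝ :=
  ∫ ω : ℝ, ‖φ ω‖ * (Real.exp (α * |ω|) * g ω)

theorem integrable_weightedNorm (hg : IsGaussianType g G δ) (α : ℝ) (φ : ExpPlus) :
    Integrable fun ω : ℝ => ‖φ ω‖ * (Real.exp (α * |ω|) * g ω) := by
  obtain ⟨β, C, -, hC⟩ := expPlus_bound φ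
  refine ((hg.integrable_exp (β + α)).const_mul C).mono' ?_ (Eventually.of_forall fun ω => ?_)
  · exact ((expPlus_continuous φ).norm.mul ((Real.continuous_exp.comp
      (continuous_const.mul continuous_abs)).mul hg.continuous)).aestronglyMeasurable
  · have := hg.nonneg ω
    rw [Real.norm_of_nonneg (by positivity), add_mul, Real.exp_add]
    calc ‖φ ω‖ * (Real.exp (α * |ω|) * g ω)
        ≤ (C * Real.exp (β * |ω|)) * (Real.exp (α * |ω|) * g ω) := by gcongr; exact hC ω
      _ = _ := by ring

theorem weightedNorm_inclusion_le (hg : IsGaussianType g G δ) (α : ℝ) {β n : ℕ}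
    (f : ExpBanach β n) :
    weightedNorm g α (inclusion β n f) ≤
      ‖f‖ * ∫ ω : ℝ, Real.exp ((β + α) * |ω|) * g ω := by
  rw [← integral_const_mul]
  refine integral_mono (integrable_weightedNorm hg α _)
    ((hg.integrable_exp (β + α)).const_mul _) fun ω => ?_
  have := hg.nonneg ω
  simp only [add_mul, Real.exp_add]
  calc ‖inclusion β n f ω‖ * (Real.exp (α * |ω|) * g ω)
      ≤ (‖f‖ * Real.exp (β * |ω|)) * (Real.exp (α * |ω|) * g ω) := by
        gcongr; exact norm_inclusion_ofReal_le f ω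
    _ = _ := by ring

theorem exists_finite_net_unitBall_on_Icc (β n : ℕ) (R : ℝ) {ε : ℝ} (hε : 0 < ε) :
    ∃ t : Set (ExpBanach β n), t.Finite ∧ t ⊆ Metric.closedBall 0 1 ∧
      ∀ f : ExpBanach β n, ‖f‖ ≤ 1 → ∃ f' ∈ t, ∀ ω ∈ Set.Icc (-R) R,
        ‖inclusion β n (f - f') ω‖ ≤ ε := by
  obtain ⟨M, hM0, hM⟩ := exists_lipschitz_unitBall β n R
  let restrict : ExpBanach β n → BoundedContinuousFunction (Set.Icc (-R) R) ℂ := fun f =>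
    BoundedContinuousFunction.mkOfCompact ⟨fun x => inclusion β n f ((x : ℝ) : ℂ),
      (expPlus_continuous _).comp continuous_subtype_val⟩
  have hcompact : IsCompact (closure (restrict '' Metric.closedBall 0 1)) := by
    refine BoundedContinuousFunction.arzela_ascoli
      (Metric.closedBall (0 : ℂ) (Real.exp (β * R))) (isCompact_closedBall _ _) _ ?_ ?_
    · rintro _ x ⟨f, hf, rfl⟩
      rw [mem_closedBall_zero_iff] at hf ⊢
      calc ‖inclusion β n f (x : ℝ)‖ ≤ ‖f‖ * Real.exp (β * |(x : ℝ)|) :=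
            norm_inclusion_ofReal_le f x
        _ ≤ 1 * Real.exp (β * R) := by gcongr; exact abs_le.2 x.2
        _ = _ := one_mul _
    · refine (LipschitzWith.uniformEquicontinuous _ M.toNNReal ?_).equicontinuous
      rintro ⟨_, f, hf, rfl⟩
      refine LipschitzWith.of_dist_le_mul fun x y => ?_
      rw [dist_eq_norm, Real.coe_toNNReal M hM0, Subtype.dist_eq, Real.dist_eq]
      exact hM f (mem_closedBall_zero_iff.1 hf) x y (abs_le.2 x.2) (abs_le.2 y.2)
  obtain ⟨t, hts, htf, ht⟩ := Set.exists_subset_image_finite_and.1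
    (Metric.finite_approx_of_totallyBounded
      (hcompact.totallyBounded.subset subset_closure) ε hε)
  refine ⟨t, htf, hts, fun f hf => ?_⟩
  obtain ⟨_, ⟨f', hf't, rfl⟩, hff'⟩ : ∃ y ∈ restrict '' t, restrict f ∈ Metric.ball y ε := by
    simpa only [Set.mem_iUnion, exists_prop] using
      ht (Set.mem_image_of_mem restrict (mem_closedBall_zero_iff.2 hf))
  refine ⟨f', hf't, fun ω hω => ?_⟩
  have hsub : inclusion β n (f - f') ω = inclusion β n f ω - inclusion β n f' ω :=
    congrArg (fun φ : ExpPlus => φ ω) (map_sub (inclusion β n) f f')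
  rw [hsub, ← dist_eq_norm]
  exact ((restrict f).dist_coe_le_dist (g := restrict f') ⟨ω, hω⟩).trans (Metric.mem_ball.1 hff').le

theorem weightedNorm_inclusion_le_add_tail (hg : IsGaussianType g G δ) (α : ℝ) {β n : ℕ}
    (f : ExpBanach β n) {R η : ℝ} (hη : 0 ≤ η)
    (hf : ∀ ω ∈ Set.Icc (-R) R, ‖inclusion β n f ω‖ ≤ η) :
    weightedNorm g α (inclusion β n f) ≤ η * (∫ ω, Real.exp (α * |ω|) * g ω) +
      ‖f‖ * ∫ ω in (Set.Icc (-R) R)ᶜ, Real.exp ((β + α) * |ω|) * g ω := by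
  have hi := integrable_weightedNorm hg α (inclusion β n f)
  have hw := hg.integrable_exp α
  rw [weightedNorm, ← integral_add_compl (measurableSet_Icc (a := -R) (b := R)) hi]
  refine add_le_add ?_ ?_
  · rw [← integral_const_mul]
    calc _ ≤ ∫ ω in Set.Icc (-R) R, η * (Real.exp (α * |ω|) * g ω) := by
          refine setIntegral_mono_on hi.integrableOn (hw.const_mul η).integrableOn
            measurableSet_Icc fun ω hω => ?_
          have := hg.nonneg ω
          gcongr
          exact hf ω hω
      _ ≤ _ := setIntegral_le_integral (hw.const_mul η)
          (Eventually.of_forall fun ω =>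
            mul_nonneg hη (mul_nonneg (Real.exp_pos _).le (hg.nonneg ω)))
  · rw [← integral_const_mul]
    refine setIntegral_mono hi.integrableOn
      ((hg.integrable_exp (β + α)).const_mul _).integrableOn fun ω => ?_
    have := hg.nonneg ω
    simp only [add_mul, Real.exp_add]
    calc ‖inclusion β n f ω‖ * (Real.exp (α * |ω|) * g ω)
        ≤ (‖f‖ * Real.exp (β * |ω|)) * (Real.exp (α * |ω|) * g ω) := by
          gcongr; exact norm_inclusion_ofReal_le f ω
      _ = _ := by ring

theorem exists_finite_weightedNorm_net (hg : IsGaussianType g G δ) (α : ℝ) (β n : ℕ) {ε : ℝ}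
    (hε : 0 < ε) : ∃ t : Set (ExpBanach β n), t.Finite ∧ ∀ f : ExpBanach β n, ‖f‖ ≤ 1 →
      ∃ f' ∈ t, weightedNorm g α (inclusion β n (f - f')) ≤ ε := by
  obtain ⟨R, hR⟩ := (hg.eventually_tail_lt (β + α) (show 0 < ε / 4 by positivity)).exists
  set I : ℝ := ∫ ω, Real.exp (α * |ω|) * g ω
  have hI : 0 ≤ I := integral_nonneg fun ω => mul_nonneg (Real.exp_pos _).le (hg.nonneg ω)
  obtain ⟨t, htf, hts, ht⟩ :=
    exists_finite_net_unitBall_on_Icc β n R (show 0 < ε / 2 / (I + 1) by positivity)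
  refine ⟨t, htf, fun f hf => ?_⟩
  obtain ⟨f', hf't, hff'⟩ := ht f hf
  have hsub : ‖f - f'‖ ≤ 2 :=
    (norm_sub_le f f').trans (by linarith [mem_closedBall_zero_iff.1 (hts hf't)])
  refine ⟨f', hf't, ?_⟩
  calc weightedNorm g α (inclusion β n (f - f'))
      ≤ ε / 2 / (I + 1) * I + ‖f - f'‖ * _ :=
          weightedNorm_inclusion_le_add_tail hg α _ (by positivity) hff'
    _ ≤ ε / 2 + 2 * (ε / 4) := by
        refine add_le_add ?_ (mul_le_mul hsub hR.le (integral_nonneg fun ω =>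
          mul_nonneg (Real.exp_pos _).le (hg.nonneg ω)) zero_le_two)
        rw [div_mul_eq_mul_div]
        exact div_le_of_le_mul₀ (by positivity) (by positivity) (by gcongr; linarith)
    _ = ε := by ring

/-! ### Functionals dominated by the weighted norm -/

/-- The functionals dominated by `M` times the weighted `L¹`-norm: a weakly closed set which
contains `i(V_{M,α})`. -/
def dominatedSet (g : ℝ → ℝ) (M α : ℝ) : Set ExpPlusDual :=
  {μ | ∀ φ, ‖μ φ‖ ≤ M * weightedNorm g α φ}

theorem boundedImage_subset_dominatedSet (hg : IsGaussianType g G δ) (C α : ℝ) :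
    boundedImage hg C α ⊆ dominatedSet g C α := by
  rintro _ ⟨ψ, hψ, rfl⟩ φ
  rw [weightedNorm, ← integral_const_mul]
  refine norm_integral_le_of_norm_le ((integrable_weightedNorm hg α φ).const_mul C)
    (Eventually.of_forall fun ω => ?_)
  have h := hψ ω (by simp)
  rw [Complex.norm_real, Real.norm_eq_abs, neg_mul, Real.exp_neg,
    mul_inv_le_iff₀ (Real.exp_pos _)] at h
  have hgω := hg.nonneg ω
  rw [norm_mul, norm_mul, Complex.norm_real, Real.norm_of_nonneg hgω]
  calc ‖φ ω‖ * ‖ψ ω‖ * g ω ≤ ‖φ ω‖ * (C * Real.exp (α * |ω|)) * g ω := by gcongr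
    _ = _ := by ring

theorem continuous_of_norm_le_weightedNorm (hg : IsGaussianType g G δ) {M : ℝ} (hM : 0 ≤ M)
    (α : ℝ) (L : ExpPlus →ₗ[ℂ] ℂ) (hL : ∀ φ, ‖L φ‖ ≤ M * weightedNorm g α φ) :
    Continuous L := by
  rw [continuous_expPlus_iff]
  intro β n
  refine AddMonoidHomClass.continuous_of_bound (L.comp (inclusionLinear β n))
    (M * ∫ ω : ℝ, Real.exp ((β + α) * |ω|) * g ω) fun f => (hL _).trans ?_
  rw [mul_assoc, mul_comm (∫ ω : ℝ, _)]
  exact mul_le_mul_of_nonneg_left (weightedNorm_inclusion_le hg α f) hM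

theorem isCompact_dominatedSet_weak (hg : IsGaussianType g G δ) {M : ℝ} (hM : 0 ≤ M) (α : ℝ) :
    @IsCompact _ weakDualTopology (dominatedSet g M α) := by
  let _ : TopologicalSpace ExpPlusDual := weakDualTopology
  have hind : Topology.IsInducing (fun (μ : ExpPlusDual) (φ : ExpPlus) => μ φ) := ⟨rfl⟩
  have himage : (fun (μ : ExpPlusDual) (φ : ExpPlus) => μ φ) '' dominatedSet g M α =
      Set.univ.pi (fun φ => Metric.closedBall (0 : ℂ) (M * weightedNorm g α φ)) ∩
        ({f | ∀ φ ψ, f (φ + ψ) = f φ + f ψ} ∩ {f | ∀ (c : ℂ) φ, f (c • φ) = c • f φ}) := by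
    ext f
    constructor
    · rintro ⟨μ, hμ, rfl⟩
      exact ⟨fun φ _ => mem_closedBall_zero_iff.2 (hμ φ), map_add μ, map_smul μ⟩
    · rintro ⟨hball, hadd, hsmul⟩
      have hbound : ∀ φ, ‖f φ‖ ≤ M * weightedNorm g α φ := fun φ =>
        mem_closedBall_zero_iff.1 (hball φ trivial)
      exact ⟨⟨⟨⟨f, hadd⟩, hsmul⟩, continuous_of_norm_le_weightedNorm hg hM α _ hbound⟩,
        hbound, rfl⟩
  rw [hind.isCompact_iff, himage]
  refine (isCompact_univ_pi fun φ => isCompact_closedBall _ _).inter_right (.inter ?_ ?_)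
  · simp only [Set.ofPred_forall]
    exact isClosed_iInter fun φ => isClosed_iInter fun ψ =>
      isClosed_eq (continuous_apply _) (Continuous.add (continuous_apply φ) (continuous_apply ψ))
  · simp only [Set.ofPred_forall]
    exact isClosed_iInter fun c => isClosed_iInter fun φ =>
      isClosed_eq (continuous_apply _) (Continuous.const_smul (continuous_apply φ) c)

theorem tendsto_projective_of_tendsto_weak (hg : IsGaussianType g G δ) {M : ℝ} (hM : 0 ≤ M)
    (α : ℝ) {ι : Type*} {l : Filter ι} {u : ι → ExpPlusDual} {μ : ExpPlusDual}
    (hu : ∀ i, u i ∈ dominatedSet g M α) (hμ : μ ∈ dominatedSet g M α)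
    (h : Tendsto u l (@nhds _ weakDualTopology μ)) :
    Tendsto u l (@nhds _ projectiveTopology μ) := by
  rw [tendsto_weak_iff] at h
  rw [tendsto_projective_iff]
  intro β n
  rw [Metric.tendsto_nhds]
  intro ε hε
  obtain ⟨t, htf, ht⟩ := exists_finite_weightedNorm_net hg α β n
    (show 0 < ε / 3 / (2 * M + 1) by positivity)
  have h1 : ∀ᶠ i in l, ∀ f ∈ t, ‖(u i - μ) (inclusion β n f)‖ < ε / 3 := by
    rw [htf.eventually_all]
    intro f _
    have := tendsto_iff_norm_sub_tendsto_zero.1 (h (inclusion β n f))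
    exact this.eventually_lt_const (by positivity)
  filter_upwards [h1] with i hi
  rw [dist_zero_right, norm_norm]
  refine lt_of_le_of_lt (ContinuousLinearMap.opNorm_le_of_unit_norm
    (show 0 ≤ ε / 3 + ε / 3 by positivity) fun f hf => ?_) (show ε / 3 + ε / 3 < ε by linarith)
  obtain ⟨f', hf't, hf'⟩ := ht f hf.le
  have e : ((u i - μ).comp (inclusion β n)) f =
      (u i - μ) (inclusion β n f') + (u i - μ) (inclusion β n (f - f')) := by
    rw [← map_add, ← map_add, add_sub_cancel]; rfl
  rw [e]
  refine (norm_add_le _ _).trans (add_le_add (hi f' hf't).le ?_)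
  calc ‖(u i - μ) (inclusion β n (f - f'))‖
      ≤ ‖u i (inclusion β n (f - f'))‖ + ‖μ (inclusion β n (f - f'))‖ := norm_sub_le _ _
    _ ≤ M * (ε / 3 / (2 * M + 1)) + M * (ε / 3 / (2 * M + 1)) :=
        add_le_add ((hu i _).trans (by gcongr)) ((hμ _).trans (by gcongr))
    _ = (2 * M) / (2 * M + 1) * (ε / 3) := by ring
    _ ≤ 1 * (ε / 3) := by
        gcongr
        rw [div_le_one (by positivity)]; linarith
    _ = ε / 3 := one_mul _

theorem topologyOn_weak_eq_projective (hg : IsGaussianType g G δ) {M : ℝ} (hM : 0 ≤ M)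
    (α : ℝ) {S : Set ExpPlusDual} (hS : S ⊆ dominatedSet g M α) :
    topologyOn weakDualTopology S = topologyOn projectiveTopology S := by
  refine le_antisymm ?_ (induced_mono projective_le_weak)
  refine (@continuous_id_iff_le _ (topologyOn weakDualTopology S)
    (topologyOn projectiveTopology S)).1 ?_
  refine @continuous_iff_continuousAt _ _ (topologyOn weakDualTopology S)
    (topologyOn projectiveTopology S) _ |>.2 fun x => ?_
  have e := @nhds_induced _ _ projectiveTopology ((↑) : S → ExpPlusDual) x
  refine (tendsto_comap_iff.2 ?_).mono_right e.ge
  refine tendsto_projective_of_tendsto_weak hg hM α (fun i => hS i.2) (hS x.2) ?_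
  exact @Continuous.tendsto _ _ (topologyOn weakDualTopology S) weakDualTopology _
    (@continuous_induced_dom _ _ _ weakDualTopology) x

theorem isCompact_dominatedSet_projective (hg : IsGaussianType g G δ) {M : ℝ} (hM : 0 ≤ M)
    (α : ℝ) : @IsCompact _ projectiveTopology (dominatedSet g M α) := by
  have h := isCompact_dominatedSet_weak hg hM α
  rw [@isCompact_iff_compactSpace _ weakDualTopology] at h
  rw [@isCompact_iff_compactSpace _ projectiveTopology]
  have e := topologyOn_weak_eq_projective hg hM α (subset_refl (dominatedSet g M α))
  change @CompactSpace _ (topologyOn projectiveTopology (dominatedSet g M α))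
  rw [← e]
  exact h

theorem balanced_boundedImage (hg : IsGaussianType g G δ) (C α : ℝ) :
    Balanced ℂ (boundedImage hg C α) := by
  rintro c hc _ ⟨_, ⟨ψ, hψ, rfl⟩, rfl⟩
  refine ⟨c • ψ, fun z hz => ?_, ContinuousLinearMap.ext fun φ => ?_⟩
  · have happly : (c • ψ) z = c * ψ z := rfl
    rw [happly, norm_mul, mul_assoc]
    exact (mul_le_of_le_one_left (by positivity) hc).trans (hψ z hz)
  · change ∫ ω : ℝ, φ ω * (c * ψ ω) * (g ω : ℂ) = c * ∫ ω : ℝ, φ ω * ψ ω * (g ω : ℂ)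
    rw [← integral_const_mul]
    congr 1 with ω
    ring

theorem zero_mem_boundedImage (hg : IsGaussianType g G δ) {C : ℝ} (hC : 0 ≤ C) (α : ℝ) :
    (0 : ExpPlusDual) ∈ boundedImage hg C α := by
  refine ⟨0, fun z _ => ?_, ContinuousLinearMap.ext fun φ => ?_⟩
  · have happly : (0 : ExpPlus) z = 0 := rfl
    simpa [happly] using hC
  · change ∫ ω : ℝ, φ ω * (0 : ℂ) * (g ω : ℂ) = 0
    simp

theorem continuous_smul_projective (μ : ExpPlusDual) :
    @Continuous _ _ _ projectiveTopology fun t : ℂ => t • μ := by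
  rw [projective_eq_strong]
  exact continuous_id.smul continuous_const

theorem isConnected_boundedImage (hg : IsGaussianType g G δ) {C : ℝ} (hC : 0 ≤ C) (α : ℝ)
    {τ : TopologicalSpace ExpPlusDual} (hτ : projectiveTopology ≤ τ) :
    @IsConnected _ τ (boundedImage hg C α) := by
  refine ⟨⟨0, zero_mem_boundedImage hg hC α⟩, isPreconnected_of_forall 0 fun μ hμ => ?_⟩
  have hray : Continuous fun t : ℝ => (t : ℂ) • μ :=
    (continuous_le_rng hτ (continuous_smul_projective μ)).comp Complex.continuous_ofReal
  refine ⟨(fun t : ℝ => (t : ℂ) • μ) '' Set.Icc 0 1, ?_, ⟨0, by simp, zero_smul ℂ μ⟩,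
    ⟨1, by simp, one_smul ℂ μ⟩, isPreconnected_Icc.image _ hray.continuousOn⟩
  rintro _ ⟨t, ht, rfl⟩
  refine (balanced_boundedImage hg C α).smul_mem ?_ hμ
  rw [Complex.norm_real, Real.norm_of_nonneg ht.1]
  exact ht.2

theorem closure_boundedImage_subset (hg : IsGaussianType g G δ) {C : ℝ} (hC : 0 ≤ C) (α : ℝ)
    {τ : TopologicalSpace ExpPlusDual} (hτ : τ ≤ weakDualTopology) :
    @closure _ τ (boundedImage hg C α) ⊆ dominatedSet g C α :=
  closure_minimal (boundedImage_subset_dominatedSet hg C α)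
    ((@IsCompact.isClosed _ weakDualTopology t2Space_weak _
      (isCompact_dominatedSet_weak hg hC α)).mono hτ)

theorem isCompact_closure_boundedImage (hg : IsGaussianType g G δ) {C : ℝ} (hC : 0 ≤ C) (α : ℝ)
    {τ : TopologicalSpace ExpPlusDual} (hproj : projectiveTopology ≤ τ)
    (hweak : τ ≤ weakDualTopology) : @IsCompact _ τ (@closure _ τ (boundedImage hg C α)) := by
  have hdom : @IsCompact _ τ (dominatedSet g C α) := by
    simpa using @IsCompact.image _ _ projectiveTopology τ _ _
      (isCompact_dominatedSet_projective hg hC α) (continuous_id_of_le hproj)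
  exact hdom.of_isClosed_subset isClosed_closure (closure_boundedImage_subset hg hC α hweak)

theorem dualMetricOn_closure_boundedImage_topology (hg : IsGaussianType g G δ) {C : ℝ}
    (hC : 0 ≤ C) (α : ℝ) {τ : TopologicalSpace ExpPlusDual} (hproj : projectiveTopology ≤ τ)
    (hweak : τ ≤ weakDualTopology) :
    (dualMetricOn (@closure _ τ (boundedImage hg C α))).toUniformSpace.toTopologicalSpace =
      topologyOn τ (@closure _ τ (boundedImage hg C α)) := by
  rw [dualMetricOn_topology]
  refine le_antisymm (induced_mono hproj) ?_
  rw [← topologyOn_weak_eq_projective hg hC α (closure_boundedImage_subset hg hC α hweak)]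
  exact induced_mono hweak

end Weight

/-! ### Density of `Exp₊` in weighted `L¹`-spaces -/

theorem exists_expPlus_of_bound {f : ℂ → ℂ} {β n : ℕ} {C : ℝ}
    (hd : DifferentiableOn ℂ f {z | -(1 / ((n : ℝ) + 1)) < z.im}) (hc : ContinuousOn f (region n))
    (hb : ∀ z ∈ region n, ‖f z‖ ≤ C * Real.exp (β * ‖z‖)) :
    ∃ φ : ExpPlus, ∀ z : ℂ, 0 ≤ z.im → φ z = f z := by
  have heq : Set.EqOn ((region n).indicator f) f (region n) :=
    fun z hz => Set.indicator_of_mem hz f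
  let F : ExpBanach β n := ⟨(region n).indicator f,
    hd.congr fun z hz => heq (by simp only [region, Set.mem_ofPred_eq] at hz ⊢; exact hz.le),
    hc.congr heq, fun z hz => Set.indicator_of_notMem hz f, C, fun z hz => by
      rw [heq hz, neg_mul, Real.exp_neg, inv_mul_le_iff₀ (Real.exp_pos _), mul_comm]
      exact hb z hz⟩
  exact ⟨inclusion β n F, fun z hz =>
    (inclusionLinear_apply F hz).trans (heq (real_mem_region n z hz))⟩

theorem exists_expPlus_exp (ξ : ℝ) :
    ∃ φ : ExpPlus, ∀ ω : ℝ, φ ω = Complex.exp (Complex.I * ξ * ω) := by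
  have hd : Differentiable ℂ fun z : ℂ => Complex.exp (Complex.I * ξ * z) := by fun_prop
  obtain ⟨φ, hφ⟩ := exists_expPlus_of_bound (β := ⌈|ξ|⌉₊) (n := 0) (C := 1) hd.differentiableOn
    hd.continuous.continuousOn fun z _ => by
      rw [Complex.norm_exp, one_mul]
      refine Real.exp_le_exp.2 ?_
      have h1 : (Complex.I * ξ * z).re = -(ξ * z.im) := by simp
      rw [h1]
      calc -(ξ * z.im) ≤ |ξ * z.im| := neg_le_abs _
        _ = |ξ| * |z.im| := abs_mul _ _
        _ ≤ ⌈|ξ|⌉₊ * ‖z‖ := by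
          gcongr
          · exact Nat.le_ceil _
          · exact Complex.abs_im_le_norm z
  exact ⟨φ, fun ω => hφ ω (by simp)⟩

theorem exists_expPlus_of_mem_span_fourier {T : ℝ} {q : C(AddCircle T, ℂ)}
    (hq : q ∈ Submodule.span ℂ (Set.range (@fourier T))) :
    ∃ φ : ExpPlus, ∀ ω : ℝ, φ ω = q (ω : AddCircle T) := by
  induction hq using Submodule.span_induction with
  | mem x hx =>
    obtain ⟨n, rfl⟩ := hx
    obtain ⟨φ, hφ⟩ := exists_expPlus_exp (2 * Real.pi * n / T)
    refine ⟨φ, fun ω => ?_⟩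
    rw [hφ, fourier_coe_apply]
    congr 1
    push_cast
    ring
  | zero => exact ⟨0, fun ω => rfl⟩
  | add x y _ _ hx hy =>
    obtain ⟨φ, hφ⟩ := hx
    obtain ⟨ψ, hψ⟩ := hy
    refine ⟨φ + ψ, fun ω => ?_⟩
    rw [ContinuousMap.add_apply, ← hφ, ← hψ]
    rfl
  | smul c x _ hx =>
    obtain ⟨φ, hφ⟩ := hx
    refine ⟨c • φ, fun ω => ?_⟩
    rw [ContinuousMap.smul_apply, ← hφ]
    rfl

theorem exists_expPlus_uniform_approx {F : ℝ → ℂ} (hF : Continuous F) {R B ε : ℝ} (hR : 0 < R)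
    (hend : F (-R) = F R) (hB : ∀ ω, ‖F ω‖ ≤ B) (hε : 0 < ε) :
    ∃ φ : ExpPlus, (∀ ω ∈ Set.Icc (-R) R, ‖F ω - φ ω‖ ≤ ε) ∧ ∀ ω : ℝ, ‖φ ω‖ ≤ B + ε := by
  have hT : Fact (0 < 2 * R) := ⟨by positivity⟩
  have hperiod : -R + 2 * R = R := by ring
  let F' : C(AddCircle (2 * R), ℂ) := ⟨AddCircle.liftIco (2 * R) (-R) F,
    AddCircle.liftIco_continuous (by rwa [hperiod]) hF.continuousOn⟩
  have hF' : ∀ ω ∈ Set.Icc (-R) R, F' (ω : AddCircle (2 * R)) = F ω := by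
    rintro ω ⟨hl, hr⟩
    rcases hr.lt_or_eq with h | h
    · exact AddCircle.liftIco_coe_apply ⟨hl, by rwa [hperiod]⟩
    · have hcoe : (ω : AddCircle (2 * R)) = ((-R : ℝ) : AddCircle (2 * R)) := by
        rw [← AddCircle.coe_add_period (2 * R) (-R), hperiod, h]
      rw [hcoe, h, ← hend]
      exact AddCircle.liftIco_coe_apply ⟨le_rfl, by linarith⟩
  have hmem : F' ∈ closure (Submodule.span ℂ (Set.range (@fourier (2 * R))) :
      Set C(AddCircle (2 * R), ℂ)) := by
    rw [← Submodule.topologicalClosure_coe, span_fourier_closure_eq_top]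
    trivial
  obtain ⟨q, hq, hqd⟩ := Metric.mem_closure_iff.1 hmem ε hε
  obtain ⟨φ, hφ⟩ := exists_expPlus_of_mem_span_fourier hq
  have hd : ∀ y, ‖F' y - q y‖ ≤ ε := fun y =>
    (dist_eq_norm _ _).symm.trans_le ((ContinuousMap.dist_apply_le_dist y).trans hqd.le)
  refine ⟨φ, fun ω hω => ?_, fun ω => ?_⟩
  · rw [hφ, ← hF' ω hω]
    exact hd _
  · have hF'B : ‖F' (ω : AddCircle (2 * R))‖ ≤ B := hB _
    rw [hφ]
    linarith [norm_le_norm_add_norm_sub (F' ω) (q ω), hd ω]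

theorem integral_mul_le_of_le_on_Icc {f w : ℝ → ℝ} (hw : Integrable w) (hw0 : ∀ ω, 0 ≤ w ω)
    (hf : ∀ ω, 0 ≤ f ω) {R η B : ℝ} (hη : ∀ ω ∈ Set.Icc (-R) R, f ω ≤ η)
    (hB : ∀ ω ∉ Set.Icc (-R) R, f ω ≤ η + B) :
    ∫ ω, f ω * w ω ≤ η * (∫ ω, w ω) + B * ∫ ω in (Set.Icc (-R) R)ᶜ, w ω := by
  have hle : ∀ ω, f ω * w ω ≤ η * w ω + (Set.Icc (-R) R)ᶜ.indicator (fun ω => B * w ω) ω :=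
    fun ω => by
      by_cases hω : ω ∈ Set.Icc (-R) R
      · rw [Set.indicator_of_notMem (by simpa using hω), add_zero]
        exact mul_le_mul_of_nonneg_right (hη ω hω) (hw0 ω)
      · rw [Set.indicator_of_mem hω, ← add_mul]
        exact mul_le_mul_of_nonneg_right (hB ω hω) (hw0 ω)
  have htail := (hw.const_mul B).indicator (measurableSet_Icc (a := -R) (b := R)).compl
  refine (integral_mono_of_nonneg (.of_forall fun ω => mul_nonneg (hf ω) (hw0 ω))
    ((hw.const_mul η).add htail) (.of_forall hle)).trans_eq ?_
  simp only [Pi.add_apply]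
  rw [integral_add (hw.const_mul η) htail, integral_indicator measurableSet_Icc.compl,
    integral_const_mul, integral_const_mul]

section Weight

variable {g : ℝ → ℝ} {G : ℂ → ℂ} {δ : ℝ}

theorem exists_expPlus_approx_compactSupport (hg : IsGaussianType g G δ) (α : ℝ) {F : ℝ → ℂ}
    (hF : Continuous F) (hs : HasCompactSupport F) {ε : ℝ} (hε : 0 < ε) :
    ∃ φ : ExpPlus, ∫ ω : ℝ, ‖F ω - φ ω‖ * (Real.exp (α * |ω|) * g ω) ≤ ε := by
  set w : ℝ → ℝ := fun ω => Real.exp (α * |ω|) * g ω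
  have hw : Integrable w := hg.integrable_exp α
  have hw0 : ∀ ω, 0 ≤ w ω := fun ω => mul_nonneg (Real.exp_pos _).le (hg.nonneg ω)
  have hI : 0 ≤ ∫ ω, w ω := integral_nonneg hw0
  obtain ⟨R₀, hR₀⟩ := hs.isCompact.isBounded.subset_closedBall 0
  obtain ⟨B, hB⟩ := hF.bounded_above_of_compact_support hs
  have hB0 : 0 ≤ B := (norm_nonneg _).trans (hB 0)
  obtain ⟨R, htail, hR₀R, hR⟩ := ((hg.eventually_tail_lt α
    (show 0 < ε / 2 / (B + 1) by positivity)).and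
      ((eventually_gt_atTop R₀).and (eventually_gt_atTop 0))).exists
  have hF0 : ∀ ω : ℝ, R ≤ |ω| → F ω = 0 := fun ω hω => image_eq_zero_of_notMem_tsupport fun h => by
    have := mem_closedBall_zero_iff.1 (hR₀ h)
    rw [Real.norm_eq_abs] at this
    linarith
  set η : ℝ := min 1 (ε / 2 / ((∫ ω, w ω) + 1))
  obtain ⟨φ, hφ, hφB⟩ := exists_expPlus_uniform_approx hF hR (ε := η)
    (by rw [hF0 _ (by simp [abs_of_pos hR]), hF0 _ (abs_of_pos hR).ge]) hB
    (lt_min one_pos (by positivity))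
  refine ⟨φ, ?_⟩
  have hoff : ∀ ω ∉ Set.Icc (-R) R, ‖F ω - φ ω‖ ≤ η + B := fun ω hω => by
    rw [hF0 ω (not_lt.1 fun h => hω (abs_le.1 h.le)), zero_sub, norm_neg, add_comm]
    exact hφB ω
  calc ∫ ω : ℝ, ‖F ω - φ ω‖ * w ω
      ≤ η * (∫ ω, w ω) + B * ∫ ω in (Set.Icc (-R) R)ᶜ, w ω :=
        integral_mul_le_of_le_on_Icc hw hw0 (fun _ => norm_nonneg _) hφ hoff
    _ ≤ ε / 2 / ((∫ ω, w ω) + 1) * ((∫ ω, w ω) + 1) + (B + 1) * (ε / 2 / (B + 1)) := by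
        gcongr
        · exact min_le_right _ _
        · linarith
        · exact integral_nonneg hw0
        · linarith
    _ = ε := by field_simp; ring

theorem IsGaussianType.ae_ne_zero (hg : IsGaussianType g G δ) : ∀ᵐ ω : ℝ, g ω ≠ 0 := by
  have han : AnalyticOnNhd ℝ (fun ω : ℝ => G ω) Set.univ := fun ω _ =>
    ((hg.analyticAt_real ω).restrictScalars (𝕜 := ℝ)).comp
      (Complex.ofRealCLM.analyticAt ω)
  obtain ⟨x, hx⟩ : ∃ x : ℝ, g x ≠ 0 := by
    by_contra! h
    have := hg.integral_eq_one
    simp [h] at this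
  have hmem := han.preimage_zero_mem_codiscrete (x := x) (by
    rw [hg.continuation]; exact_mod_cast hx)
  have h1 := ae_restrict_le_codiscreteWithin (μ := (volume : Measure ℝ)) MeasurableSet.univ hmem
  rw [Measure.restrict_univ] at h1
  filter_upwards [h1] with ω hω
  intro h0
  refine hω ?_
  change G ω = 0
  rw [hg.continuation, h0, Complex.ofReal_zero]

theorem integrable_exp_mul_pairing (hg : IsGaussianType g G δ) (α : ℝ) (φ : ExpPlus) :
    Integrable fun ω : ℝ => (Real.exp (α * |ω|) : ℂ) * (φ ω * g ω) := by
  have hexp : Continuous fun ω : ℝ => (Real.exp (α * |ω|) : ℂ) := by fun_prop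
  have hm : Continuous fun ω : ℝ => (Real.exp (α * |ω|) : ℂ) * (φ ω * g ω) :=
    hexp.mul ((expPlus_continuous φ).mul (Complex.continuous_ofReal.comp hg.continuous))
  refine (integrable_norm_iff hm.aestronglyMeasurable).1
    ((integrable_weightedNorm hg α φ).congr (.of_forall fun ω => ?_))
  simp only [norm_mul, Complex.norm_real, Real.norm_of_nonneg (hg.nonneg ω),
    Real.norm_of_nonneg (Real.exp_pos _).le]
  ring

theorem norm_exp_mul_sub (α ω : ℝ) (z z' : ℂ) :
    ‖(Real.exp (α * |ω|) : ℂ) * z - (Real.exp (α * |ω|) : ℂ) * z'‖ =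
      ‖z - z'‖ * Real.exp (α * |ω|) := by
  rw [← mul_sub, norm_mul, Complex.norm_real, Real.norm_of_nonneg (Real.exp_pos _).le, mul_comm]

theorem exists_compactSupport_approx (hg : IsGaussianType g G δ) (α : ℝ) {f : ℝ → ℂ}
    (hf : Integrable fun ω => (Real.exp (α * |ω|) : ℂ) * f ω) {ε : ℝ} (hε : 0 < ε) :
    ∃ F : ℝ → ℂ, Continuous F ∧ HasCompactSupport F ∧
      ∫ ω : ℝ, ‖f ω - F ω * g ω‖ * Real.exp (α * |ω|) ≤ ε := by
  set w : ℝ → ℝ := fun ω => Real.exp (α * |ω|) * g ω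
  have hw0 : ∀ ω, 0 ≤ w ω := fun ω => mul_nonneg (Real.exp_pos _).le (hg.nonneg ω)
  have hwm : Measurable fun ω => ENNReal.ofReal (w ω) :=
    ((Real.continuous_exp.comp (continuous_const.mul continuous_abs)).mul
      hg.continuous).measurable.ennreal_ofReal
  have hwtop : ∀ᵐ ω : ℝ, ENNReal.ofReal (w ω) < ⊤ := .of_forall fun ω => ENNReal.ofReal_lt_top
  have hfin := isFiniteMeasure_withDensity_ofReal (hg.integrable_exp α).2
  have htoReal : ∀ ω, (ENNReal.ofReal (w ω)).toReal = w ω := fun ω =>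
    ENNReal.toReal_ofReal (hw0 ω)
  have hquot : Integrable (fun ω => f ω / g ω)
      (volume.withDensity fun ω => ENNReal.ofReal (w ω)) := by
    rw [integrable_withDensity_iff_integrable_smul' hwm hwtop]
    refine hf.congr ?_
    filter_upwards [hg.ae_ne_zero] with ω hω
    have : (g ω : ℂ) ≠ 0 := Complex.ofReal_ne_zero.2 hω
    simp only [htoReal, Complex.real_smul, w]
    push_cast
    field_simp
  obtain ⟨F, hFs, hFd, hFc, -⟩ := hquot.exists_hasCompactSupport_integral_sub_le hε
  refine ⟨F, hFc, hFs, le_of_eq_of_le (integral_congr_ae ?_)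
    ((integral_withDensity_eq_integral_toReal_smul hwm hwtop _).symm.trans_le hFd)⟩
  filter_upwards [hg.ae_ne_zero] with ω hω
  have h0 : (g ω : ℂ) ≠ 0 := Complex.ofReal_ne_zero.2 hω
  have e : f ω - F ω * g ω = (f ω / g ω - F ω) * g ω := by field_simp
  rw [e, norm_mul, Complex.norm_real, Real.norm_of_nonneg (hg.nonneg ω), htoReal, smul_eq_mul]
  ring

theorem exists_expPlus_approx (hg : IsGaussianType g G δ) (α : ℝ) {f : ℝ → ℂ}
    (hf : Integrable fun ω => (Real.exp (α * |ω|) : ℂ) * f ω) {ε : ℝ} (hε : 0 < ε) :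
    ∃ φ : ExpPlus, ∫ ω : ℝ, ‖f ω - φ ω * g ω‖ * Real.exp (α * |ω|) ≤ ε := by
  obtain ⟨F, hFc, hFs, hF⟩ := exists_compactSupport_approx hg α hf (half_pos hε)
  obtain ⟨φ, hφ⟩ := exists_expPlus_approx_compactSupport hg α hFc hFs (half_pos hε)
  refine ⟨φ, ?_⟩
  have hexp : Continuous fun ω : ℝ => (Real.exp (α * |ω|) : ℂ) := by fun_prop
  have hgC : Continuous fun ω : ℝ => (g ω : ℂ) := Complex.continuous_ofReal.comp hg.continuous
  have hFi : Integrable fun ω => (Real.exp (α * |ω|) : ℂ) * (F ω * g ω) :=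
    (hexp.mul (hFc.mul hgC)).integrable_of_hasCompactSupport (hFs.mul_right.mul_left)
  have h1 : Integrable fun ω => ‖f ω - F ω * g ω‖ * Real.exp (α * |ω|) :=
    (hf.sub hFi).norm.congr (.of_forall fun ω => norm_exp_mul_sub α ω _ _)
  have h2 : Integrable fun ω => ‖F ω - φ ω‖ * (Real.exp (α * |ω|) * g ω) := by
    refine (hFi.sub (integrable_exp_mul_pairing hg α φ)).norm.congr (.of_forall fun ω => ?_)
    refine (norm_exp_mul_sub α ω _ _).trans ?_
    rw [← sub_mul, norm_mul, Complex.norm_real, Real.norm_of_nonneg (hg.nonneg ω)]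
    ring
  calc ∫ ω : ℝ, ‖f ω - φ ω * g ω‖ * Real.exp (α * |ω|)
      ≤ ∫ ω : ℝ, (‖f ω - F ω * g ω‖ * Real.exp (α * |ω|) +
          ‖F ω - φ ω‖ * (Real.exp (α * |ω|) * g ω)) := by
        refine integral_mono_of_nonneg (.of_forall fun ω =>
          mul_nonneg (norm_nonneg _) (Real.exp_pos _).le) (h1.add h2) (.of_forall fun ω => ?_)
        have htri := norm_sub_le_norm_sub_add_norm_sub (f ω) (F ω * g ω) (φ ω * g ω)
        rw [← sub_mul, norm_mul _ (g ω : ℂ), Complex.norm_real,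
          Real.norm_of_nonneg (hg.nonneg ω)] at htri
        calc _ ≤ _ := mul_le_mul_of_nonneg_right htri (Real.exp_pos (α * |ω|)).le
          _ = _ := by ring
    _ = (∫ ω : ℝ, ‖f ω - F ω * g ω‖ * Real.exp (α * |ω|)) +
          ∫ ω : ℝ, ‖F ω - φ ω‖ * (Real.exp (α * |ω|) * g ω) := integral_add h1 h2
    _ ≤ ε := by linarith

/-! ### Weakly null sequences -/

/-- A sequence in `Exp₊` with the uniform bound `M exp (α |z|)` on the upper half plane, whose
image under `i` is weakly null. The functionals to be proved continuous on `i (V_{C,α})` are those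
which tend to zero along all such sequences. -/
structure IsWeaklyNull (g : ℝ → ℝ) (M α : ℝ) (u : ℕ → ExpPlus) : Prop where
  bound : ∀ k, ∀ z : ℂ, 0 ≤ z.im → ‖u k z‖ ≤ M * Real.exp (α * ‖z‖)
  null : ∀ φ : ExpPlus, Tendsto (fun k => ∫ ω : ℝ, φ ω * u k ω * (g ω : ℂ)) atTop (𝓝 0)

theorem nonneg_of_norm_expPlus_le {M α : ℝ} {ψ : ExpPlus}
    (hψ : ∀ z : ℂ, 0 ≤ z.im → ‖ψ z‖ ≤ M * Real.exp (α * ‖z‖)) : 0 ≤ M := by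
  have h := hψ 0 (by simp)
  rw [norm_zero, mul_zero, Real.exp_zero, mul_one] at h
  exact (norm_nonneg _).trans h

theorem norm_expPlus_apply_le {M α ρ : ℝ} {ψ : ExpPlus}
    (hψ : ∀ z : ℂ, 0 ≤ z.im → ‖ψ z‖ ≤ M * Real.exp (α * ‖z‖)) {z : ℂ} (hz : 0 ≤ z.im)
    (hρ : ‖z‖ ≤ ρ) : ‖ψ z‖ ≤ M * Real.exp (|α| * ρ) := by
  refine (hψ z hz).trans ?_
  have := nonneg_of_norm_expPlus_le hψ
  gcongr
  exact le_abs_self α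

theorem integrable_mul_expPlus {M α : ℝ} {ψ : ExpPlus}
    (hψ : ∀ z : ℂ, 0 ≤ z.im → ‖ψ z‖ ≤ M * Real.exp (α * ‖z‖)) {f : ℝ → ℂ}
    (hf : Integrable fun ω => (Real.exp (α * |ω|) : ℂ) * f ω) :
    Integrable fun ω : ℝ => f ω * ψ ω := by
  have hfm : AEStronglyMeasurable f volume := by
    have h1 : Continuous fun ω : ℝ => (Real.exp (-(α * |ω|)) : ℂ) := by fun_prop
    refine (h1.aestronglyMeasurable.mul hf.1).congr (Eventually.of_forall fun ω => ?_)
    change (Real.exp (-(α * |ω|)) : ℂ) * ((Real.exp (α * |ω|) : ℂ) * f ω) = f ω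
    rw [← mul_assoc, ← Complex.ofReal_mul, ← Real.exp_add, neg_add_cancel, Real.exp_zero,
      Complex.ofReal_one, one_mul]
  refine (hf.norm.const_mul M).mono' (hfm.mul (expPlus_continuous ψ).aestronglyMeasurable)
    (Eventually.of_forall fun ω => ?_)
  have h := hψ ω (by simp)
  rw [Complex.norm_real, Real.norm_eq_abs] at h
  rw [norm_mul, norm_mul, Complex.norm_real, Real.norm_of_nonneg (Real.exp_pos _).le]
  calc ‖f ω‖ * ‖ψ ω‖ ≤ ‖f ω‖ * (M * Real.exp (α * |ω|)) := by gcongr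
    _ = _ := by ring

theorem norm_integral_mul_expPlus_le {M α : ℝ} {ψ : ExpPlus}
    (hψ : ∀ z : ℂ, 0 ≤ z.im → ‖ψ z‖ ≤ M * Real.exp (α * ‖z‖)) {f : ℝ → ℂ}
    (hf : Integrable fun ω => (Real.exp (α * |ω|) : ℂ) * f ω) :
    ‖∫ ω : ℝ, f ω * ψ ω‖ ≤ M * ∫ ω : ℝ, ‖f ω‖ * Real.exp (α * |ω|) := by
  rw [← integral_const_mul]
  have hint : Integrable fun ω => ‖f ω‖ * Real.exp (α * |ω|) :=
    hf.norm.congr (.of_forall fun ω => by simpa using norm_exp_mul_sub α ω (f ω) 0)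
  refine norm_integral_le_of_norm_le (hint.const_mul M) (.of_forall fun ω => ?_)
  have h := hψ ω (by simp)
  rw [Complex.norm_real, Real.norm_eq_abs] at h
  rw [norm_mul]
  calc ‖f ω‖ * ‖ψ ω‖ ≤ ‖f ω‖ * (M * Real.exp (α * |ω|)) := by gcongr
    _ = _ := by ring

theorem IsWeaklyNull.tendsto_integral (hg : IsGaussianType g G δ) {M α : ℝ} {u : ℕ → ExpPlus}
    (hu : IsWeaklyNull g M α u) {f : ℝ → ℂ}
    (hf : Integrable fun ω => (Real.exp (α * |ω|) : ℂ) * f ω) :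
    Tendsto (fun k => ∫ ω : ℝ, f ω * u k ω) atTop (𝓝 0) := by
  have hM := nonneg_of_norm_expPlus_le (hu.bound 0)
  rw [Metric.tendsto_nhds]
  intro ε hε
  obtain ⟨φ, hφ⟩ := exists_expPlus_approx hg α hf (show 0 < ε / 2 / (M + 1) by positivity)
  filter_upwards [(tendsto_zero_iff_norm_tendsto_zero.1 (hu.null φ)).eventually_lt_const
    (half_pos hε)] with k hk
  have hfi := integrable_mul_expPlus (hu.bound k) hf
  have hφi := integrable_pairing hg (u k) φ
  have hsplit : ∫ ω : ℝ, f ω * u k ω =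
      (∫ ω : ℝ, φ ω * u k ω * (g ω : ℂ)) + ∫ ω : ℝ, (f ω - φ ω * g ω) * u k ω := by
    rw [← integral_add hφi ((hfi.sub hφi).congr (.of_forall fun ω => by
      simp only [Pi.sub_apply]; ring))]
    exact integral_congr_ae (.of_forall fun ω => by ring)
  have hrest : ‖∫ ω : ℝ, (f ω - φ ω * g ω) * u k ω‖ ≤ ε / 2 := by
    have hdiff : Integrable fun ω => (Real.exp (α * |ω|) : ℂ) * (f ω - φ ω * g ω) :=
      (hf.sub (integrable_exp_mul_pairing hg α φ)).congr (.of_forall fun ω => (mul_sub _ _ _).symm)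
    calc ‖∫ ω : ℝ, (f ω - φ ω * g ω) * u k ω‖
        ≤ M * ∫ ω : ℝ, ‖f ω - φ ω * g ω‖ * Real.exp (α * |ω|) :=
          norm_integral_mul_expPlus_le (hu.bound k) hdiff
      _ ≤ (M + 1) * (ε / 2 / (M + 1)) := by gcongr; linarith
      _ = ε / 2 := by field_simp
  rw [dist_zero_right, hsplit]
  linarith [norm_add_le (∫ ω : ℝ, φ ω * u k ω * (g ω : ℂ)) (∫ ω : ℝ, (f ω - φ ω * g ω) * u k ω)]

end Weight

/-! ### Carleman's formula on a rectangle -/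

/-- The integral of `f` along the boundary of the rectangle `[-a, a] × [-b, b]`, counterclockwise;
it is written in the form of Mathlib's Cauchy–Goursat theorem. -/
def boundaryIntegral (f : ℂ → ℂ) (a b : ℝ) : ℂ :=
  (∫ x in -a..a, f (x + (-b : ℝ) * Complex.I)) - (∫ x in -a..a, f (x + (b : ℝ) * Complex.I)) +
    Complex.I * (∫ y in -b..b, f ((a : ℝ) + y * Complex.I)) -
      Complex.I * ∫ y in -b..b, f ((-a : ℝ) + y * Complex.I)

/-- The closed rectangle `[-a, a] × [-b, b]`. -/
def closedRect (a b : ℝ) : Set ℂ := Set.Icc (-a) a ×ℂ Set.Icc (-b) b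

section Carleman

variable {f f' : ℂ → ℂ} {a b : ℝ}

theorem mem_closedRect {z : ℂ} : z ∈ closedRect a b ↔ |z.re| ≤ a ∧ |z.im| ≤ b := by
  rw [closedRect, Complex.mem_reProdIm, abs_le, abs_le]
  rfl

theorem closedRect_mem_nhds (ha : 0 < a) (hb : 0 < b) : closedRect a b ∈ 𝓝 (0 : ℂ) := by
  refine mem_of_superset ((isOpen_Ioo.reProdIm isOpen_Ioo).mem_nhds (x := 0)
    (s := Set.Ioo (-a) a ×ℂ Set.Ioo (-b) b) ?_)
    fun z hz => ⟨Set.Ioo_subset_Icc_self hz.1, Set.Ioo_subset_Icc_self hz.2⟩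
  simp [Complex.mem_reProdIm, ha, hb]

theorem horizontal_mem_closedRect (hb : 0 < b) {x y : ℝ} (hx : x ∈ Set.uIcc (-a) a)
    (ha : 0 < a) (hy : |y| = b) : (x + y * Complex.I : ℂ) ∈ closedRect a b \ {0} := by
  rw [Set.uIcc_of_le (by linarith)] at hx
  refine ⟨by simpa [mem_closedRect, abs_le.2 hx] using hy.le, fun h => ?_⟩
  have him : y = 0 := by simpa using congrArg Complex.im h
  rw [him, abs_zero] at hy
  exact hb.ne hy

theorem vertical_mem_closedRect (ha : 0 < a) {x y : ℝ} (hy : y ∈ Set.uIcc (-b) b)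
    (hb : 0 < b) (hx : |x| = a) : (x + y * Complex.I : ℂ) ∈ closedRect a b \ {0} := by
  rw [Set.uIcc_of_le (by linarith)] at hy
  refine ⟨by simpa [mem_closedRect, abs_le.2 hy] using hx.le, fun h => ?_⟩
  have hre : x = 0 := by simpa using congrArg Complex.re h
  rw [hre, abs_zero] at hx
  exact ha.ne hx

theorem boundaryIntegral_add (ha : 0 < a) (hb : 0 < b)
    (hf : ContinuousOn f (closedRect a b \ {0})) (hf' : ContinuousOn f' (closedRect a b \ {0})) :
    boundaryIntegral (fun z => f z + f' z) a b =
      boundaryIntegral f a b + boundaryIntegral f' a b := by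
  have horizontal {h : ℂ → ℂ} (hh : ContinuousOn h (closedRect a b \ {0})) {y : ℝ} (hy : |y| = b) :
      IntervalIntegrable (fun x : ℝ => h (x + y * Complex.I)) volume (-a) a :=
    (hh.comp (by fun_prop) fun x hx => horizontal_mem_closedRect hb hx ha hy).intervalIntegrable
  have vertical {h : ℂ → ℂ} (hh : ContinuousOn h (closedRect a b \ {0})) {x : ℝ} (hx : |x| = a) :
      IntervalIntegrable (fun y : ℝ => h (x + y * Complex.I)) volume (-b) b :=
    (hh.comp (by fun_prop) fun y hy => vertical_mem_closedRect ha hy hb hx).intervalIntegrable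
  have ha' : |a| = a := abs_of_pos ha
  have hb' : |b| = b := abs_of_pos hb
  have hna : |-a| = a := by rwa [abs_neg]
  have hnb : |-b| = b := by rwa [abs_neg]
  simp only [boundaryIntegral]
  rw [intervalIntegral.integral_add (horizontal hf hnb) (horizontal hf' hnb),
    intervalIntegral.integral_add (horizontal hf hb') (horizontal hf' hb'),
    intervalIntegral.integral_add (vertical hf ha') (vertical hf' ha'),
    intervalIntegral.integral_add (vertical hf hna) (vertical hf' hna)]
  ring

theorem boundaryIntegral_const_mul (w : ℂ) :
    boundaryIntegral (fun z => w * f z) a b = w * boundaryIntegral f a b := by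
  simp only [boundaryIntegral, intervalIntegral.integral_const_mul]
  ring

theorem boundaryIntegral_congr (ha : 0 < a) (hb : 0 < b)
    (h : Set.EqOn f f' (closedRect a b \ {0})) :
    boundaryIntegral f a b = boundaryIntegral f' a b := by
  have horizontal {y : ℝ} (hy : |y| = b) :
      ∫ x in -a..a, f (x + y * Complex.I) = ∫ x in -a..a, f' (x + y * Complex.I) :=
    intervalIntegral.integral_congr fun x hx => h (horizontal_mem_closedRect hb hx ha hy)
  have vertical {x : ℝ} (hx : |x| = a) :
      ∫ y in -b..b, f (x + y * Complex.I) = ∫ y in -b..b, f' (x + y * Complex.I) :=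
    intervalIntegral.integral_congr fun y hy => h (vertical_mem_closedRect ha hy hb hx)
  simp only [boundaryIntegral]
  rw [horizontal (by rw [abs_neg, abs_of_pos hb]), horizontal (abs_of_pos hb),
    vertical (abs_of_pos ha), vertical (by rw [abs_neg, abs_of_pos ha])]

theorem norm_boundaryIntegral_le (ha : 0 < a) (hb : 0 < b) {C : ℝ}
    (h : ∀ z ∈ closedRect a b, z.im = b ∨ |z.re| = a → ‖f z‖ ≤ C) :
    ‖boundaryIntegral f a b‖ ≤
      ‖∫ x in -a..a, f (x + (-b : ℝ) * Complex.I)‖ + (2 * a + 4 * b) * C := by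
  have top : ‖∫ x in -a..a, f (x + b * Complex.I)‖ ≤ C * |a - -a| :=
    intervalIntegral.norm_integral_le_of_norm_le_const fun x hx => h _
      (horizontal_mem_closedRect hb (Set.uIoc_subset_uIcc hx) ha (abs_of_pos hb)).1 (by simp)
  have vertical {x : ℝ} (hx : |x| = a) :
      ‖Complex.I * ∫ y in -b..b, f (x + y * Complex.I)‖ ≤ C * |b - -b| := by
    rw [norm_mul, Complex.norm_I, one_mul]
    exact intervalIntegral.norm_integral_le_of_norm_le_const fun y hy => h _
      (vertical_mem_closedRect ha (Set.uIoc_subset_uIcc hy) hb hx).1 (by simp [hx])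
  have right := vertical (abs_of_pos ha)
  have left := vertical (x := -a) (by rw [abs_neg, abs_of_pos ha])
  rw [abs_of_pos (by linarith)] at top right left
  refine (norm_sub_le _ _).trans ((add_le_add_left ((norm_add_le _ _).trans
    (add_le_add_left (norm_sub_le _ _) _)) _).trans ?_)
  linarith

theorem ofReal_add_mul_I_ne_zero {x y : ℝ} (h : x ≠ 0 ∨ y ≠ 0) :
    (x + y * Complex.I : ℂ) ≠ 0 := fun h0 =>
  h.elim (fun hx => hx (by simpa using congrArg Complex.re h0))
    fun hy => hy (by simpa using congrArg Complex.im h0)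

theorem integral_inv_horizontal_sides (a : ℝ) (hb : 0 < b) :
    (∫ x in -a..a, (x + (-b : ℝ) * Complex.I : ℂ)⁻¹) - (∫ x in -a..a, (x + b * Complex.I : ℂ)⁻¹) =
      2 * Complex.I * (∫ x in -a..a, b / (x ^ 2 + b ^ 2) : ℝ) := by
  rw [← intervalIntegral.integral_sub, ← intervalIntegral.integral_ofReal,
    ← intervalIntegral.integral_const_mul]
  · refine intervalIntegral.integral_congr fun x _ => ?_
    have h1 : (x - b * Complex.I : ℂ) ≠ 0 := by
      simpa [sub_eq_add_neg] using ofReal_add_mul_I_ne_zero (x := x) (.inr (neg_ne_zero.2 hb.ne'))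
    have h2 : (x + b * Complex.I : ℂ) ≠ 0 := ofReal_add_mul_I_ne_zero (.inr hb.ne')
    have h3 : (x ^ 2 + b ^ 2 : ℂ) ≠ 0 := by exact_mod_cast (by positivity : x ^ 2 + b ^ 2 ≠ 0)
    push_cast
    rw [neg_mul, ← sub_eq_add_neg]
    field_simp
    linear_combination (2 * (b : ℂ) ^ 3 * Complex.I) * Complex.I_sq
  all_goals exact (Continuous.inv₀ (by fun_prop) fun x =>
    ofReal_add_mul_I_ne_zero (.inr (by simpa using hb.ne'))).intervalIntegrable _ _

theorem integral_inv_vertical_sides (ha : 0 < a) (b : ℝ) :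
    (∫ y in -b..b, (a + y * Complex.I : ℂ)⁻¹) - (∫ y in -b..b, ((-a : ℝ) + y * Complex.I : ℂ)⁻¹) =
      2 * (∫ y in -b..b, a / (a ^ 2 + y ^ 2) : ℝ) := by
  rw [← intervalIntegral.integral_sub, ← intervalIntegral.integral_ofReal,
    ← intervalIntegral.integral_const_mul]
  · refine intervalIntegral.integral_congr fun y _ => ?_
    have h1 : ((-a : ℝ) + y * Complex.I : ℂ) ≠ 0 :=
      ofReal_add_mul_I_ne_zero (.inl (neg_ne_zero.2 ha.ne'))
    have h2 : (a + y * Complex.I : ℂ) ≠ 0 := ofReal_add_mul_I_ne_zero (.inl ha.ne')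
    have h3 : (a ^ 2 + y ^ 2 : ℂ) ≠ 0 := by exact_mod_cast (by positivity : a ^ 2 + y ^ 2 ≠ 0)
    push_cast at h1 ⊢
    field_simp
    linear_combination (-2 * (a : ℂ) * y ^ 2) * Complex.I_sq
  all_goals exact (Continuous.inv₀ (by fun_prop) fun y =>
    ofReal_add_mul_I_ne_zero (.inl (by simpa using ha.ne'))).intervalIntegrable _ _

theorem boundaryIntegral_inv (ha : 0 < a) (hb : 0 < b) :
    boundaryIntegral (fun z => z⁻¹) a b = 2 * Complex.I *
      ((∫ x in -a..a, b / (x ^ 2 + b ^ 2)) + ∫ y in -b..b, a / (a ^ 2 + y ^ 2) : ℝ) := by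
  simp only [boundaryIntegral]
  rw [integral_inv_horizontal_sides a hb, add_sub_assoc, ← mul_sub,
    integral_inv_vertical_sides ha b]
  push_cast
  ring

theorem boundaryIntegral_inv_ne_zero (ha : 0 < a) (hb : 0 < b) :
    boundaryIntegral (fun z => z⁻¹) a b ≠ 0 := by
  have hx : 0 < ∫ x in -a..a, b / (x ^ 2 + b ^ 2) :=
    intervalIntegral.intervalIntegral_pos_of_pos
      (Continuous.intervalIntegrable (by fun_prop (disch := intros; positivity)) _ _)
      (fun x => by positivity) (by linarith)
  have hy : 0 < ∫ y in -b..b, a / (a ^ 2 + y ^ 2) :=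
    intervalIntegral.intervalIntegral_pos_of_pos
      (Continuous.intervalIntegrable (by fun_prop (disch := intros; positivity)) _ _)
      (fun x => by positivity) (by linarith)
  rw [boundaryIntegral_inv ha hb]
  exact mul_ne_zero (by simp) (Complex.ofReal_ne_zero.2 (add_pos hx hy).ne')

theorem boundaryIntegral_div_self (ha : 0 < a) (hb : 0 < b)
    (hc : ContinuousOn f (closedRect a b)) (hd : DifferentiableOn ℂ f (interior (closedRect a b))) :
    boundaryIntegral (fun z => f z / z) a b = f 0 * boundaryIntegral (fun z => z⁻¹) a b := by
  have h0 := closedRect_mem_nhds ha hb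
  have hd0 : DifferentiableAt ℂ f 0 :=
    hd.differentiableAt (interior_mem_nhds.2 h0)
  have hslope : ContinuousOn (dslope f 0) (closedRect a b) :=
    (continuousOn_dslope h0).2 ⟨hc, hd0⟩
  have hgoursat : boundaryIntegral (dslope f 0) a b = 0 := by
    have := Complex.integral_boundary_rect_eq_zero_of_continuousOn_of_differentiableOn (dslope f 0)
      ⟨-a, -b⟩ ⟨a, b⟩ ?_ ?_
    · exact this
    · rwa [Set.uIcc_of_le (by linarith), Set.uIcc_of_le (by linarith)]
    · simp only [min_eq_left (show -a ≤ a by linarith), max_eq_right (show -a ≤ a by linarith),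
        min_eq_left (show -b ≤ b by linarith), max_eq_right (show -b ≤ b by linarith)]
      rw [closedRect, Complex.interior_reProdIm, interior_Icc, interior_Icc] at hd
      exact ((Complex.differentiableOn_dslope ((isOpen_Ioo.reProdIm isOpen_Ioo).mem_nhds
        (by simp [Complex.mem_reProdIm, ha, hb]))).2 hd)
  have hinv : ContinuousOn (fun z : ℂ => f 0 * z⁻¹) (closedRect a b \ {0}) :=
    continuousOn_const.mul (continuousOn_id.inv₀ fun z hz => hz.2)
  calc boundaryIntegral (fun z => f z / z) a b
      = boundaryIntegral (fun z => dslope f 0 z + f 0 * z⁻¹) a b := by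
        refine boundaryIntegral_congr ha hb fun z hz => ?_
        have hz0 : z ≠ 0 := hz.2
        simp only [dslope_of_ne _ hz0, slope_def_field]
        field_simp
        ring
    _ = f 0 * boundaryIntegral (fun z => z⁻¹) a b := by
        rw [boundaryIntegral_add ha hb (hslope.mono Set.sdiff_subset) hinv, hgoursat,
          boundaryIntegral_const_mul, zero_add]

/-- The kernel `w ^ m / z` with `w = exp (-z² + 2 i b z)`. On the rectangle `[-2b, 2b] × [-b, b]`
one has `w 0 = 1`, while `‖w‖ ≤ exp (-b²) < 1` on every side except the lower one. -/
def carlemanKernel (b : ℝ) (m : ℕ) (z : ℂ) : ℂ :=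
  Complex.exp (m * (-z ^ 2 + 2 * Complex.I * b * z)) / z

theorem norm_carlemanKernel_le (hb : 0 < b) (m : ℕ) {z : ℂ} (hz : z ∈ closedRect (2 * b) b)
    (hz' : z.im = b ∨ |z.re| = 2 * b) :
    ‖carlemanKernel b m z‖ ≤ Real.exp (-b ^ 2) ^ m / b := by
  obtain ⟨-, him⟩ := mem_closedRect.1 hz
  obtain ⟨hl, hr⟩ := abs_le.1 him
  have hnorm : b ≤ ‖z‖ := by
    rcases hz' with h | h
    · exact h.ge.trans ((le_abs_self _).trans (Complex.abs_im_le_norm z))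
    · linarith [Complex.abs_re_le_norm z]
  have hexp : (-z ^ 2 + 2 * Complex.I * b * z).re ≤ -b ^ 2 := by
    have hre : (-z ^ 2 + 2 * Complex.I * b * z).re = -z.re ^ 2 + z.im ^ 2 - 2 * b * z.im := by
      simp [sq]
      ring
    rw [hre]
    rcases hz' with h | h
    · rw [h]
      nlinarith [sq_nonneg z.re]
    · rw [← sq_abs z.re, h]
      nlinarith
  rw [carlemanKernel, norm_div, Complex.exp_nat_mul, norm_pow, Complex.norm_exp]
  gcongr

theorem norm_apply_zero_le_carleman (hb : 0 < b) (hc : ContinuousOn f (closedRect (2 * b) b))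
    (hd : DifferentiableOn ℂ f (interior (closedRect (2 * b) b))) {B : ℝ}
    (hB : ∀ z ∈ closedRect (2 * b) b, ‖f z‖ ≤ B) (m : ℕ) :
    ‖f 0‖ * ‖boundaryIntegral (fun z => z⁻¹) (2 * b) b‖ ≤
      ‖∫ x in -(2 * b)..2 * b, carlemanKernel b m (x + (-b : ℝ) * Complex.I) *
          f (x + (-b : ℝ) * Complex.I)‖ + 8 * B * Real.exp (-b ^ 2) ^ m := by
  have hw : Differentiable ℂ fun z : ℂ =>
      Complex.exp (m * (-z ^ 2 + 2 * Complex.I * b * z)) := by fun_prop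
  have hcauchy := boundaryIntegral_div_self (by positivity) hb
    (hw.continuous.continuousOn.mul hc) (hw.differentiableOn.mul hd)
  have hkernel : boundaryIntegral (fun z => carlemanKernel b m z * f z) (2 * b) b =
      f 0 * boundaryIntegral (fun z => z⁻¹) (2 * b) b := by
    simpa [carlemanKernel, div_mul_eq_mul_div] using hcauchy
  have hsides : ∀ z ∈ closedRect (2 * b) b, z.im = b ∨ |z.re| = 2 * b →
      ‖carlemanKernel b m z * f z‖ ≤ Real.exp (-b ^ 2) ^ m / b * B := fun z hz hz' => by
    rw [norm_mul]
    exact mul_le_mul (norm_carlemanKernel_le hb m hz hz') (hB z hz) (norm_nonneg _) (by positivity)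
  rw [← norm_mul, ← hkernel]
  refine (norm_boundaryIntegral_le (by positivity) hb hsides).trans_eq ?_
  congr 1
  field_simp
  ring

theorem ExpPlus.norm_apply_le_carleman (φ : ExpPlus) {c : ℂ} (hc : 0 < c.im) {B : ℝ}
    (hB : ∀ z ∈ closedRect (2 * c.im) c.im, ‖φ (c + z)‖ ≤ B) (m : ℕ) :
    ‖φ c‖ * ‖boundaryIntegral (fun z => z⁻¹) (2 * c.im) c.im‖ ≤
      ‖∫ x in -(2 * c.im)..2 * c.im, carlemanKernel c.im m (x + (-c.im : ℝ) * Complex.I) *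
        φ (c + (x + (-c.im : ℝ) * Complex.I))‖ + 8 * B * Real.exp (-c.im ^ 2) ^ m := by
  have hd : DifferentiableOn ℂ (fun z => φ (c + z)) (interior (closedRect (2 * c.im) c.im)) := by
    refine φ.differentiableOn.comp (by fun_prop) fun z hz => ?_
    rw [closedRect, Complex.interior_reProdIm, interior_Icc, interior_Icc] at hz
    have : -c.im < z.im := hz.2.1
    simp only [Set.mem_ofPred_eq, Complex.add_im]
    linarith
  have hcont : ContinuousOn (fun z => φ (c + z)) (closedRect (2 * c.im) c.im) :=
    φ.continuousOn.comp (by fun_prop) fun z hz => by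
      simp only [Set.mem_ofPred_eq, Complex.add_im]
      linarith [(abs_le.1 (mem_closedRect.1 hz).2).1]
  simpa using norm_apply_zero_le_carleman hc hcont hd hB m

end Carleman

section Weight

variable {g : ℝ → ℝ} {G : ℂ → ℂ} {δ : ℝ}

theorem IsWeaklyNull.tendsto_intervalIntegral (hg : IsGaussianType g G δ) {M α : ℝ}
    {u : ℕ → ExpPlus} (hu : IsWeaklyNull g M α u) {f : ℝ → ℂ} (hf : Continuous f) {a b : ℝ}
    (hab : a ≤ b) : Tendsto (fun k => ∫ x in a..b, f x * u k x) atTop (𝓝 0) := by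
  have hexp : Continuous fun ω : ℝ => (Real.exp (α * |ω|) : ℂ) := by fun_prop
  have hint : Integrable fun ω => (Real.exp (α * |ω|) : ℂ) * (Set.Ioc a b).indicator f ω := by
    have h := ((hexp.mul hf).integrableOn_Ioc (a := a) (b := b)
      (μ := volume)).integrable_indicator measurableSet_Ioc
    refine h.congr (.of_forall fun ω => ?_)
    exact Set.indicator_mul_right _ (fun ω : ℝ => (Real.exp (α * |ω|) : ℂ)) f
  refine (hu.tendsto_integral hg hint).congr fun k => ?_
  rw [intervalIntegral.integral_of_le hab, ← integral_indicator measurableSet_Ioc]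
  exact integral_congr_ae (.of_forall fun ω =>
    (Set.indicator_mul_left _ f (fun ω : ℝ => u k ω)).symm)

theorem IsWeaklyNull.tendsto_integral_carlemanKernel (hg : IsGaussianType g G δ) {M α : ℝ}
    {u : ℕ → ExpPlus} (hu : IsWeaklyNull g M α u) {c : ℂ} (hc : 0 < c.im) (m : ℕ) :
    Tendsto (fun k => ∫ x in -(2 * c.im)..2 * c.im,
      carlemanKernel c.im m (x + (-c.im : ℝ) * Complex.I) *
        u k (c + (x + (-c.im : ℝ) * Complex.I))) atTop (𝓝 0) := by
  have hf : Continuous fun t : ℝ =>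
      carlemanKernel c.im m ((t - c.re : ℝ) + (-c.im : ℝ) * Complex.I) :=
    Continuous.div (by fun_prop) (by fun_prop) fun t h => hc.ne' (by
      simpa using congrArg Complex.im h)
  refine (hu.tendsto_intervalIntegral hg hf (a := -(2 * c.im) + c.re) (b := 2 * c.im + c.re)
    (by linarith)).congr fun k => ?_
  rw [← intervalIntegral.integral_comp_add_right]
  refine intervalIntegral.integral_congr fun x _ => ?_
  have hx : c + (x + (-c.im : ℝ) * Complex.I) = (x + c.re : ℝ) := by
    apply Complex.ext <;> simp [add_comm]
  simp only [hx, add_sub_cancel_right]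

theorem IsWeaklyNull.tendsto_apply (hg : IsGaussianType g G δ) {M α : ℝ} {u : ℕ → ExpPlus}
    (hu : IsWeaklyNull g M α u) {c : ℂ} (hc : 0 < c.im) :
    Tendsto (fun k => u k c) atTop (𝓝 0) := by
  set J := ‖boundaryIntegral (fun z => z⁻¹) (2 * c.im) c.im‖
  have hJ : 0 < J := norm_pos_iff.2 (boundaryIntegral_inv_ne_zero (by positivity) hc)
  set B := M * Real.exp (|α| * (‖c‖ + 3 * c.im))
  have hB (k : ℕ) : ∀ z ∈ closedRect (2 * c.im) c.im, ‖u k (c + z)‖ ≤ B := fun z hz => by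
    obtain ⟨hre, him⟩ := mem_closedRect.1 hz
    refine norm_expPlus_apply_le (hu.bound k)
      (by rw [Complex.add_im]; linarith [(abs_le.1 him).1]) ?_
    linarith [norm_add_le c z, Complex.norm_le_abs_re_add_abs_im z]
  have hq : Tendsto (fun m : ℕ => 8 * B * Real.exp (-c.im ^ 2) ^ m) atTop (𝓝 0) := by
    simpa using (tendsto_pow_atTop_nhds_zero_of_lt_one (Real.exp_pos _).le
      (Real.exp_lt_one_iff.2 (by nlinarith : -c.im ^ 2 < 0))).const_mul (8 * B)
  refine Metric.tendsto_nhds.2 fun ε hε => ?_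
  obtain ⟨m, hm⟩ := (hq.eventually_lt_const (by positivity : 0 < ε * J / 2)).exists
  filter_upwards [(hu.tendsto_integral_carlemanKernel hg hc m).norm.eventually_lt_const
    (by rw [norm_zero]; positivity : ‖(0 : ℂ)‖ < ε * J / 2)] with k hk
  rw [dist_zero_right]
  refine lt_of_mul_lt_mul_right ?_ hJ.le
  linarith [(u k).norm_apply_le_carleman hc (hB k) m]

end Weight

/-! ### Functionals which are continuous along weakly null sequences -/

/-- A linear form on `Exp₊` which is bounded on every `Exp₊(β, n)` and tends to zero along all
weakly null sequences; the rank-one projections `Π_λ` are built from such forms. -/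
structure IsRegularFunctional (g : ℝ → ℝ) (L : ExpPlus →ₗ[ℂ] ℂ) : Prop where
  bounded : ∀ β n : ℕ, ∃ B : ℝ, ∀ f : ExpBanach β n, ‖L (inclusion β n f)‖ ≤ B * ‖f‖
  null : ∀ (M α : ℝ) (u : ℕ → ExpPlus), IsWeaklyNull g M α u →
    Tendsto (fun k => L (u k)) atTop (𝓝 0)

section Weight

variable {g : ℝ → ℝ} {G : ℂ → ℂ} {δ : ℝ}

theorem IsRegularFunctional.add {L L' : ExpPlus →ₗ[ℂ] ℂ} (h : IsRegularFunctional g L)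
    (h' : IsRegularFunctional g L') : IsRegularFunctional g (L + L') where
  bounded β n := by
    obtain ⟨B, hB⟩ := h.bounded β n
    obtain ⟨B', hB'⟩ := h'.bounded β n
    refine ⟨B + B', fun f => ?_⟩
    rw [add_mul]
    exact (norm_add_le _ _).trans (add_le_add (hB f) (hB' f))
  null M α u hu := by simpa using (h.null M α u hu).add (h'.null M α u hu)

theorem IsRegularFunctional.smul {L : ExpPlus →ₗ[ℂ] ℂ} (h : IsRegularFunctional g L) (c : ℂ) :
    IsRegularFunctional g (c • L) where
  bounded β n := by
    obtain ⟨B, hB⟩ := h.bounded β n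
    refine ⟨‖c‖ * B, fun f => ?_⟩
    rw [LinearMap.smul_apply, norm_smul, mul_assoc]
    exact mul_le_mul_of_nonneg_left (hB f) (norm_nonneg c)
  null M α u hu := by simpa using (h.null M α u hu).const_mul c

theorem IsRegularFunctional.continuous {L : ExpPlus →ₗ[ℂ] ℂ} (h : IsRegularFunctional g L) :
    Continuous L := by
  rw [continuous_expPlus_iff]
  intro β n
  obtain ⟨B, hB⟩ := h.bounded β n
  exact AddMonoidHomClass.continuous_of_bound (L.comp (inclusionLinear β n)) B hB

section Path

variable {X : Type*} [MeasurableSpace X] {ν : Measure X} {γ w : X → ℂ}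

/-- The linear form `φ ↦ ∫ w(s) φ(γ(s)) dν(s)` on `Exp₊`. -/
def integralAlong (hi : ∀ φ : ExpPlus, Integrable (fun s => w s * φ (γ s)) ν) :
    ExpPlus →ₗ[ℂ] ℂ where
  toFun φ := ∫ s, w s * φ (γ s) ∂ν
  map_add' φ ψ := by
    rw [← integral_add (hi φ) (hi ψ)]
    exact integral_congr_ae (.of_forall fun s => mul_add (w s) (φ (γ s)) (ψ (γ s)))
  map_smul' c φ := by
    rw [RingHom.id_apply, smul_eq_mul, ← integral_const_mul]
    exact integral_congr_ae (.of_forall fun s => mul_left_comm (w s) c (φ (γ s)))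

variable {ρ : ℝ}

theorem ae_norm_mul_expPlus_comp_le (hγν : ∀ᵐ s ∂ν, 0 < (γ s).im ∧ ‖γ s‖ ≤ ρ) {M α : ℝ}
    {φ : ExpPlus} (hφ : ∀ z : ℂ, 0 ≤ z.im → ‖φ z‖ ≤ M * Real.exp (α * ‖z‖)) :
    ∀ᵐ s ∂ν, ‖w s * φ (γ s)‖ ≤ M * Real.exp (|α| * ρ) * ‖w s‖ := by
  filter_upwards [hγν] with s hs
  rw [norm_mul, mul_comm]
  gcongr
  exact norm_expPlus_apply_le hφ hs.1.le hs.2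

theorem aestronglyMeasurable_mul_expPlus_comp (hγ : Measurable γ)
    (hw : AEStronglyMeasurable w ν) (φ : ExpPlus) :
    AEStronglyMeasurable (fun s => w s * φ (γ s)) ν :=
  hw.mul (φ.measurable.comp hγ).aestronglyMeasurable

theorem integrable_mul_expPlus_comp (hγ : Measurable γ) (hw : Integrable w ν)
    (hγν : ∀ᵐ s ∂ν, 0 < (γ s).im ∧ ‖γ s‖ ≤ ρ) (φ : ExpPlus) :
    Integrable (fun s => w s * φ (γ s)) ν := by
  obtain ⟨β, C, h⟩ := φ.exists_bound
  exact (hw.norm.const_mul _).mono' (aestronglyMeasurable_mul_expPlus_comp hγ hw.1 φ)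
    (ae_norm_mul_expPlus_comp_le hγν h)

theorem isRegularFunctional_integralAlong (hg : IsGaussianType g G δ) (hγ : Measurable γ)
    (hw : Integrable w ν) (hγν : ∀ᵐ s ∂ν, 0 < (γ s).im ∧ ‖γ s‖ ≤ ρ) :
    IsRegularFunctional g (integralAlong (integrable_mul_expPlus_comp hγ hw hγν)) where
  bounded β n := by
    refine ⟨Real.exp (|(β : ℝ)| * ρ) * ∫ s, ‖w s‖ ∂ν, fun f => ?_⟩
    have h := norm_integral_le_of_norm_le (hw.norm.const_mul _)
      (ae_norm_mul_expPlus_comp_le hγν fun z hz =>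
        (congrArg norm (inclusionLinear_apply f hz)).trans_le
          (expBanach_norm_apply_le f (real_mem_region n z hz)))
    rw [integral_const_mul] at h
    exact h.trans_eq (by ring)
  null M α u hu := by
    have h := tendsto_integral_of_dominated_convergence (μ := ν)
      (F := fun k s => w s * u k (γ s)) (f := fun _ => (0 : ℂ)) _
      (fun k => aestronglyMeasurable_mul_expPlus_comp hγ hw.1 (u k)) (hw.norm.const_mul _)
      (fun k => ae_norm_mul_expPlus_comp_le hγν (hu.bound k)) (by
        filter_upwards [hγν] with s hs
        simpa using (hu.tendsto_apply hg hs.1).const_mul (w s))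
    rwa [integral_zero] at h

end Path

theorem integrable_kernel_mul_expPlus {κ : ℝ → ℂ}
    (hκ : ∀ a : ℝ, Integrable fun ω => (Real.exp (a * |ω|) : ℂ) * κ ω) (φ : ExpPlus) :
    Integrable fun ω : ℝ => κ ω * φ ω := by
  obtain ⟨β, C, h⟩ := φ.exists_bound
  exact integrable_mul_expPlus h (hκ β)

theorem isRegularFunctional_integralAlong_ofReal (hg : IsGaussianType g G δ) {κ : ℝ → ℂ}
    (hκ : ∀ a : ℝ, Integrable fun ω => (Real.exp (a * |ω|) : ℂ) * κ ω) :
    IsRegularFunctional g (integralAlong (integrable_kernel_mul_expPlus hκ)) where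
  bounded β n := by
    refine ⟨∫ ω : ℝ, ‖κ ω‖ * Real.exp (β * |ω|), fun f => ?_⟩
    rw [mul_comm]
    exact norm_integral_mul_expPlus_le (fun z hz =>
      (congrArg norm (inclusionLinear_apply f hz)).trans_le
        (expBanach_norm_apply_le f (real_mem_region n z hz))) (hκ β)
  null M α u hu := hu.tendsto_integral hg (hκ α)

theorem exists_isRegularFunctional_eval (hg : IsGaussianType g G δ) {z : ℂ} (hz : 0 < z.im)
    (c : ℂ) : ∃ L : ExpPlus →ₗ[ℂ] ℂ, IsRegularFunctional g L ∧ ∀ φ, L φ = c * φ z :=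
  ⟨_, isRegularFunctional_integralAlong hg (ν := Measure.dirac ()) (γ := fun _ => z)
    measurable_const (integrable_const c) (.of_forall fun _ => ⟨hz, le_rfl⟩),
    fun _ => integral_dirac _ _⟩

/-! ### Generalized eigenfunctions -/

theorem integrable_exp_mul_density_mul (hg : IsGaussianType g G δ) {c : ℝ → ℂ} {B : ℝ}
    (hm : Measurable c) (hb : ∀ ω, ‖c ω‖ ≤ B) (a : ℝ) :
    Integrable fun ω : ℝ => (Real.exp (a * |ω|) : ℂ) * ((g ω : ℂ) * c ω) := by
  refine ((hg.integrable_exp a).ofReal.mul_bdd hm.aestronglyMeasurable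
    (.of_forall hb)).congr (.of_forall fun ω => ?_)
  simp only [Complex.coe_algebraMap, Complex.ofReal_mul]
  ring

theorem integrable_expPlus_mul_density (hg : IsGaussianType g G δ) (φ : ExpPlus) :
    Integrable fun ω : ℝ => φ ω * (g ω : ℂ) :=
  (integrable_kernel_mul_expPlus (integrable_exp_mul_density_mul hg (c := fun _ => 1) (B := 1)
    measurable_const (by simp)) φ).congr (.of_forall fun ω => by simp only [mul_one, mul_comm])

theorem exists_regular_eigenfunctional_of_re_neg (hg : IsGaussianType g G δ) {lam : ℂ}
    (hlam : lam.re < 0) :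
    ∃ L : ExpPlus →ₗ[ℂ] ℂ, IsRegularFunctional g L ∧ ∀ φ : ExpPlus,
      L φ = (∫ ω : ℝ, φ ω * (g ω : ℂ) / (lam - Complex.I * ω)) +
        2 * Real.pi * φ (-Complex.I * lam) * G (-Complex.I * lam) := by
  have hb (ω : ℝ) : ‖(lam - Complex.I * ω)⁻¹‖ ≤ (-lam.re)⁻¹ := by
    rw [norm_inv]
    refine inv_anti₀ (by linarith) ?_
    simpa using (neg_le_abs _).trans (Complex.abs_re_le_norm (lam - Complex.I * ω))
  have hκ := integrable_exp_mul_density_mul hg (c := fun ω : ℝ => (lam - Complex.I * ω)⁻¹)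
    (by fun_prop) hb
  obtain ⟨L, hL, hLφ⟩ := exists_isRegularFunctional_eval hg (z := -Complex.I * lam)
    (by simpa using hlam) (2 * Real.pi * G (-Complex.I * lam))
  refine ⟨_, (isRegularFunctional_integralAlong_ofReal hg hκ).add hL, fun φ => ?_⟩
  rw [LinearMap.add_apply, hLφ]
  congr 1
  · refine integral_congr_ae (.of_forall fun ω => ?_)
    simp only [div_eq_mul_inv]
    ring
  · ring

section ImaginaryAxis

variable {lam : ℂ} {r : ℝ}

theorem le_norm_add_ofReal_sub {z : ℂ} (h : r ≤ |lam.im - z.re| ∨ (lam.re = 0 ∧ r ≤ z.im))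
    {x : ℝ} (hx : 0 ≤ x) : r ≤ ‖lam + x - Complex.I * z‖ := by
  rcases h with h | ⟨hre, him⟩
  · refine h.trans ?_
    simpa using Complex.abs_im_le_norm (lam + x - Complex.I * z)
  · refine le_trans ?_ ((le_abs_self _).trans (Complex.abs_re_le_norm _))
    simp only [Complex.sub_re, Complex.add_re, hre, Complex.ofReal_re, Complex.I_mul_re]
    linarith

theorem norm_inv_sub_le {z : ℂ} (hr : 0 < r)
    (h : r ≤ |lam.im - z.re| ∨ (lam.re = 0 ∧ r ≤ z.im)) :
    ‖(lam - Complex.I * z)⁻¹‖ ≤ r⁻¹ := by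
  rw [norm_inv]
  exact inv_anti₀ hr (by simpa using le_norm_add_ofReal_sub h le_rfl)

theorem tendsto_integral_div_of_far {X : Type*} [MeasurableSpace X] {ν : Measure X}
    {v γ : X → ℂ} (hv : Integrable v ν) (hγ : Measurable γ) (hr : 0 < r)
    (hfar : ∀ᵐ s ∂ν, r ≤ |lam.im - (γ s).re| ∨ (lam.re = 0 ∧ r ≤ (γ s).im)) :
    Tendsto (fun x : ℝ => ∫ s, v s / (lam + x - Complex.I * γ s) ∂ν) (𝓝[>] 0)
      (𝓝 (∫ s, v s / (lam - Complex.I * γ s) ∂ν)) := by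
  refine tendsto_integral_filter_of_dominated_convergence (fun s => ‖v s‖ / r) ?_ ?_
    (hv.norm.div_const r) ?_
  · refine .of_forall fun x => ?_
    simp only [div_eq_mul_inv]
    exact hv.1.mul (Measurable.aestronglyMeasurable (by fun_prop))
  · filter_upwards [self_mem_nhdsWithin] with x hx
    filter_upwards [hfar] with s hs
    rw [norm_div]
    exact div_le_div_of_nonneg_left (norm_nonneg _) hr (le_norm_add_ofReal_sub hs (le_of_lt hx))
  · filter_upwards [hfar] with s hs
    have hne : lam - Complex.I * γ s ≠ 0 := norm_pos_iff.1
      (hr.trans_le (by simpa using le_norm_add_ofReal_sub hs le_rfl))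
    have hlim : Tendsto (fun x : ℝ => lam + x - Complex.I * γ s) (𝓝[>] 0)
        (𝓝 (lam - Complex.I * γ s)) := by
      have hcont : Continuous fun x : ℝ => lam + x - Complex.I * γ s := by fun_prop
      simpa using (hcont.tendsto 0).mono_left nhdsWithin_le_nhds
    exact tendsto_const_nhds.div hlim hne

theorem exists_isRegularFunctional_tendsto_setIntegral (hg : IsGaussianType g G δ) (hr : 0 < r)
    {S : Set ℝ} (hS : MeasurableSet S) (hfar : ∀ ω ∈ S, r ≤ |lam.im - ω|) :
    ∃ L : ExpPlus →ₗ[ℂ] ℂ, IsRegularFunctional g L ∧ ∀ φ : ExpPlus,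
      Tendsto (fun x : ℝ => ∫ ω in S, φ (ω : ℝ) * (g ω : ℂ) / (lam + x - Complex.I * (ω : ℝ)))
        (𝓝[>] 0) (𝓝 (L φ)) := by
  have hκ := integrable_exp_mul_density_mul hg (c := S.indicator fun ω => (lam - Complex.I * ω)⁻¹)
    (B := r⁻¹) (Measurable.indicator (by fun_prop) hS) fun ω => by
      by_cases hω : ω ∈ S
      · rw [Set.indicator_of_mem hω]
        exact norm_inv_sub_le hr (Or.inl (hfar ω hω))
      · rw [Set.indicator_of_notMem hω, norm_zero]
        positivity
  refine ⟨_, isRegularFunctional_integralAlong_ofReal hg hκ, fun φ => ?_⟩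
  have hlim := tendsto_integral_div_of_far (lam := lam) (γ := fun ω : ℝ => (ω : ℂ))
    (integrable_expPlus_mul_density hg φ).integrableOn (by fun_prop) hr
    ((ae_restrict_mem hS).mono fun ω hω => Or.inl (hfar ω hω))
  convert hlim using 2
  rw [← integral_indicator hS]
  refine integral_congr_ae (.of_forall fun ω => ?_)
  by_cases hω : ω ∈ S
  · simp only [Set.indicator_of_mem hω, div_eq_mul_inv]
    ring
  · simp only [Set.indicator_of_notMem hω]
    ring

theorem exists_isRegularFunctional_tendsto_path (hg : IsGaussianType g G δ) (hr : 0 < r)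
    {γ : ℝ → ℂ} (hγ : Continuous γ) {a b : ℝ} (hG : ContinuousOn (fun s => G (γ s)) (Set.Icc a b))
    (hfar : ∀ s ∈ Set.Ioc a b,
      0 < (γ s).im ∧ (r ≤ |lam.im - (γ s).re| ∨ (lam.re = 0 ∧ r ≤ (γ s).im))) :
    ∃ L : ExpPlus →ₗ[ℂ] ℂ, IsRegularFunctional g L ∧ ∀ φ : ExpPlus,
      Tendsto (fun x : ℝ => ∫ s in Set.Ioc a b, φ (γ s) * G (γ s) /
        (lam + x - Complex.I * γ s)) (𝓝[>] 0) (𝓝 (L φ)) := by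
  obtain ⟨ρ, hρ⟩ := isCompact_Icc.exists_bound_of_continuousOn (hγ.continuousOn (s := Set.Icc a b))
  have hmem := ae_restrict_mem (μ := volume) (measurableSet_Ioc (a := a) (b := b))
  have hγν : ∀ᵐ s ∂volume.restrict (Set.Ioc a b), 0 < (γ s).im ∧ ‖γ s‖ ≤ ρ :=
    hmem.mono fun s hs => ⟨(hfar s hs).1, hρ s (Set.Ioc_subset_Icc_self hs)⟩
  have hGi : IntegrableOn (fun s => G (γ s)) (Set.Ioc a b) :=
    hG.integrableOn_Icc.mono_set Set.Ioc_subset_Icc_self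
  have hw : IntegrableOn (fun s => G (γ s) * (lam - Complex.I * γ s)⁻¹) (Set.Ioc a b) :=
    hGi.mul_bdd (Measurable.aestronglyMeasurable (by fun_prop))
      (hmem.mono fun s hs => norm_inv_sub_le hr (hfar s hs).2)
  refine ⟨_, isRegularFunctional_integralAlong hg hγ.measurable hw hγν, fun φ => ?_⟩
  have hv := integrable_mul_expPlus_comp hγ.measurable hGi hγν φ
  convert tendsto_integral_div_of_far hv hγ.measurable hr
    (hmem.mono fun s hs => (hfar s hs).2) using 2
  · simp only [mul_comm]
  · refine integral_congr_ae (.of_forall fun s => ?_)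
    simp only [div_eq_mul_inv]
    ring

end ImaginaryAxis

/-- The closed rectangle `[y - r, y + r] × [0, r]`, used to push a piece of the real line into
the upper half plane. -/
def upperBox (y r : ℝ) : Set ℂ := Set.Icc (y - r) (y + r) ×ℂ Set.Icc 0 r

theorem exists_analyticAt_upperBox (hg : IsGaussianType g G δ) (y : ℝ) :
    ∃ r : ℝ, 0 < r ∧ ∀ z ∈ upperBox y r, AnalyticAt ℂ G z := by
  obtain ⟨R, hR, hG⟩ := Metric.eventually_nhds_iff.1 (hg.analyticAt_real y).eventually_analyticAt
  refine ⟨R / 3, by positivity, fun z hz => hG ?_⟩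
  obtain ⟨hre, him⟩ := Complex.mem_reProdIm.1 hz
  have hre' : |(z - y).re| ≤ R / 3 := by
    rw [Complex.sub_re, Complex.ofReal_re]
    exact abs_le.2 ⟨by linarith [hre.1], by linarith [hre.2]⟩
  have him' : |(z - y).im| ≤ R / 3 := by
    rw [Complex.sub_im, Complex.ofReal_im, sub_zero]
    exact abs_le.2 ⟨by linarith [him.1], him.2⟩
  rw [dist_eq_norm]
  linarith [Complex.norm_le_abs_re_add_abs_im (z - y)]

theorem integral_eq_of_differentiableOn_upperBox {f : ℂ → ℂ} {y r : ℝ} (hr : 0 < r)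
    (hc : ContinuousOn f (upperBox y r)) (hd : DifferentiableOn ℂ f (interior (upperBox y r))) :
    ∫ ω in Set.Ioc (y - r) (y + r), f (ω : ℝ) =
      (∫ ω in Set.Ioc (y - r) (y + r), f ((ω : ℝ) + r * Complex.I)) -
      Complex.I * (∫ s in Set.Ioc 0 r, f ((y + r : ℝ) + (s : ℝ) * Complex.I)) +
      Complex.I * (∫ s in Set.Ioc 0 r, f ((y - r : ℝ) + (s : ℝ) * Complex.I)) := by
  have hle : y - r ≤ y + r := by linarith
  rw [upperBox, Complex.interior_reProdIm, interior_Icc, interior_Icc] at hd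
  have h := Complex.integral_boundary_rect_eq_zero_of_continuousOn_of_differentiableOn f
    ⟨y - r, 0⟩ ⟨y + r, r⟩ (by rwa [Set.uIcc_of_le hle, Set.uIcc_of_le hr.le])
    (by rwa [min_eq_left hle, max_eq_right hle, min_eq_left hr.le, max_eq_right hr.le])
  simp only [Complex.ofReal_zero, zero_mul, add_zero, smul_eq_mul,
    intervalIntegral.integral_of_le hle, intervalIntegral.integral_of_le hr.le] at h
  linear_combination h

theorem integral_expPlus_div_eq_of_upperBox (hg : IsGaussianType g G δ) {lam : ℂ} {r x : ℝ}
    (hlam : lam.re = 0) (hr : 0 < r) (hG : ∀ z ∈ upperBox lam.im r, AnalyticAt ℂ G z)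
    (hx : 0 < x) (φ : ExpPlus) :
    ∫ ω in Set.Ioc (lam.im - r) (lam.im + r),
        φ (ω : ℝ) * (g ω : ℂ) / (lam + x - Complex.I * (ω : ℝ)) =
      (∫ ω in Set.Ioc (lam.im - r) (lam.im + r), φ ((ω : ℝ) + r * Complex.I) *
        G ((ω : ℝ) + r * Complex.I) / (lam + x - Complex.I * ((ω : ℝ) + r * Complex.I))) -
      Complex.I * (∫ s in Set.Ioc 0 r, φ ((lam.im + r : ℝ) + (s : ℝ) * Complex.I) *
        G ((lam.im + r : ℝ) + (s : ℝ) * Complex.I) /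
          (lam + x - Complex.I * ((lam.im + r : ℝ) + (s : ℝ) * Complex.I))) +
      Complex.I * (∫ s in Set.Ioc 0 r, φ ((lam.im - r : ℝ) + (s : ℝ) * Complex.I) *
        G ((lam.im - r : ℝ) + (s : ℝ) * Complex.I) /
          (lam + x - Complex.I * ((lam.im - r : ℝ) + (s : ℝ) * Complex.I))) := by
  have hne (z : ℂ) (hz : 0 ≤ z.im) : lam + x - Complex.I * z ≠ 0 := fun h => by
    have hre : x + z.im = 0 := by simpa [hlam] using congrArg Complex.re h
    linarith
  have hsub : upperBox lam.im r ⊆ {z | 0 ≤ z.im} := fun z hz => (Complex.mem_reProdIm.1 hz).2.1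
  have hsub' : interior (upperBox lam.im r) ⊆ {z | 0 < z.im} := by
    rw [upperBox, Complex.interior_reProdIm, interior_Icc, interior_Icc]
    exact fun z hz => (Complex.mem_reProdIm.1 hz).2.1
  simp only [← hg.continuation]
  refine integral_eq_of_differentiableOn_upperBox
    (f := fun z => φ z * G z / (lam + x - Complex.I * z)) hr
    (((φ.continuousOn.mono hsub).mul fun z hz => (hG z hz).continuousAt.continuousWithinAt).div
      (by fun_prop) fun z hz => hne z (hsub hz))
    (((φ.differentiableOn.mono hsub').mul fun z hz =>
      (hG z (interior_subset hz)).differentiableAt.differentiableWithinAt).div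
      (by fun_prop) fun z hz => hne z (hsub (interior_subset hz)))

theorem exists_isRegularFunctional_tendsto_Ioc (hg : IsGaussianType g G δ) {lam : ℂ} {r : ℝ}
    (hlam : lam.re = 0) (hr : 0 < r) (hG : ∀ z ∈ upperBox lam.im r, AnalyticAt ℂ G z) :
    ∃ L : ExpPlus →ₗ[ℂ] ℂ, IsRegularFunctional g L ∧ ∀ φ : ExpPlus,
      Tendsto (fun x : ℝ => ∫ ω in Set.Ioc (lam.im - r) (lam.im + r),
        φ (ω : ℝ) * (g ω : ℂ) / (lam + x - Complex.I * (ω : ℝ))) (𝓝[>] 0) (𝓝 (L φ)) := by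
  have hGc : ContinuousOn G (upperBox lam.im r) :=
    fun z hz => (hG z hz).continuousAt.continuousWithinAt
  obtain ⟨L₁, hL₁, h₁⟩ := exists_isRegularFunctional_tendsto_path hg (lam := lam) hr
    (γ := fun s => (s : ℂ) + r * Complex.I) (a := lam.im - r) (b := lam.im + r) (by fun_prop)
    (hGc.comp (by fun_prop) fun s hs =>
      Complex.mem_reProdIm.2 ⟨by simpa using hs, by simp [hr.le]⟩)
    fun s _ => ⟨by simpa using hr, Or.inr ⟨hlam, by simp⟩⟩
  have vertical (d : ℝ) (hd : |d| = r) := exists_isRegularFunctional_tendsto_path hg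
    (lam := lam) hr (γ := fun s => ((lam.im + d : ℝ) : ℂ) + s * Complex.I) (a := 0) (b := r)
    (by fun_prop)
    (hGc.comp (by fun_prop) fun s hs => Complex.mem_reProdIm.2
      ⟨by simpa [neg_le_iff_add_nonneg, add_assoc] using abs_le.1 hd.le, by simpa using hs⟩)
    fun s hs => ⟨by simpa using hs.1, Or.inl (by simp [hd])⟩
  obtain ⟨L₂, hL₂, h₂⟩ := vertical r (abs_of_pos hr)
  obtain ⟨L₃, hL₃, h₃⟩ := vertical (-r) (by rw [abs_neg, abs_of_pos hr])
  refine ⟨L₁ + (-Complex.I) • L₂ + Complex.I • L₃,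
    (hL₁.add (hL₂.smul _)).add (hL₃.smul _), fun φ => ?_⟩
  have hlim := ((h₁ φ).add ((h₂ φ).const_mul (-Complex.I))).add ((h₃ φ).const_mul Complex.I)
  refine hlim.congr' ?_
  filter_upwards [self_mem_nhdsWithin] with x hx
  rw [integral_expPlus_div_eq_of_upperBox hg hlam hr hG hx φ, neg_mul, ← sub_eq_add_neg]
  simp only [sub_eq_add_neg]

theorem integrable_expPlus_mul_density_div (hg : IsGaussianType g G δ) {lam : ℂ}
    (hlam : 0 < lam.re) (φ : ExpPlus) :
    Integrable fun ω : ℝ => φ ω * (g ω : ℂ) / (lam - Complex.I * ω) := by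
  refine (integrable_expPlus_mul_density hg φ).mul_bdd (c := lam.re⁻¹)
    (Measurable.aestronglyMeasurable (by fun_prop)) (.of_forall fun ω => ?_)
  rw [norm_inv]
  refine inv_anti₀ hlam ?_
  simpa using (le_abs_self _).trans (Complex.abs_re_le_norm (lam - Complex.I * ω))

theorem exists_regular_eigenfunctional_of_re_eq_zero (hg : IsGaussianType g G δ) {lam : ℂ}
    (hlam : lam.re = 0) :
    ∃ L : ExpPlus →ₗ[ℂ] ℂ, IsRegularFunctional g L ∧ ∀ φ : ExpPlus,
      Tendsto (fun x : ℝ => ∫ ω : ℝ, φ ω * (g ω : ℂ) / ((lam + x) - Complex.I * ω))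
        (𝓝[>] 0) (𝓝 (L φ)) := by
  obtain ⟨r, hr, hG⟩ := exists_analyticAt_upperBox hg lam.im
  obtain ⟨L₁, hL₁, h₁⟩ := exists_isRegularFunctional_tendsto_Ioc hg hlam hr hG
  obtain ⟨L₂, hL₂, h₂⟩ := exists_isRegularFunctional_tendsto_setIntegral hg hr
    (lam := lam) (S := (Set.Ioc (lam.im - r) (lam.im + r))ᶜ) measurableSet_Ioc.compl
    fun ω hω => by
      by_contra! h
      rw [abs_lt] at h
      exact hω ⟨by linarith, by linarith⟩
  refine ⟨L₁ + L₂, hL₁.add hL₂, fun φ => ((h₁ φ).add (h₂ φ)).congr' ?_⟩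
  filter_upwards [self_mem_nhdsWithin] with x hx
  exact integral_add_compl measurableSet_Ioc
    (integrable_expPlus_mul_density_div hg (by simpa [hlam] using hx) φ)

theorem exists_eigenfunction (hg : IsGaussianType g G δ) {lam : ℂ} (hlam : lam.re ≤ 0) :
    ∃ μ : ExpPlusDual, IsGeneralizedEigenfunction g G lam μ ∧
      IsRegularFunctional g (μ : ExpPlus →ₗ[ℂ] ℂ) := by
  rcases hlam.lt_or_eq with h | h
  · obtain ⟨L, hL, hLφ⟩ := exists_regular_eigenfunctional_of_re_neg hg h
    exact ⟨⟨L, hL.continuous⟩, ⟨fun _ => hLφ, fun h0 => absurd h0 h.ne⟩, hL⟩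
  · obtain ⟨L, hL, hLφ⟩ := exists_regular_eigenfunctional_of_re_eq_zero hg h
    exact ⟨⟨L, hL.continuous⟩, ⟨fun h0 => absurd h h0.ne, fun _ => hLφ⟩, hL⟩

/-! ### The projections -/

theorem isWeaklyNull_sub (hg : IsGaussianType g G δ) {C α : ℝ} {ψ : ℕ → ExpPlus}
    {χ : ExpPlus} (hψ : ∀ k, ψ k ∈ boundedSet C α) (hχ : χ ∈ boundedSet C α)
    (h : Tendsto (fun k => canonicalInclusion hg (ψ k)) atTop
      (@nhds _ weakDualTopology (canonicalInclusion hg χ))) :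
    IsWeaklyNull g (2 * C) α fun k => ψ k - χ where
  bound k z hz := by
    have hbound {ψ : ExpPlus} (hψ : ψ ∈ boundedSet C α) : ‖ψ z‖ ≤ C * Real.exp (α * ‖z‖) := by
      simpa [Real.exp_neg, mul_inv_le_iff₀ (Real.exp_pos _)] using hψ z hz
    have hsub : ‖(ψ k - χ) z‖ ≤ ‖ψ k z‖ + ‖χ z‖ := norm_sub_le (ψ k z) (χ z)
    linarith [hbound (hψ k), hbound hχ]
  null φ := by
    have hlim := (tendsto_weak_iff.1 h φ).sub_const (canonicalInclusion hg χ φ)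
    rw [sub_self] at hlim
    refine hlim.congr fun k => (integral_sub (integrable_pairing hg _ φ)
      (integrable_pairing hg _ φ)).symm.trans (integral_congr_ae (.of_forall fun ω => ?_))
    change φ ω * ψ k ω * (g ω : ℂ) - φ ω * χ ω * (g ω : ℂ) = φ ω * (ψ k ω - χ ω) * (g ω : ℂ)
    ring

theorem IsRegularFunctional.tendsto_of_tendsto_weak {L : ExpPlus →ₗ[ℂ] ℂ}
    (hL : IsRegularFunctional g L) (hg : IsGaussianType g G δ) {C α : ℝ} {ψ : ℕ → ExpPlus}
    {χ : ExpPlus} (hψ : ∀ k, ψ k ∈ boundedSet C α) (hχ : χ ∈ boundedSet C α)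
    (h : Tendsto (fun k => canonicalInclusion hg (ψ k)) atTop
      (@nhds _ weakDualTopology (canonicalInclusion hg χ))) :
    Tendsto (fun k => L (ψ k)) atTop (𝓝 (L χ)) := by
  have hlim := (hL.null _ _ _ (isWeaklyNull_sub hg hψ hχ h)).add_const (L χ)
  simpa only [map_sub, sub_add_cancel, zero_add] using hlim

theorem sequentialSpace_of_metricSpace {X : Type*} (M : MetricSpace X) :
    @SequentialSpace X M.toPseudoMetricSpace.toUniformSpace.toTopologicalSpace :=
  inferInstance

theorem sequentialSpace_topologyOn_projective (S : Set ExpPlusDual) :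
    @SequentialSpace S (topologyOn projectiveTopology S) := by
  rw [← dualMetricOn_topology]
  exact sequentialSpace_of_metricSpace _

theorem IsRegularFunctional.exists_continuous_boundedImage {L : ExpPlus →ₗ[ℂ] ℂ}
    (hL : IsRegularFunctional g L) (hg : IsGaussianType g G δ) (C α : ℝ) :
    ∃ l : boundedImage hg C α → ℂ,
      (∀ (ψ : ExpPlus) (hψ : ψ ∈ boundedSet C α),
        l ⟨canonicalInclusion hg ψ, Set.mem_image_of_mem _ hψ⟩ = L ψ) ∧
      @Continuous _ _ (topologyOn projectiveTopology (boundedImage hg C α)) _ l := by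
  choose ψ hψ hψi using fun x : boundedImage hg C α => x.2
  refine ⟨fun x => L (ψ x), fun χ hχ => ?_, ?_⟩
  · refine tendsto_nhds_unique tendsto_const_nhds (hL.tendsto_of_tendsto_weak hg
      (ψ := fun _ : ℕ => ψ ⟨canonicalInclusion hg χ, _⟩) (fun _ => hψ _) hχ ?_)
    rw [hψi]
    exact @tendsto_const_nhds ExpPlusDual weakDualTopology _ _ _
  · refine @SeqContinuous.continuous _ _ (topologyOn projectiveTopology _) _
      (sequentialSpace_topologyOn_projective _) _ fun x a hx => ?_
    refine hL.tendsto_of_tendsto_weak hg (fun k => hψ (x k)) (hψ a) ?_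
    have hx' : Tendsto (fun k => (x k).1) atTop (@nhds _ projectiveTopology a.1) :=
      (@Continuous.tendsto _ _ (topologyOn projectiveTopology _) projectiveTopology _
        (@continuous_induced_dom _ _ _ projectiveTopology) a).comp hx
    simpa only [Function.comp_apply, hψi] using hx'.mono_right (nhds_mono projective_le_weak)

theorem exists_projection (hg : IsGaussianType g G δ) {C : ℝ} (hC : 0 ≤ C) (α : ℝ)
    {μ : ExpPlusDual} (hμ : IsRegularFunctional g (μ : ExpPlus →ₗ[ℂ] ℂ)) (c : ℂ) :
    ∃ P : boundedImage hg C α → ExpPlusDual,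
      (∀ (ψ : ExpPlus) (hψ : ψ ∈ boundedSet C α),
        P ⟨canonicalInclusion hg ψ, Set.mem_image_of_mem _ hψ⟩ = (c * μ ψ) • μ) ∧
      @Continuous _ _ (topologyOn projectiveTopology (boundedImage hg C α))
        projectiveTopology P ∧
      @SeqContinuous _ _ (topologyOn weakDualTopology (boundedImage hg C α))
        weakDualTopology P := by
  obtain ⟨l, hl, hcont⟩ := hμ.exists_continuous_boundedImage hg C α
  have hP : @Continuous _ _ (topologyOn projectiveTopology (boundedImage hg C α))
      projectiveTopology fun x => (c * l x) • μ :=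
    @Continuous.comp _ _ _ (topologyOn projectiveTopology _) _ projectiveTopology _ _
      (continuous_smul_projective μ)
      (@Continuous.comp _ _ _ (topologyOn projectiveTopology _) _ _ _ _
        (continuous_const_mul c) hcont)
  refine ⟨fun x => (c * l x) • μ, fun ψ hψ => ?_, hP, ?_⟩
  · exact congrArg (fun v => (c * v) • μ) (hl ψ hψ)
  · refine @Continuous.seqContinuous _ _ (topologyOn weakDualTopology _) weakDualTopology _ ?_
    rw [topologyOn_weak_eq_projective hg hC α (boundedImage_subset_dominatedSet hg C α)]
    exact continuous_le_rng projective_le_weak hP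

end Weight

/-! ### Linear differential equations depending on a parameter -/

theorem abs_integral_exp_mul_abs_le {L : ℝ} (hL : 0 < L) (t : ℝ) :
    |∫ s in (0 : ℝ)..t, Real.exp (L * |s|)| ≤ Real.exp (L * |t|) / L := by
  wlog ht : 0 ≤ t generalizing t
  · have hneg := intervalIntegral.integral_comp_neg (a := 0) (b := t) fun s => Real.exp (L * |s|)
    simp only [abs_neg, neg_zero] at hneg
    rw [hneg, intervalIntegral.integral_symm, abs_neg, ← abs_neg t]
    exact this (-t) (by linarith)
  have hcongr : ∫ s in (0 : ℝ)..t, Real.exp (L * |s|) = ∫ s in (0 : ℝ)..t, Real.exp (L * s) := by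
    refine intervalIntegral.integral_congr fun s hs => ?_
    rw [Set.uIcc_of_le ht] at hs
    simp only [abs_of_nonneg hs.1]
  have hone : 1 ≤ Real.exp (L * t) := Real.one_le_exp (by positivity)
  rw [hcongr, intervalIntegral.integral_comp_mul_left (fun s => Real.exp s) hL.ne', integral_exp,
    abs_of_nonneg ht, mul_zero, Real.exp_zero, smul_eq_mul, inv_mul_eq_div,
    abs_of_nonneg (div_nonneg (by linarith) hL.le)]
  gcongr
  linarith

section LinearODE

open scoped BoundedContinuousFunction

variable {E : Type*} [NormedAddCommGroup E] [NormedSpace ℂ E]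

/-- The integral operator of the equation `x' = A x`, written in the exponentially weighted
unknown `f t = e^{-L|t|} x t`, in which it becomes a contraction for large `L`. -/
def weightedVolterra (A : ℝ → E →L[ℂ] E) (L : ℝ) (f : ℝ → E) (t : ℝ) : E :=
  Real.exp (-(L * |t|)) • ∫ s in (0 : ℝ)..t, Real.exp (L * |s|) • A s (f s)

theorem continuous_exp_mul_abs_smul (L : ℝ) {f : ℝ → E} (hf : Continuous f) :
    Continuous fun s => Real.exp (L * |s|) • f s := by
  have hexp : Continuous fun s : ℝ => Real.exp (L * |s|) := by fun_prop
  exact hexp.smul hf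

theorem continuous_exp_smul_clm_apply (L : ℝ) {A : ℝ → E →L[ℂ] E} (hA : Continuous A)
    {f : ℝ → E} (hf : Continuous f) : Continuous fun s => Real.exp (L * |s|) • A s (f s) :=
  continuous_exp_mul_abs_smul L (hA.clm_apply hf)

theorem continuous_weightedVolterra (L : ℝ) {A : ℝ → E →L[ℂ] E} (hA : Continuous A)
    {f : ℝ → E} (hf : Continuous f) : Continuous (weightedVolterra A L f) := by
  unfold weightedVolterra
  simpa only [neg_mul] using continuous_exp_mul_abs_smul (-L) (intervalIntegral.continuous_primitive
    (fun a b => (continuous_exp_smul_clm_apply L hA hf).intervalIntegrable a b) 0)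

theorem norm_weightedVolterra_le {A : ℝ → E →L[ℂ] E} {m : ℝ} (hAm : ∀ s, ‖A s‖ ≤ m) {L : ℝ}
    (hL : 0 < L) (f : ℝ →ᵇ E) (t : ℝ) : ‖weightedVolterra A L f t‖ ≤ m / L * ‖f‖ := by
  have hm : 0 ≤ m := (norm_nonneg _).trans (hAm 0)
  have hint : ‖∫ s in (0 : ℝ)..t, Real.exp (L * |s|) • A s (f s)‖ ≤
      m * ‖f‖ * (Real.exp (L * |t|) / L) := by
    calc ‖∫ s in (0 : ℝ)..t, Real.exp (L * |s|) • A s (f s)‖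
        ≤ |∫ s in (0 : ℝ)..t, m * ‖f‖ * Real.exp (L * |s|)| := by
          refine intervalIntegral.norm_integral_le_abs_of_norm_le (ae_of_all _ fun s => ?_)
            (Continuous.intervalIntegrable (by fun_prop) _ _)
          rw [norm_smul, Real.norm_eq_abs, abs_of_pos (Real.exp_pos _), mul_comm]
          gcongr
          exact (A s).le_of_opNorm_le_of_le (hAm s) (f.norm_coe_le_norm s)
      _ = m * ‖f‖ * |∫ s in (0 : ℝ)..t, Real.exp (L * |s|)| := by
          rw [intervalIntegral.integral_const_mul, abs_mul, abs_of_nonneg (by positivity)]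
      _ ≤ m * ‖f‖ * (Real.exp (L * |t|) / L) := by
          gcongr
          exact abs_integral_exp_mul_abs_le hL t
  rw [weightedVolterra, norm_smul, Real.norm_eq_abs, abs_of_pos (Real.exp_pos _)]
  calc Real.exp (-(L * |t|)) * ‖∫ s in (0 : ℝ)..t, Real.exp (L * |s|) • A s (f s)‖
      ≤ Real.exp (-(L * |t|)) * (m * ‖f‖ * (Real.exp (L * |t|) / L)) := by gcongr
    _ = m / L * ‖f‖ * (Real.exp (-(L * |t|)) * Real.exp (L * |t|)) := by ring
    _ = m / L * ‖f‖ := by rw [← Real.exp_add, neg_add_cancel, Real.exp_zero, mul_one]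

theorem exists_clm_eq_weightedVolterra {A : ℝ → E →L[ℂ] E} (hA : Continuous A) {m : ℝ}
    (hAm : ∀ s, ‖A s‖ ≤ m) {L : ℝ} (hL : 0 < L) :
    ∃ V : (ℝ →ᵇ E) →L[ℂ] (ℝ →ᵇ E),
      (∀ f t, V f t = weightedVolterra A L f t) ∧ ‖V‖ ≤ m / L := by
  have hm : 0 ≤ m := (norm_nonneg _).trans (hAm 0)
  have hint (f : ℝ →ᵇ E) (t : ℝ) :
      IntervalIntegrable (fun s => Real.exp (L * |s|) • A s (f s)) volume 0 t :=
    (continuous_exp_smul_clm_apply L hA f.continuous).intervalIntegrable _ _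
  let V : (ℝ →ᵇ E) →ₗ[ℂ] (ℝ →ᵇ E) :=
    { toFun := fun f => BoundedContinuousFunction.ofNormedAddCommGroup _
        (continuous_weightedVolterra L hA f.continuous) _ (norm_weightedVolterra_le hAm hL f)
      map_add' := fun f h => by
        ext t
        simp only [BoundedContinuousFunction.coe_ofNormedAddCommGroup, weightedVolterra,
          BoundedContinuousFunction.coe_add, Pi.add_apply, map_add, smul_add]
        rw [intervalIntegral.integral_add (hint f t) (hint h t), smul_add]
      map_smul' := fun c f => by
        ext t
        simp only [BoundedContinuousFunction.coe_ofNormedAddCommGroup, weightedVolterra,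
          BoundedContinuousFunction.coe_smul, map_smul, RingHom.id_apply]
        simp only [smul_comm _ c, intervalIntegral.integral_smul] }
  exact ⟨V.mkContinuous (m / L) fun f => (BoundedContinuousFunction.norm_le (by positivity)).2
    (norm_weightedVolterra_le hAm hL f), fun _ _ => rfl,
    LinearMap.mkContinuous_norm_le _ (by positivity) _⟩

theorem exists_differentiableOn_affine_fixedPoint {F : Type*} [NormedAddCommGroup F]
    [NormedSpace ℂ F] [CompleteSpace F] {T : ℂ → F →L[ℂ] F} {U : Set ℂ}
    (hT : DifferentiableOn ℂ T U) (hT1 : ∀ ω ∈ U, ‖T ω‖ < 1) (e : F) :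
    ∃ f : ℂ → F, (∀ ω ∈ U, f ω = e + T ω (f ω)) ∧ DifferentiableOn ℂ f U := by
  have hunit (ω : ℂ) (hω : ω ∈ U) : IsUnit (1 - T ω) := isUnit_one_sub_of_norm_lt_one (hT1 ω hω)
  refine ⟨fun ω => Ring.inverse (1 - T ω) e, fun ω hω => ?_, fun ω hω => ?_⟩
  · have hinv : (1 - T ω) (Ring.inverse (1 - T ω) e) = e :=
      congr($(Ring.mul_inverse_cancel _ (hunit ω hω)) e)
    exact sub_eq_iff_eq_add.1 hinv
  · have hinv : DifferentiableAt ℂ Ring.inverse (1 - T ω) :=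
      (hasFDerivAt_ringInverse (𝕜 := ℂ) (hunit ω hω).unit).differentiableAt
    exact (hinv.comp_differentiableWithinAt ω ((differentiableWithinAt_const _).sub
      (hT ω hω))).clm_apply (differentiableWithinAt_const e)

theorem hasDerivAt_of_eq_add_integral {F : Type*} [NormedAddCommGroup F] [NormedSpace ℝ F]
    [CompleteSpace F] {x f : ℝ → F} {v : F} (hf : Continuous f)
    (h : ∀ t, x t = v + ∫ s in (0 : ℝ)..t, f s) (t : ℝ) : HasDerivAt x (f t) t := by
  rw [funext h]
  exact (intervalIntegral.integral_hasDerivAt_right (hf.intervalIntegrable 0 t)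
    hf.stronglyMeasurable.stronglyMeasurableAtFilter hf.continuousAt).const_add v

theorem exp_smul_eq_add_integral (A₁ : E →L[ℂ] E) {A₀ : ℝ → E →L[ℂ] E} (hA : Continuous A₀)
    {L : ℝ} {ω : ℂ} {v : E} {f : ℝ → E} (hf : Continuous f)
    (h : ∀ t, f t = Real.exp (-(L * |t|)) • v +
      (ω • weightedVolterra (fun _ => A₁) L f t + weightedVolterra A₀ L f t)) (t : ℝ) :
    Real.exp (L * |t|) • f t = v + ∫ s in (0 : ℝ)..t,
      (ω • A₁ (Real.exp (L * |s|) • f s) + A₀ s (Real.exp (L * |s|) • f s)) := by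
  rw [h t, weightedVolterra, weightedVolterra, smul_comm ω, ← smul_add, ← smul_add, smul_smul,
    ← Real.exp_add, add_neg_cancel, Real.exp_zero, one_smul, ← intervalIntegral.integral_smul,
    ← intervalIntegral.integral_add]
  · simp only [ContinuousLinearMap.map_smul_of_tower]
  · exact ((continuous_exp_smul_clm_apply L continuous_const hf).const_smul
      ω).intervalIntegrable _ _
  · exact (continuous_exp_smul_clm_apply L hA hf).intervalIntegrable _ _

theorem exists_linear_ode_ball [CompleteSpace E] (A₁ : E →L[ℂ] E) {A₀ : ℝ → E →L[ℂ] E}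
    (hA : Continuous A₀) {m : ℝ} (hAm : ∀ s, ‖A₀ s‖ ≤ m) (v : E) (R : ℝ) :
    ∃ x : ℂ → ℝ → E, (∀ ω ∈ Metric.ball (0 : ℂ) R, x ω 0 = v ∧
        ∀ t, HasDerivAt (x ω) (ω • A₁ (x ω t) + A₀ t (x ω t)) t) ∧
      ∀ t, DifferentiableOn ℂ (fun ω => x ω t) (Metric.ball 0 R) := by
  have hm : 0 ≤ m := (norm_nonneg _).trans (hAm 0)
  set L : ℝ := |R| * ‖A₁‖ + m + 1
  have hL : 0 < L := by positivity
  obtain ⟨V₁, hV₁, hn₁⟩ := exists_clm_eq_weightedVolterra (A := fun _ => A₁) continuous_const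
    (fun _ => le_rfl) hL
  obtain ⟨V₀, hV₀, hn₀⟩ := exists_clm_eq_weightedVolterra hA hAm hL
  let e : ℝ →ᵇ E := .ofNormedAddCommGroup (fun t : ℝ => Real.exp (-(L * |t|)) • v)
    (by fun_prop) ‖v‖ fun t => by
      rw [norm_smul, Real.norm_eq_abs, abs_of_pos (Real.exp_pos _)]
      exact mul_le_of_le_one_left (norm_nonneg _)
        (Real.exp_le_one_iff.2 (neg_nonpos.2 (by positivity)))
  have hcontr (ω : ℂ) (hω : ω ∈ Metric.ball (0 : ℂ) R) : ‖ω • V₁ + V₀‖ < 1 := by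
    calc ‖ω • V₁ + V₀‖ ≤ ‖ω‖ * ‖V₁‖ + ‖V₀‖ := (norm_add_le _ _).trans (by rw [norm_smul])
      _ ≤ |R| * (‖A₁‖ / L) + m / L := by
          gcongr
          exact (mem_ball_zero_iff.1 hω).le.trans (le_abs_self R)
      _ = (|R| * ‖A₁‖ + m) / L := by ring
      _ < 1 := by rw [div_lt_one hL]; linarith
  obtain ⟨f, hfix, hdiff⟩ := exists_differentiableOn_affine_fixedPoint
    (T := fun ω => ω • V₁ + V₀) (by fun_prop) hcontr e
  have hint (ω : ℂ) (hω : ω ∈ Metric.ball (0 : ℂ) R) :=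
    exp_smul_eq_add_integral A₁ hA (L := L) (ω := ω) (v := v) (f ω).continuous fun t => by
      rw [← hV₁, ← hV₀]
      exact congr($(hfix ω hω) t)
  refine ⟨fun ω t => Real.exp (L * |t|) • f ω t, fun ω hω =>
    ⟨by simpa using hint ω hω 0, hasDerivAt_of_eq_add_integral ?_ (hint ω hω)⟩, fun t => ?_⟩
  · have hx : Continuous fun s : ℝ => Real.exp (L * |s|) • f ω s :=
      continuous_exp_mul_abs_smul L (f ω).continuous
    exact ((A₁.continuous.comp hx).const_smul ω).add (hA.clm_apply hx)
  · exact DifferentiableOn.fun_const_smul (c := Real.exp (L * |t|))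
      ((BoundedContinuousFunction.evalCLM ℂ t).differentiable.comp_differentiableOn hdiff)

theorem linear_ode_unique (A₁ : E →L[ℂ] E) {A₀ : ℝ → E →L[ℂ] E} {m : ℝ}
    (hAm : ∀ s, ‖A₀ s‖ ≤ m) (ω : ℂ) {x y : ℝ → E} {t₀ : ℝ}
    (hx : ∀ t, HasDerivAt x (ω • A₁ (x t) + A₀ t (x t)) t)
    (hy : ∀ t, HasDerivAt y (ω • A₁ (y t) + A₀ t (y t)) t) (h0 : x t₀ = y t₀) : x = y := by
  have hm : 0 ≤ m := (norm_nonneg _).trans (hAm 0)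
  refine ODE_solution_unique_univ (v := fun t z => ω • A₁ z + A₀ t z) (s := fun _ => Set.univ)
    (K := (‖ω‖ * ‖A₁‖ + m).toNNReal) (fun t => LipschitzWith.lipschitzOnWith
      ((ω • A₁ + A₀ t).lipschitz.weaken ?_))
    (fun t => ⟨hx t, Set.mem_univ _⟩) (fun t => ⟨hy t, Set.mem_univ _⟩) h0
  rw [← NNReal.coe_le_coe, coe_nnnorm, Real.coe_toNNReal _ (by positivity)]
  calc ‖ω • A₁ + A₀ t‖ ≤ ‖ω‖ * ‖A₁‖ + ‖A₀ t‖ := (norm_add_le _ _).trans (by rw [norm_smul])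
    _ ≤ ‖ω‖ * ‖A₁‖ + m := by gcongr; exact hAm t

theorem exists_linear_ode [CompleteSpace E] (A₁ : E →L[ℂ] E) {A₀ : ℝ → E →L[ℂ] E}
    (hA : Continuous A₀) {m : ℝ} (hAm : ∀ s, ‖A₀ s‖ ≤ m) (v : E) :
    ∃ x : ℂ → ℝ → E, (∀ ω, x ω 0 = v) ∧
      (∀ ω t, HasDerivAt (x ω) (ω • A₁ (x ω t) + A₀ t (x ω t)) t) ∧
      ∀ t, Differentiable ℂ fun ω => x ω t := by
  choose X hX hXd using fun ω : ℂ => exists_linear_ode_ball A₁ hA hAm v (‖ω‖ + 1)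
  have hself (ω : ℂ) : ω ∈ Metric.ball (0 : ℂ) (‖ω‖ + 1) := by simp
  refine ⟨fun ω => X ω ω, fun ω => (hX ω ω (hself ω)).1, fun ω => (hX ω ω (hself ω)).2,
    fun t ω => ?_⟩
  have hU : Metric.ball (0 : ℂ) (‖ω‖ + 1) ∈ 𝓝 ω := Metric.isOpen_ball.mem_nhds (hself ω)
  refine ((hXd ω t).differentiableAt hU).congr_of_eventuallyEq ?_
  filter_upwards [hU] with z hz
  obtain ⟨hz0, hz'⟩ := hX z z (hself z)
  obtain ⟨hω0, hω'⟩ := hX ω z hz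
  exact congrFun (linear_ode_unique A₁ hAm z hz' hω' (hz0.trans hω0.symm)) t

end LinearODE

/-! ### The linear system over the Riccati equation `ζ' = iωζ + (K/2) (η - conj η ζ²)` -/

theorem abs_re_mul_mul_conj_le {a : ℂ} (ha : ‖a‖ ≤ 1) (b c : ℂ) :
    |(a * b * (starRingEnd ℂ) c).re| ≤ (‖b‖ ^ 2 + ‖c‖ ^ 2) / 2 := by
  refine (Complex.abs_re_le_norm _).trans ?_
  rw [norm_mul, norm_mul, RCLike.norm_conj]
  have hle : ‖a‖ * ‖b‖ * ‖c‖ ≤ 1 * ‖b‖ * ‖c‖ := by gcongr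
  linarith [two_mul_le_add_sq ‖b‖ ‖c‖]

theorem energy_deriv_nonneg (K : ℝ) {w D S T c : ℝ} (hw₁ : -1 ≤ w) (hw₀ : w ≤ 0) (hwc : -c ≤ w)
    (hDS : D ≤ S) (hS : 0 ≤ S) (hT : |T| ≤ S / 2) :
    0 ≤ w * S + ((2 + |K|) * c * S + c * (w * D + 2 * K * T)) := by
  have hc : 0 ≤ c := by linarith
  have hwD : -S ≤ w * D := by nlinarith
  have hKT : -(|K| * S) ≤ 2 * K * T := by
    have hKT' : |K * T| ≤ |K| * (S / 2) := by rw [abs_mul]; gcongr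
    linarith [neg_abs_le (K * T)]
  have hwS : -(c * S) ≤ w * S := by nlinarith
  have hsum : c * (-S - |K| * S) ≤ c * (w * D + 2 * K * T) := by gcongr; linarith
  linarith

/-- `(p, q)` solves the linear system for which `p / q` solves the Riccati equation. -/
structure IsRiccatiLift (K : ℝ) (η : ℝ → ℂ) (ω : ℂ) (p q : ℝ → ℂ) : Prop where
  fst : ∀ t, HasDerivAt p (Complex.I * ω / 2 * p t + K / 2 * η t * q t) t
  snd : ∀ t, HasDerivAt q
    (-(Complex.I * ω / 2) * q t + K / 2 * (starRingEnd ℂ) (η t) * p t) t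

namespace IsRiccatiLift

variable {K : ℝ} {η : ℝ → ℂ} {ω : ℂ} {p q : ℝ → ℂ}

theorem mul_add {a b c d : ℝ → ℂ} (hac : IsRiccatiLift K η ω a c) (hbd : IsRiccatiLift K η ω b d)
    (z : ℂ) : IsRiccatiLift K η ω (fun t => a t * z + b t) fun t => c t * z + d t := by
  constructor <;> intro t
  · refine (((hac.fst t).mul_const z).fun_add (hbd.fst t)).congr_deriv ?_
    ring
  · refine (((hac.snd t).mul_const z).fun_add (hbd.snd t)).congr_deriv ?_
    ring

theorem hasDerivAt_normSq_sub (h : IsRiccatiLift K η ω p q) (t : ℝ) :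
    HasDerivAt (fun t => ‖q t‖ ^ 2 - ‖p t‖ ^ 2) (ω.im * (‖q t‖ ^ 2 + ‖p t‖ ^ 2)) t := by
  refine (((h.snd t).norm_sq).fun_sub ((h.fst t).norm_sq)).congr_deriv ?_
  simp only [Complex.inner, Complex.sq_norm, Complex.normSq_apply]
  simp
  ring

theorem hasDerivAt_normSq_add (h : IsRiccatiLift K η ω p q) (t : ℝ) :
    HasDerivAt (fun t => ‖q t‖ ^ 2 + ‖p t‖ ^ 2) (ω.im * (‖q t‖ ^ 2 - ‖p t‖ ^ 2) +
      2 * K * (η t * q t * (starRingEnd ℂ) (p t)).re) t := by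
  refine (((h.snd t).norm_sq).fun_add ((h.fst t).norm_sq)).congr_deriv ?_
  simp only [Complex.inner, Complex.sq_norm, Complex.normSq_apply]
  simp
  ring

theorem norm_eq (h : IsRiccatiLift K η ω p q) (hω : ω.im = 0) (h0 : ‖p 0‖ = ‖q 0‖) (t : ℝ) :
    ‖p t‖ = ‖q t‖ := by
  have hconst := is_const_of_deriv_eq_zero (fun s => (h.hasDerivAt_normSq_sub s).differentiableAt)
    (fun s => by rw [(h.hasDerivAt_normSq_sub s).deriv, hω, zero_mul]) t 0
  simp only [h0, sub_self] at hconst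
  exact (sq_eq_sq₀ (norm_nonneg _) (norm_nonneg _)).1 (by linarith)

theorem norm_le (h : IsRiccatiLift K η ω p q) (hω : 0 ≤ ω.im) (h0 : ‖p 0‖ = ‖q 0‖) {t : ℝ}
    (ht : 0 ≤ t) : ‖p t‖ ≤ ‖q t‖ := by
  have hmono : Monotone fun t => ‖q t‖ ^ 2 - ‖p t‖ ^ 2 :=
    monotone_of_deriv_nonneg (fun s => (h.hasDerivAt_normSq_sub s).differentiableAt)
      fun s => by rw [(h.hasDerivAt_normSq_sub s).deriv]; positivity
  have hle := hmono ht
  simp only [h0, sub_self] at hle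
  exact (sq_le_sq₀ (norm_nonneg _) (norm_nonneg _)).1 (by linarith)

theorem normSq_sub_add_exp_nonneg (h : IsRiccatiLift K η ω p q) (hη : ∀ t, ‖η t‖ ≤ 1) {ε : ℝ}
    (hε1 : ε ≤ 1) (hω : -ε ≤ ω.im) (hω' : ω.im ≤ 0) (h0 : ‖p 0‖ = ‖q 0‖) {t : ℝ} (ht : 0 ≤ t) :
    0 ≤ ‖q t‖ ^ 2 - ‖p t‖ ^ 2 +
      ε * Real.exp ((2 + |K|) * t) * (‖q t‖ ^ 2 + ‖p t‖ ^ 2) := by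
  have hε : 0 ≤ ε := by linarith
  have hexp (s : ℝ) : HasDerivAt (fun s => ε * Real.exp ((2 + |K|) * s))
      (ε * (Real.exp ((2 + |K|) * s) * ((2 + |K|) * 1))) s :=
    (((hasDerivAt_id s).const_mul (2 + |K|)).exp).const_mul ε
  have hderiv (s : ℝ) :=
    (h.hasDerivAt_normSq_sub s).add ((hexp s).mul (h.hasDerivAt_normSq_add s))
  have hmono : MonotoneOn (fun t => ‖q t‖ ^ 2 - ‖p t‖ ^ 2 +
      ε * Real.exp ((2 + |K|) * t) * (‖q t‖ ^ 2 + ‖p t‖ ^ 2)) (Set.Ici 0) := by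
    refine monotoneOn_of_deriv_nonneg (convex_Ici 0)
      (fun s _ => (hderiv s).continuousAt.continuousWithinAt)
      (fun s _ => (hderiv s).differentiableAt.differentiableWithinAt) fun s hs => ?_
    have hs0 : 0 ≤ s := interior_subset hs
    have hle : ε ≤ ε * Real.exp ((2 + |K|) * s) :=
      le_mul_of_one_le_right hε (Real.one_le_exp (by positivity))
    have hnonneg := energy_deriv_nonneg K (c := ε * Real.exp ((2 + |K|) * s)) (by linarith) hω'
      (by linarith)
      (by linarith [sq_nonneg ‖p s‖] : ‖q s‖ ^ 2 - ‖p s‖ ^ 2 ≤ ‖q s‖ ^ 2 + ‖p s‖ ^ 2)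
      (by positivity) (abs_re_mul_mul_conj_le (hη s) (q s) (p s))
    exact (hnonneg.trans_eq (by ring)).trans_eq (hderiv s).deriv.symm
  refine le_trans ?_ (hmono Set.self_mem_Ici ht ht)
  simp only [h0, sub_self, zero_add]
  positivity

theorem normSq_le (h : IsRiccatiLift K η ω p q) (hη : ∀ t, ‖η t‖ ≤ 1) {t : ℝ} (ht : 0 ≤ t)
    (hω : -(1 / 2 * Real.exp (-((2 + |K|) * t))) ≤ ω.im) (h0 : ‖p 0‖ = ‖q 0‖) :
    ‖p t‖ ^ 2 ≤ 3 * ‖q t‖ ^ 2 := by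
  rcases le_total 0 ω.im with hω₀ | hω₀
  · have hle := h.norm_le hω₀ h0 ht
    have hsq : ‖p t‖ ^ 2 ≤ ‖q t‖ ^ 2 := by gcongr
    linarith [sq_nonneg ‖q t‖]
  · have hexp : Real.exp (-((2 + |K|) * t)) ≤ 1 :=
      Real.exp_le_one_iff.2 (neg_nonpos.2 (by positivity))
    have henergy := h.normSq_sub_add_exp_nonneg hη (by linarith) hω hω₀ h0 ht
    rw [mul_assoc (1 / 2 : ℝ), ← Real.exp_add, neg_add_cancel, Real.exp_zero] at henergy
    linarith

/-- The diagonal part of the system, multiplied by `ω`. -/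
def diagonalPart : ℂ × ℂ →L[ℂ] ℂ × ℂ :=
  (Complex.I / 2) • (ContinuousLinearMap.inl ℂ ℂ ℂ ∘L ContinuousLinearMap.fst ℂ ℂ ℂ) -
    (Complex.I / 2) • (ContinuousLinearMap.inr ℂ ℂ ℂ ∘L ContinuousLinearMap.snd ℂ ℂ ℂ)

/-- The coupling part of the system. -/
def couplingPart (K : ℝ) (z : ℂ) : ℂ × ℂ →L[ℂ] ℂ × ℂ :=
  (K / 2 * z) • (ContinuousLinearMap.inl ℂ ℂ ℂ ∘L ContinuousLinearMap.snd ℂ ℂ ℂ) +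
    (K / 2 * (starRingEnd ℂ) z) • (ContinuousLinearMap.inr ℂ ℂ ℂ ∘L ContinuousLinearMap.fst ℂ ℂ ℂ)

theorem continuous_couplingPart (K : ℝ) : Continuous (couplingPart K) := by
  unfold couplingPart
  have : Continuous fun z : ℂ => (starRingEnd ℂ) z := Complex.continuous_conj
  fun_prop

theorem exists_norm_couplingPart_le (K : ℝ) :
    ∃ m : ℝ, ∀ z : ℂ, ‖z‖ ≤ 1 → ‖couplingPart K z‖ ≤ m := by
  obtain ⟨m, hm⟩ := (isCompact_closedBall (0 : ℂ) 1).exists_bound_of_continuousOn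
    (continuous_couplingPart K).continuousOn
  exact ⟨m, fun z hz => hm z (by simpa using hz)⟩

theorem vectorField_eq (K : ℝ) (ω z : ℂ) (x : ℂ × ℂ) :
    ω • diagonalPart x + couplingPart K z x =
      (Complex.I * ω / 2 * x.1 + K / 2 * z * x.2,
        -(Complex.I * ω / 2) * x.2 + K / 2 * (starRingEnd ℂ) z * x.1) := by
  ext <;> simp [diagonalPart, couplingPart] <;> ring

theorem hasDerivAt_prod (h : IsRiccatiLift K η ω p q) (t : ℝ) :
    HasDerivAt (fun t => (p t, q t))
      (ω • diagonalPart (p t, q t) + couplingPart K (η t) (p t, q t)) t := by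
  rw [vectorField_eq]
  exact (h.fst t).prodMk (h.snd t)

theorem eq_zero_of_eq_zero (h : IsRiccatiLift K η ω p q) (hη : ∀ t, ‖η t‖ ≤ 1) {t : ℝ}
    (hp : p t = 0) (hq : q t = 0) : q 0 = 0 := by
  obtain ⟨m, hm⟩ := exists_norm_couplingPart_le K
  have hzero (s : ℝ) : HasDerivAt (fun _ : ℝ => (0 : ℂ × ℂ))
      (ω • diagonalPart 0 + couplingPart K (η s) 0) s := by
    simpa using hasDerivAt_const s (0 : ℂ × ℂ)
  have heq := linear_ode_unique diagonalPart (fun s => hm _ (hη s)) ω (t₀ := t)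
    h.hasDerivAt_prod hzero (by simp [hp, hq])
  exact congrArg Prod.snd (congrFun heq 0)

theorem snd_ne_zero (h : IsRiccatiLift K η ω p q) (hη : ∀ t, ‖η t‖ ≤ 1) (h0 : q 0 ≠ 0) {t c : ℝ}
    (hc : ‖p t‖ ^ 2 ≤ c * ‖q t‖ ^ 2) : q t ≠ 0 := by
  intro hq
  have hp : ‖p t‖ ^ 2 ≤ 0 := by simpa [hq] using hc
  exact h0 (h.eq_zero_of_eq_zero hη (by simpa using le_antisymm hp (sq_nonneg _)) hq)

theorem hasDerivAt_div (h : IsRiccatiLift K η ω p q) {t : ℝ} (hq : q t ≠ 0) :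
    HasDerivAt (fun t => p t / q t) (Complex.I * ω * (p t / q t) +
      K / 2 * (η t - (starRingEnd ℂ) (η t) * (p t / q t) ^ 2)) t := by
  refine ((h.fst t).fun_div (h.snd t) hq).congr_deriv ?_
  field_simp
  ring

theorem hasDerivAt_div_pow (h : IsRiccatiLift K η ω p q) {t : ℝ} (hq : q t ≠ 0) {j : ℕ}
    (hj : 1 ≤ j) :
    HasDerivAt (fun t => (p t / q t) ^ j) (j * Complex.I * ω * (p t / q t) ^ j + j * K / 2 *
      (η t * (p t / q t) ^ (j - 1) - (starRingEnd ℂ) (η t) * (p t / q t) ^ (j + 1))) t := by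
  obtain ⟨k, rfl⟩ : ∃ k, j = k + 1 := ⟨j - 1, by omega⟩
  refine ((h.hasDerivAt_div hq).fun_pow (k + 1)).congr_deriv ?_
  simp only [Nat.add_sub_cancel]
  push_cast
  ring

theorem exists_entire (K : ℝ) (hηc : Continuous η) (hη : ∀ t, ‖η t‖ ≤ 1) (p₀ q₀ : ℂ) :
    ∃ p q : ℂ → ℝ → ℂ, (∀ ω, IsRiccatiLift K η ω (p ω) (q ω)) ∧ (∀ ω, p ω 0 = p₀) ∧
      (∀ ω, q ω 0 = q₀) ∧ (∀ t, Differentiable ℂ fun ω => p ω t) ∧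
      ∀ t, Differentiable ℂ fun ω => q ω t := by
  obtain ⟨m, hm⟩ := exists_norm_couplingPart_le K
  obtain ⟨x, hx0, hx, hxd⟩ := exists_linear_ode diagonalPart
    ((continuous_couplingPart K).comp hηc) (fun s => hm _ (hη s)) (p₀, q₀)
  have hx' : ∀ ω t, HasDerivAt (x ω) (Complex.I * ω / 2 * (x ω t).1 + K / 2 * η t * (x ω t).2,
        -(Complex.I * ω / 2) * (x ω t).2 + K / 2 * (starRingEnd ℂ) (η t) * (x ω t).1) t := by
    intro ω t
    rw [← vectorField_eq]
    exact hx ω t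
  exact ⟨fun ω t => (x ω t).1, fun ω t => (x ω t).2,
    fun ω => ⟨fun t => (hx' ω t).fst, fun t => (hx' ω t).snd⟩, fun ω => congrArg Prod.fst (hx0 ω),
    fun ω => congrArg Prod.snd (hx0 ω), fun t => (hxd t).fst, fun t => (hxd t).snd⟩

end IsRiccatiLift

/-! ### Uniqueness for the hierarchy of moments -/

theorem abs_div_mul_succ_le {T y y' u : ℝ} (hy : 0 ≤ y) (hy' : 0 ≤ y')
    (hT : |T| ≤ (y + y') / 2) (hu : 1 ≤ u) :
    |T / (u * (u + 1))| ≤ 1 / 2 * (y / u ^ 2) + y' / (u + 1) ^ 2 := by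
  have hleft : y / (u * (u + 1)) ≤ y / u ^ 2 := by
    gcongr
    nlinarith
  have hright : y' / (u * (u + 1)) ≤ 2 * (y' / (u + 1) ^ 2) := by
    rw [← mul_div_assoc, div_le_div_iff₀ (by positivity) (by positivity)]
    nlinarith [mul_nonneg hy' (by nlinarith : 0 ≤ 2 * (u * (u + 1)) - (u + 1) ^ 2)]
  rw [abs_div, abs_of_pos (by positivity : 0 < u * (u + 1))]
  calc |T| / (u * (u + 1)) ≤ (y + y') / 2 / (u * (u + 1)) := by gcongr
    _ = (y / (u * (u + 1)) + y' / (u * (u + 1))) / 2 := by ring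
    _ ≤ 1 / 2 * (y / u ^ 2) + y' / (u + 1) ^ 2 := by linarith

-- Summation by parts: the coefficients `1/k - 1/(k+1)` it produces are comparable to `1/k ^ 2`.
theorem abs_sum_sub_div_add_le {y T : ℕ → ℝ} (hy : ∀ k, 0 ≤ y k) (hT0 : T 0 = 0)
    (hT : ∀ k, |T k| ≤ (y k + y (k + 1)) / 2) (m : ℕ) :
    |(∑ k ∈ Finset.range (m + 1), (T k - T (k + 1)) / ((k : ℝ) + 1)) + T (m + 1) / ((m : ℝ) + 1)| ≤
      3 / 2 * ∑ k ∈ Finset.range (m + 1), y (k + 1) / ((k : ℝ) + 1) ^ 2 -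
        1 / 2 * (y (m + 1) / ((m : ℝ) + 1) ^ 2) := by
  induction m with
  | zero =>
    simp only [zero_add, Finset.sum_range_one, hT0, Nat.cast_zero, div_one, one_pow, zero_sub,
      neg_add_cancel, abs_zero]
    linarith [hy 1]
  | succ m ih =>
    rw [Finset.sum_range_succ, Finset.sum_range_succ (fun k => y (k + 1) / ((k : ℝ) + 1) ^ 2)]
    push_cast
    set A := ∑ k ∈ Finset.range (m + 1), (T k - T (k + 1)) / ((k : ℝ) + 1)
    set u : ℝ := (m : ℝ) + 1 with hu
    have hu1 : 1 ≤ u := by rw [hu]; linarith [(Nat.cast_nonneg m : (0 : ℝ) ≤ m)]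
    have hsum : A + (T (m + 1) - T (m + 1 + 1)) / (u + 1) + T (m + 1 + 1) / (u + 1) =
        (A + T (m + 1) / u) - T (m + 1) / (u * (u + 1)) := by
      field_simp
      ring
    rw [hsum]
    linarith [abs_sub (A + T (m + 1) / u) (T (m + 1) / (u * (u + 1))),
      abs_div_mul_succ_le (hy _) (hy _) (hT (m + 1)) hu1]

/-- `X` solves, for `t ≥ 0`, the equations of the moments `Z_j`, `j ≥ 1`, with the order parameter
`η` regarded as a given function: this makes the hierarchy linear. -/
def IsMomentHierarchy (K ω : ℝ) (η : ℝ → ℂ) (X : ℕ → ℝ → ℂ) : Prop :=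
  ∀ j : ℕ, 1 ≤ j → ∀ t, 0 ≤ t → HasDerivWithinAt (X j)
    (j * Complex.I * ω * X j t + j * K / 2 *
      (η t * X (j - 1) t - (starRingEnd ℂ) (η t) * X (j + 1) t)) (Set.Ici 0) t

/-- The amount `Re (η X_k conj X_{k+1})` exchanged by the moments of orders `k` and `k + 1`. -/
def momentFlux (η : ℝ → ℂ) (X : ℕ → ℝ → ℂ) (k : ℕ) (t : ℝ) : ℝ :=
  (η t * X k t * (starRingEnd ℂ) (X (k + 1) t)).re

/-- The truncated energy `∑_{j ≤ m + 1} |X_j|² / j²`; the weights make the exchanges between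
neighbouring moments summable. -/
def momentEnergy (X : ℕ → ℝ → ℂ) (m : ℕ) (t : ℝ) : ℝ :=
  ∑ k ∈ Finset.range (m + 1), ‖X (k + 1) t‖ ^ 2 / ((k : ℝ) + 1) ^ 2

theorem momentEnergy_nonneg (X : ℕ → ℝ → ℂ) (m : ℕ) (t : ℝ) : 0 ≤ momentEnergy X m t :=
  Finset.sum_nonneg fun _ _ => by positivity

theorem norm_sq_div_le_momentEnergy (X : ℕ → ℝ → ℂ) {k m : ℕ} (hk : k ≤ m) (t : ℝ) :
    ‖X (k + 1) t‖ ^ 2 / ((k : ℝ) + 1) ^ 2 ≤ momentEnergy X m t :=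
  Finset.single_le_sum (f := fun k : ℕ => ‖X (k + 1) t‖ ^ 2 / ((k : ℝ) + 1) ^ 2)
    (fun _ _ => by positivity) (Finset.mem_range.2 (Nat.lt_succ_of_le hk))

theorem IsMomentHierarchy.hasDerivWithinAt_momentEnergy {K ω : ℝ} {η : ℝ → ℂ} {X : ℕ → ℝ → ℂ}
    (h : IsMomentHierarchy K ω η X) (m : ℕ) {t : ℝ} (ht : 0 ≤ t) :
    HasDerivWithinAt (momentEnergy X m) (K * ∑ k ∈ Finset.range (m + 1),
      (momentFlux η X k t - momentFlux η X (k + 1) t) / ((k : ℝ) + 1)) (Set.Ici 0) t := by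
  rw [Finset.mul_sum]
  refine HasDerivWithinAt.fun_sum fun k _ => ?_
  refine (((h (k + 1) (by omega) t ht).norm_sq).div_const (((k : ℝ) + 1) ^ 2)).congr_deriv ?_
  simp only [momentFlux, Complex.inner, Nat.add_sub_cancel]
  have hk : ((k : ℝ) + 1) ≠ 0 := by positivity
  simp
  field_simp
  ring

theorem abs_sum_momentFlux_le {η : ℝ → ℂ} {X : ℕ → ℝ → ℂ} {b t : ℝ} (hη : ‖η t‖ ≤ 1)
    (h0 : X 0 t = 0) (hb : ∀ j, ‖X j t‖ ≤ b) (m : ℕ) :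
    |∑ k ∈ Finset.range (m + 1), (momentFlux η X k t - momentFlux η X (k + 1) t) / ((k : ℝ) + 1)| ≤
      3 / 2 * momentEnergy X m t + b ^ 2 / ((m : ℝ) + 1) := by
  have hflux (k : ℕ) : |momentFlux η X k t| ≤ (‖X k t‖ ^ 2 + ‖X (k + 1) t‖ ^ 2) / 2 :=
    abs_re_mul_mul_conj_le hη _ _
  have hlast : |momentFlux η X (m + 1) t / ((m : ℝ) + 1)| ≤ b ^ 2 / ((m : ℝ) + 1) := by
    have hsq (j : ℕ) : ‖X j t‖ ^ 2 ≤ b ^ 2 := by gcongr; exact hb j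
    rw [abs_div, abs_of_pos (by positivity : 0 < (m : ℝ) + 1)]
    gcongr
    linarith [hflux (m + 1), hsq (m + 1), hsq (m + 1 + 1)]
  have hparts := abs_sum_sub_div_add_le (y := fun k => ‖X k t‖ ^ 2)
    (T := fun k => momentFlux η X k t) (fun k => sq_nonneg _) (by simp [momentFlux, h0]) hflux m
  have htri := abs_sub ((∑ k ∈ Finset.range (m + 1),
    (momentFlux η X k t - momentFlux η X (k + 1) t) / ((k : ℝ) + 1)) +
      momentFlux η X (m + 1) t / ((m : ℝ) + 1)) (momentFlux η X (m + 1) t / ((m : ℝ) + 1))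
  rw [add_sub_cancel_right] at htri
  have hpos : 0 ≤ ‖X (m + 1) t‖ ^ 2 / ((m : ℝ) + 1) ^ 2 := by positivity
  unfold momentEnergy
  linarith

theorem IsMomentHierarchy.momentEnergy_le_gronwallBound {K ω : ℝ} {η : ℝ → ℂ} {X : ℕ → ℝ → ℂ}
    (h : IsMomentHierarchy K ω η X) (hη : ∀ t, 0 ≤ t → ‖η t‖ ≤ 1) (h0 : ∀ t, 0 ≤ t → X 0 t = 0)
    {b : ℝ} (hb : ∀ j t, 0 ≤ t → ‖X j t‖ ≤ b) (hi : ∀ j, X j 0 = 0) (m : ℕ) {t : ℝ}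
    (ht : 0 ≤ t) :
    momentEnergy X m t ≤ gronwallBound 0 (3 / 2 * |K|) (|K| * b ^ 2 / ((m : ℝ) + 1)) t := by
  have hgron := norm_le_gronwallBound_of_norm_deriv_right_le (f := momentEnergy X m) (δ := 0)
    (K := 3 / 2 * |K|) (ε := |K| * b ^ 2 / ((m : ℝ) + 1)) (a := 0) (b := t)
    (fun s hs => ((h.hasDerivWithinAt_momentEnergy m hs.1).mono
      Set.Icc_subset_Ici_self).continuousWithinAt)
    (fun s hs => (h.hasDerivWithinAt_momentEnergy m hs.1).mono (Set.Ici_subset_Ici.2 hs.1))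
    (by simp [momentEnergy, hi])
    (fun s hs => by
      have hsum := abs_sum_momentFlux_le (hη s hs.1) (h0 s hs.1) (fun j => hb j s hs.1) m
      rw [Real.norm_eq_abs, Real.norm_eq_abs, abs_of_nonneg (momentEnergy_nonneg X m s), abs_mul]
      exact (mul_le_mul_of_nonneg_left hsum (abs_nonneg K)).trans_eq (by ring)) t ⟨ht, le_rfl⟩
  rw [sub_zero] at hgron
  exact (le_abs_self _).trans hgron

theorem tendsto_gronwallBound_div_atTop (K c t : ℝ) :
    Tendsto (fun m : ℕ => gronwallBound 0 K (c / ((m : ℝ) + 1)) t) atTop (𝓝 0) := by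
  have hcont := (gronwallBound_continuous_ε 0 K t).tendsto 0
  rw [gronwallBound_ε0, zero_mul] at hcont
  exact hcont.comp (tendsto_const_nhds.div_atTop
    (tendsto_atTop_add_const_right _ 1 tendsto_natCast_atTop_atTop))

theorem IsMomentHierarchy.eq_zero {K ω : ℝ} {η : ℝ → ℂ} {X : ℕ → ℝ → ℂ}
    (h : IsMomentHierarchy K ω η X) (hη : ∀ t, 0 ≤ t → ‖η t‖ ≤ 1) (h0 : ∀ t, 0 ≤ t → X 0 t = 0)
    {b : ℝ} (hb : ∀ j t, 0 ≤ t → ‖X j t‖ ≤ b) (hi : ∀ j, X j 0 = 0) (j : ℕ) {t : ℝ}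
    (ht : 0 ≤ t) : X j t = 0 := by
  obtain _ | k := j
  · exact h0 t ht
  have hle : ‖X (k + 1) t‖ ^ 2 / ((k : ℝ) + 1) ^ 2 ≤ 0 :=
    ge_of_tendsto (tendsto_gronwallBound_div_atTop (3 / 2 * |K|) (|K| * b ^ 2) t)
      (eventually_atTop.2 ⟨k, fun m hm => (norm_sq_div_le_momentEnergy X hm t).trans
        (h.momentEnergy_le_gronwallBound hη h0 hb hi m ht)⟩)
  rw [div_le_iff₀ (by positivity), zero_mul] at hle
  exact norm_eq_zero.1 (pow_eq_zero_iff two_ne_zero |>.1 (le_antisymm hle (sq_nonneg _)))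

theorem IsMomentHierarchy.eq_of_bounded {K ω : ℝ} {η : ℝ → ℂ} {X Y : ℕ → ℝ → ℂ}
    (hX : IsMomentHierarchy K ω η X) (hY : IsMomentHierarchy K ω η Y)
    (hη : ∀ t, 0 ≤ t → ‖η t‖ ≤ 1) (h0 : ∀ t, 0 ≤ t → X 0 t = Y 0 t) {b : ℝ}
    (hbX : ∀ j t, 0 ≤ t → ‖X j t‖ ≤ b) (hbY : ∀ j t, 0 ≤ t → ‖Y j t‖ ≤ b)
    (hi : ∀ j, X j 0 = Y j 0) (j : ℕ) {t : ℝ} (ht : 0 ≤ t) : X j t = Y j t := by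
  have hsub : IsMomentHierarchy K ω η fun j t => X j t - Y j t := fun j hj t ht =>
    ((hX j hj t ht).fun_sub (hY j hj t ht)).congr_deriv (by ring)
  exact sub_eq_zero.1 (hsub.eq_zero hη (fun s hs => sub_eq_zero.2 (h0 s hs))
    (fun k s hs => norm_sub_le_of_le (hbX k s hs) (hbY k s hs))
    (fun k => sub_eq_zero.2 (hi k)) j ht)

/-! ### Holomorphic dependence of integrals on a parameter -/

theorem aestronglyMeasurable_deriv {X 𝕜 E : Type*} [MeasurableSpace X] {ν : Measure X}
    [NontriviallyNormedField 𝕜] [NormedAddCommGroup E] [NormedSpace 𝕜 E] {f : 𝕜 → X → E} {z₀ : 𝕜}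
    (hm : ∀ᶠ z in 𝓝 z₀, AEStronglyMeasurable (f z) ν)
    (hd : ∀ᵐ x ∂ν, DifferentiableAt 𝕜 (fun z => f z x) z₀) :
    AEStronglyMeasurable (fun x => deriv (fun z => f z x) z₀) ν := by
  obtain ⟨u, hu, hmu⟩ := exists_seq_forall_of_frequently
    (hm.filter_mono nhdsWithin_le_nhds : ∀ᶠ z in 𝓝[≠] z₀, AEStronglyMeasurable (f z) ν).frequently
  refine aestronglyMeasurable_of_tendsto_ae atTop
    (f := fun k x => slope (fun z => f z x) z₀ (u k)) (fun k => ?_) ?_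
  · simp only [slope_def_module]
    exact ((hmu k).fun_sub hm.self_of_nhds).fun_const_smul _
  · filter_upwards [hd] with x hx
    exact (hasDerivAt_iff_tendsto_slope.1 hx.hasDerivAt).comp hu

theorem norm_deriv_le_div {E : Type*} [NormedAddCommGroup E] [NormedSpace ℂ E]
    {f : ℂ → E} {z : ℂ} {r B : ℝ} (hr : 0 < r) (hf : DifferentiableOn ℂ f (Metric.closedBall z r))
    (hb : ∀ w ∈ Metric.closedBall z r, ‖f w‖ ≤ B) : ‖deriv f z‖ ≤ B / r :=
  Complex.norm_deriv_le_of_forall_mem_sphere_norm_le hr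
    (hf.diffContOnCl_ball subset_rfl) fun w hw => hb w (Metric.sphere_subset_closedBall hw)

theorem differentiableOn_integral_of_norm_le {X E : Type*} [MeasurableSpace X] {ν : Measure X}
    [IsFiniteMeasure ν] [NormedAddCommGroup E] [NormedSpace ℂ E] {f : ℂ → X → E} {U : Set ℂ}
    (hU : IsOpen U) {B : ℝ} (hm : ∀ z ∈ U, AEStronglyMeasurable (f z) ν)
    (hd : ∀ᵐ x ∂ν, DifferentiableOn ℂ (fun z => f z x) U)
    (hb : ∀ᵐ x ∂ν, ∀ z ∈ U, ‖f z x‖ ≤ B) :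
    DifferentiableOn ℂ (fun z => ∫ x, f z x ∂ν) U := by
  intro z₀ hz₀
  obtain ⟨r, hr, hball⟩ := Metric.nhds_basis_closedBall.mem_iff.1 (hU.mem_nhds hz₀)
  have hsub (z : ℂ) (hz : z ∈ Metric.ball z₀ (r / 2)) : Metric.closedBall z (r / 2) ⊆ U :=
    (Metric.closedBall_subset_closedBall' (by linarith [Metric.mem_ball.1 hz])).trans hball
  have hder : ∀ᵐ x ∂ν, ∀ z ∈ U, HasDerivAt (fun z => f z x) (deriv (fun z => f z x) z) z :=
    hd.mono fun x hx z hz => (hx.differentiableAt (hU.mem_nhds hz)).hasDerivAt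
  refine (hasDerivAt_integral_of_dominated_loc_of_deriv_le (bound := fun _ => B / (r / 2))
    (F' := fun z x => deriv (fun z => f z x) z) (Metric.ball_mem_nhds z₀ (half_pos hr))
    ?_ ?_ ?_ ?_ (integrable_const _) ?_).2.differentiableAt.differentiableWithinAt
  · filter_upwards [hU.mem_nhds hz₀] with z hz using hm z hz
  · exact (integrable_const B).mono' (hm z₀ hz₀) (hb.mono fun x hx => hx z₀ hz₀)
  · exact aestronglyMeasurable_deriv ((hU.mem_nhds hz₀ |> Filter.mem_of_superset) hm)
      (hder.mono fun x hx => (hx z₀ hz₀).differentiableAt)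
  · filter_upwards [hd, hb] with x hx hbx z hz using norm_deriv_le_div (half_pos hr)
      (hx.mono (hsub z hz)) fun w hw => hbx w (hsub z hz hw)
  · exact hder.mono fun x hx z hz =>
      hx z (hsub z hz (Metric.mem_closedBall_self (half_pos hr).le))

/-! ### Moments and the order parameter -/

theorem fourier_eq_pow {T : ℝ} (j : ℕ) (θ : AddCircle T) :
    (fourier (j : ℤ) θ : ℂ) = (fourier 1 θ : ℂ) ^ j := by
  rw [fourier_apply, fourier_apply, one_zsmul, AddCircle.toCircle_zsmul]
  simp

theorem norm_fourier_apply {T : ℝ} (j : ℤ) (θ : AddCircle T) : ‖(fourier j θ : ℂ)‖ = 1 := by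
  rw [fourier_apply]
  exact Circle.norm_coe _

namespace IsKuramotoSolution

variable {K : ℝ} {g : ℝ → ℝ} {h : Measure (AddCircle (2 * Real.pi))}
  {ρ : ℝ → Kernel ℝ (AddCircle (2 * Real.pi))}

theorem norm_circleMoment_le (hρ : IsKuramotoSolution K g h ρ) (j : ℕ) {t : ℝ} (ht : 0 ≤ t)
    (ω : ℝ) : ‖circleMoment ρ j t ω‖ ≤ 1 := by
  have := hρ.markov t ht
  simpa [circleMoment] using norm_integral_le_of_norm_le_const (μ := ρ t ω)
    (ae_of_all _ fun θ => (norm_fourier_apply (j : ℤ) θ).le)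

theorem circleMoment_zero (hρ : IsKuramotoSolution K g h ρ) {t : ℝ} (ht : 0 ≤ t) (ω : ℝ) :
    circleMoment ρ 0 t ω = 1 := by
  have := hρ.markov t ht
  simp [circleMoment]

theorem stronglyMeasurable_circleMoment (hρ : IsKuramotoSolution K g h ρ) (j : ℕ) {t : ℝ}
    (ht : 0 ≤ t) : StronglyMeasurable (circleMoment ρ j t) := by
  have := hρ.markov t ht
  exact StronglyMeasurable.integral_kernel (fourier (j : ℤ)).continuous.stronglyMeasurable

theorem continuousOn_orderParameter (hρ : IsKuramotoSolution K g h ρ) (hg : Integrable g) :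
    ContinuousOn (orderParameter g ρ) (Set.Ici 0) := by
  intro t ht
  refine continuousWithinAt_of_dominated (bound := fun ω => ‖g ω‖) ?_ ?_ hg.norm
    (ae_of_all _ fun ω => ?_)
  · filter_upwards [self_mem_nhdsWithin] with s hs
    exact (hρ.stronglyMeasurable_circleMoment 1 hs).aestronglyMeasurable.mul
      hg.ofReal.aestronglyMeasurable
  · filter_upwards [self_mem_nhdsWithin] with s hs
    refine ae_of_all _ fun ω => ?_
    rw [norm_mul, Complex.norm_real]
    exact mul_le_of_le_one_left (norm_nonneg _) (hρ.norm_circleMoment_le 1 hs ω)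
  · exact (hρ.moments 1 le_rfl ω t ht).continuousWithinAt.mul continuousWithinAt_const

theorem norm_orderParameter_le (hρ : IsKuramotoSolution K g h ρ) (hg : Integrable g)
    (hg₀ : ∀ ω, 0 ≤ g ω) {t : ℝ} (ht : 0 ≤ t) : ‖orderParameter g ρ t‖ ≤ ∫ ω, g ω := by
  refine norm_integral_le_of_norm_le hg (ae_of_all _ fun ω => ?_)
  rw [norm_mul, Complex.norm_real, Real.norm_of_nonneg (hg₀ ω)]
  exact mul_le_of_le_one_left (hg₀ ω) (hρ.norm_circleMoment_le 1 ht ω)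

theorem isMomentHierarchy_circleMoment (hρ : IsKuramotoSolution K g h ρ) {η : ℝ → ℂ}
    (hη : ∀ t, 0 ≤ t → η t = orderParameter g ρ t) (ω : ℝ) :
    IsMomentHierarchy K ω η fun j t => circleMoment ρ j t ω := fun j hj t ht => by
  simpa only [hη t ht] using hρ.moments j hj ω t ht

end IsKuramotoSolution

/-! ### Möbius transport of the initial measure -/

/-- The Möbius transformation of `z` with coefficients `a, b, c, d` at time `t` and frequency
`ω`. -/
def moebius (a b c d : ℂ → ℝ → ℂ) (t : ℝ) (ω z : ℂ) : ℂ :=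
  (a ω t * z + b ω t) / (c ω t * z + d ω t)

/-- The moments of the image of `h` under the Möbius transformations with coefficients
`a, b, c, d`. -/
def moebiusMoment {T : ℝ} (h : Measure (AddCircle T)) (a b c d : ℂ → ℝ → ℂ) (j : ℕ) (t : ℝ)
    (ω : ℂ) : ℂ :=
  ∫ θ, moebius a b c d t ω (fourier 1 θ) ^ j ∂h

theorem aestronglyMeasurable_moebius_pow {T : ℝ} (h : Measure (AddCircle T))
    (a b c d : ℂ → ℝ → ℂ) (j : ℕ) (t : ℝ) (ω : ℂ) :
    AEStronglyMeasurable (fun θ : AddCircle T => moebius a b c d t ω (fourier 1 θ) ^ j) h := by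
  have hmeas : Measurable fun θ : AddCircle T => (fourier 1 θ : ℂ) :=
    (fourier 1).continuous.measurable
  unfold moebius
  exact Measurable.aestronglyMeasurable (by fun_prop)

theorem norm_moebiusMoment_le {T : ℝ} {h : Measure (AddCircle T)} [IsProbabilityMeasure h]
    {a b c d : ℂ → ℝ → ℂ} {t : ℝ} {ω : ℂ} {B : ℝ}
    (hB : ∀ z, ‖z‖ = 1 → ‖moebius a b c d t ω z‖ ≤ B) (j : ℕ) :
    ‖moebiusMoment h a b c d j t ω‖ ≤ B ^ j := by
  have hpow (θ : AddCircle T) : ‖moebius a b c d t ω (fourier 1 θ) ^ j‖ ≤ B ^ j := by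
    rw [norm_pow]
    gcongr
    exact hB _ (norm_fourier_apply 1 θ)
  simpa [moebiusMoment] using norm_integral_le_of_norm_le_const (μ := h) (ae_of_all _ hpow)

/-- The columns `(a, c)` and `(b, d)` are the solutions with initial values `(1, 0)` and `(0, 1)`
of the linear system over the Riccati equation, and depend holomorphically on the frequency. -/
structure IsFundamentalSystem (K : ℝ) (η : ℝ → ℂ) (a b c d : ℂ → ℝ → ℂ) : Prop where
  left : ∀ ω, IsRiccatiLift K η ω (a ω) (c ω)
  right : ∀ ω, IsRiccatiLift K η ω (b ω) (d ω)
  a_zero : ∀ ω, a ω 0 = 1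
  b_zero : ∀ ω, b ω 0 = 0
  c_zero : ∀ ω, c ω 0 = 0
  d_zero : ∀ ω, d ω 0 = 1
  differentiable_a : ∀ t, Differentiable ℂ fun ω => a ω t
  differentiable_b : ∀ t, Differentiable ℂ fun ω => b ω t
  differentiable_c : ∀ t, Differentiable ℂ fun ω => c ω t
  differentiable_d : ∀ t, Differentiable ℂ fun ω => d ω t

theorem exists_isFundamentalSystem (K : ℝ) {η : ℝ → ℂ} (hηc : Continuous η)
    (hη : ∀ t, ‖η t‖ ≤ 1) : ∃ a b c d, IsFundamentalSystem K η a b c d := by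
  obtain ⟨a, c, hac, ha₀, hc₀, ha, hc⟩ := IsRiccatiLift.exists_entire K hηc hη 1 0
  obtain ⟨b, d, hbd, hb₀, hd₀, hb, hd⟩ := IsRiccatiLift.exists_entire K hηc hη 0 1
  exact ⟨a, b, c, d, hac, hbd, ha₀, hb₀, hc₀, hd₀, ha, hb, hc, hd⟩

theorem norm_momentField_le {K ω : ℝ} {z e : ℂ} (hz : ‖z‖ = 1) (he : ‖e‖ ≤ 1) (j : ℕ) :
    ‖j * Complex.I * ω * z ^ j +
      j * K / 2 * (e * z ^ (j - 1) - (starRingEnd ℂ) e * z ^ (j + 1))‖ ≤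
      j * |ω| + j * |K| := by
  have hcoupling : ‖e * z ^ (j - 1) - (starRingEnd ℂ) e * z ^ (j + 1)‖ ≤ 2 := by
    refine (norm_sub_le _ _).trans ?_
    rw [norm_mul, norm_mul, norm_pow, norm_pow, hz, RCLike.norm_conj, one_pow, one_pow]
    linarith
  calc _ ≤ j * |ω| + j * |K| / 2 *
        ‖e * z ^ (j - 1) - (starRingEnd ℂ) e * z ^ (j + 1)‖ := by
        refine (norm_add_le _ _).trans_eq ?_
        simp [hz]
    _ ≤ j * |ω| + j * |K| / 2 * 2 := by gcongr
    _ = j * |ω| + j * |K| := by ring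

namespace IsFundamentalSystem

variable {K : ℝ} {η : ℝ → ℂ} {a b c d : ℂ → ℝ → ℂ}

theorem lift (hF : IsFundamentalSystem K η a b c d) (ω z : ℂ) :
    IsRiccatiLift K η ω (fun t => a ω t * z + b ω t) fun t => c ω t * z + d ω t :=
  (hF.left ω).mul_add (hF.right ω) z

theorem moebius_zero (hF : IsFundamentalSystem K η a b c d) (ω z : ℂ) :
    moebius a b c d 0 ω z = z := by
  simp [moebius, hF.a_zero, hF.b_zero, hF.c_zero, hF.d_zero]

theorem norm_lift_zero (hF : IsFundamentalSystem K η a b c d) (ω : ℂ) {z : ℂ} (hz : ‖z‖ = 1) :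
    ‖a ω 0 * z + b ω 0‖ = ‖c ω 0 * z + d ω 0‖ := by
  simp [hF.a_zero, hF.b_zero, hF.c_zero, hF.d_zero, hz]

theorem denom_ne_zero (hF : IsFundamentalSystem K η a b c d) (hη : ∀ t, ‖η t‖ ≤ 1) {ω z : ℂ}
    {t : ℝ} (ht : 0 ≤ t) (hω : -(1 / 2 * Real.exp (-((2 + |K|) * t))) ≤ ω.im) (hz : ‖z‖ = 1) :
    c ω t * z + d ω t ≠ 0 :=
  (hF.lift ω z).snd_ne_zero hη (by simp [hF.c_zero, hF.d_zero])
    ((hF.lift ω z).normSq_le hη ht hω (hF.norm_lift_zero ω hz))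

theorem denom_ne_zero_of_im_eq_zero (hF : IsFundamentalSystem K η a b c d)
    (hη : ∀ t, ‖η t‖ ≤ 1) {ω z : ℂ} (hω : ω.im = 0) (t : ℝ) (hz : ‖z‖ = 1) :
    c ω t * z + d ω t ≠ 0 :=
  (hF.lift ω z).snd_ne_zero (c := 1) hη (by simp [hF.c_zero, hF.d_zero])
    (by rw [(hF.lift ω z).norm_eq hω (hF.norm_lift_zero ω hz), one_mul])

theorem norm_moebius_eq_one (hF : IsFundamentalSystem K η a b c d) (hη : ∀ t, ‖η t‖ ≤ 1)
    {ω z : ℂ} (hω : ω.im = 0) (t : ℝ) (hz : ‖z‖ = 1) : ‖moebius a b c d t ω z‖ = 1 := by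
  rw [moebius, norm_div, (hF.lift ω z).norm_eq hω (hF.norm_lift_zero ω hz),
    div_self (norm_ne_zero_iff.2 (hF.denom_ne_zero_of_im_eq_zero hη hω t hz))]

theorem norm_moebius_le_one (hF : IsFundamentalSystem K η a b c d) {ω z : ℂ} (hω : 0 ≤ ω.im)
    {t : ℝ} (ht : 0 ≤ t) (hz : ‖z‖ = 1) : ‖moebius a b c d t ω z‖ ≤ 1 := by
  rw [moebius, norm_div]
  exact div_le_one_of_le₀ ((hF.lift ω z).norm_le hω (hF.norm_lift_zero ω hz) ht) (norm_nonneg _)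

theorem norm_moebius_le_two (hF : IsFundamentalSystem K η a b c d) (hη : ∀ t, ‖η t‖ ≤ 1) {ω z : ℂ}
    {t : ℝ} (ht : 0 ≤ t) (hω : -(1 / 2 * Real.exp (-((2 + |K|) * t))) ≤ ω.im) (hz : ‖z‖ = 1) :
    ‖moebius a b c d t ω z‖ ≤ 2 := by
  have hsq := (hF.lift ω z).normSq_le hη ht hω (hF.norm_lift_zero ω hz)
  rw [moebius, norm_div, div_le_iff₀ (norm_pos_iff.2 (hF.denom_ne_zero hη ht hω hz))]
  refine (sq_le_sq₀ (norm_nonneg _) (by positivity)).1 ?_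
  nlinarith [sq_nonneg ‖c ω t * z + d ω t‖]

theorem differentiableOn_moebiusMoment {T : ℝ} {h : Measure (AddCircle T)} [IsFiniteMeasure h]
    (hF : IsFundamentalSystem K η a b c d) (hη : ∀ t, ‖η t‖ ≤ 1) (j : ℕ) {t : ℝ} (ht : 0 ≤ t) :
    DifferentiableOn ℂ (moebiusMoment h a b c d j t)
      {ω | -(1 / 2 * Real.exp (-((2 + |K|) * t))) < ω.im} := by
  refine differentiableOn_integral_of_norm_le (B := 2 ^ j)
    (isOpen_lt continuous_const Complex.continuous_im)
    (fun ω _ => aestronglyMeasurable_moebius_pow h a b c d j t ω) (ae_of_all _ fun θ => ?_)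
    (ae_of_all _ fun θ ω hω => ?_)
  · exact ((((hF.differentiable_a t).mul_const _).add (hF.differentiable_b t)).differentiableOn.div
      (((hF.differentiable_c t).mul_const _).add (hF.differentiable_d t)).differentiableOn
      fun ω hω => hF.denom_ne_zero hη ht (le_of_lt hω) (norm_fourier_apply 1 θ)).pow j
  · rw [norm_pow]
    gcongr
    exact hF.norm_moebius_le_two hη ht (le_of_lt hω) (norm_fourier_apply 1 θ)

theorem integrable_moebius_pow {T : ℝ} {h : Measure (AddCircle T)} [IsFiniteMeasure h]
    (hF : IsFundamentalSystem K η a b c d) (hη : ∀ t, ‖η t‖ ≤ 1) (ω t : ℝ) (j : ℕ) :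
    Integrable (fun θ => moebius a b c d t ω (fourier 1 θ) ^ j) h :=
  .of_bound (aestronglyMeasurable_moebius_pow h a b c d j t ω) 1 (ae_of_all _ fun θ => by
    rw [norm_pow, hF.norm_moebius_eq_one hη (Complex.ofReal_im ω) t (norm_fourier_apply 1 θ),
      one_pow])

theorem isMomentHierarchy_moebiusMoment {T : ℝ} {h : Measure (AddCircle T)} [IsFiniteMeasure h]
    (hF : IsFundamentalSystem K η a b c d) (hη : ∀ t, ‖η t‖ ≤ 1) (ω : ℝ) :
    IsMomentHierarchy K ω η fun j t => moebiusMoment h a b c d j t ω := by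
  intro j hj t _
  let ζ (s : ℝ) (θ : AddCircle T) : ℂ := moebius a b c d s ω (fourier 1 θ)
  have hint (k : ℕ) (s : ℝ) : Integrable (fun θ => ζ s θ ^ k) h :=
    hF.integrable_moebius_pow hη ω s k
  have hcoupling : Integrable (fun θ => η t * ζ t θ ^ (j - 1) -
      (starRingEnd ℂ) (η t) * ζ t θ ^ (j + 1)) h :=
    ((hint (j - 1) t).const_mul _).sub ((hint (j + 1) t).const_mul _)
  have hderiv := (hasDerivAt_integral_of_dominated_loc_of_deriv_le (μ := h)
    (F := fun s θ => ζ s θ ^ j) (F' := fun s θ => j * Complex.I * ω * ζ s θ ^ j +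
      j * K / 2 * (η s * ζ s θ ^ (j - 1) - (starRingEnd ℂ) (η s) * ζ s θ ^ (j + 1)))
    (x₀ := t) (bound := fun _ => j * |ω| + j * |K|) univ_mem
    (Eventually.of_forall fun s => (hint j s).aestronglyMeasurable) (hint j t)
    (((hint j t).const_mul _).add (hcoupling.const_mul _)).aestronglyMeasurable
    (ae_of_all _ fun θ s _ => norm_momentField_le
      (hF.norm_moebius_eq_one hη (Complex.ofReal_im ω) s (norm_fourier_apply 1 θ)) (hη s) j)
    (integrable_const _) (ae_of_all _ fun θ s _ => (hF.lift ω (fourier 1 θ)).hasDerivAt_div_pow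
      (hF.denom_ne_zero_of_im_eq_zero hη (Complex.ofReal_im ω) s (norm_fourier_apply 1 θ)) hj)).2
  refine (hderiv.congr_deriv ?_).hasDerivWithinAt
  rw [integral_add ((hint j t).const_mul _) (hcoupling.const_mul _), integral_const_mul,
    integral_const_mul, integral_sub ((hint (j - 1) t).const_mul _)
    ((hint (j + 1) t).const_mul _), integral_const_mul, integral_const_mul]
  rfl

theorem exists_expPlus_eq_moebiusMoment {T : ℝ} (h : Measure (AddCircle T))
    [IsProbabilityMeasure h] (hF : IsFundamentalSystem K η a b c d) (hη : ∀ t, ‖η t‖ ≤ 1) (j : ℕ)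
    {t : ℝ} (ht : 0 ≤ t) :
    ∃ φ ∈ boundedSet 1 0, ∀ ω : ℝ, φ ω = moebiusMoment h a b c d j t ω := by
  obtain ⟨n, hn⟩ := exists_nat_one_div_lt
    (by positivity : 0 < 1 / 2 * Real.exp (-((2 + |K|) * t)))
  have hsub {z : ℂ} (hz : -(1 / ((n : ℝ) + 1)) ≤ z.im) :
      -(1 / 2 * Real.exp (-((2 + |K|) * t))) < z.im := by linarith
  have hdiff := hF.differentiableOn_moebiusMoment (h := h) hη j ht
  obtain ⟨φ, hφ⟩ := exists_expPlus_of_bound (f := moebiusMoment h a b c d j t)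
    (β := 0) (n := n) (C := 2 ^ j) (hdiff.mono fun z hz => hsub (le_of_lt hz))
    (hdiff.continuousOn.mono fun z hz => hsub hz) fun z hz => by
      simpa using norm_moebiusMoment_le
        (fun w hw => hF.norm_moebius_le_two hη ht (hsub hz).le hw) j
  refine ⟨φ, fun z hz => ?_, fun ω => hφ ω (by simp)⟩
  rw [neg_zero, zero_mul, Real.exp_zero, mul_one, hφ z hz]
  simpa using norm_moebiusMoment_le (h := h)
    (fun w hw => hF.norm_moebius_le_one hz ht hw) j

end IsFundamentalSystem

namespace IsKuramotoSolution

variable {K : ℝ} {g : ℝ → ℝ} {h : Measure (AddCircle (2 * Real.pi))}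
  {ρ : ℝ → Kernel ℝ (AddCircle (2 * Real.pi))}

theorem circleMoment_eq_moebiusMoment [IsProbabilityMeasure h]
    (hρ : IsKuramotoSolution K g h ρ) {η : ℝ → ℂ} (hη : ∀ t, ‖η t‖ ≤ 1)
    (hηρ : ∀ t, 0 ≤ t → η t = orderParameter g ρ t) {a b c d : ℂ → ℝ → ℂ}
    (hF : IsFundamentalSystem K η a b c d) (j : ℕ) {t : ℝ} (ht : 0 ≤ t) (ω : ℝ) :
    circleMoment ρ j t ω = moebiusMoment h a b c d j t ω := by
  refine (hρ.isMomentHierarchy_circleMoment hηρ ω).eq_of_bounded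
    (hF.isMomentHierarchy_moebiusMoment hη ω) (fun s _ => hη s) (fun s hs => ?_)
    (fun k s hs => hρ.norm_circleMoment_le k hs ω) (fun k s hs => ?_) (fun k => ?_) j ht
  · rw [hρ.circleMoment_zero hs]
    simp [moebiusMoment]
  · simpa using norm_moebiusMoment_le (h := h)
      (fun z hz => hF.norm_moebius_le_one (ω := ω) (by simp) hs hz) k
  · simp only [moebiusMoment, circleMoment, hρ.initial, hF.moebius_zero, fourier_eq_pow]

theorem exists_expPlus [IsProbabilityMeasure h] (hρ : IsKuramotoSolution K g h ρ)
    (hg : Integrable g) (hg₀ : ∀ ω, 0 ≤ g ω) (hg₁ : ∫ ω, g ω ≤ 1) {t : ℝ} (ht : 0 ≤ t) (j : ℕ) :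
    ∃ φ ∈ boundedSet 1 0, ∀ ω : ℝ, φ ω = circleMoment ρ j t ω := by
  let η (s : ℝ) : ℂ := orderParameter g ρ (max s 0)
  have hηc : Continuous η := (hρ.continuousOn_orderParameter hg).comp_continuous
    (continuous_id.max continuous_const) fun s => le_max_right s 0
  have hη (s : ℝ) : ‖η s‖ ≤ 1 := (hρ.norm_orderParameter_le hg hg₀ (le_max_right s 0)).trans hg₁
  have hηρ (s : ℝ) (hs : 0 ≤ s) : η s = orderParameter g ρ s := by simp only [η, max_eq_left hs]
  obtain ⟨a, b, c, d, hF⟩ := exists_isFundamentalSystem K hηc hη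
  obtain ⟨φ, hφ, hreal⟩ := hF.exists_expPlus_eq_moebiusMoment h hη j ht
  exact ⟨φ, hφ, fun ω => (hreal ω).trans (hρ.circleMoment_eq_moebiusMoment hη hηρ hF j ht ω).symm⟩

end IsKuramotoSolution

/-! ### Resonance poles -/

theorem IsResonancePole.re_nonpos {K : ℝ} {g : ℝ → ℝ} {G : ℂ → ℂ} {lam : ℂ}
    (h : IsResonancePole K g G lam) : lam.re ≤ 0 :=
  h.elim (fun h => h.1.le) fun h => h.1.le

theorem IsResonancePole.analyticAt {K : ℝ} {g : ℝ → ℝ} {G : ℂ → ℂ} {lam : ℂ}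
    (h : IsResonancePole K g G lam) (hlam : lam.re < 0) : AnalyticAt ℂ G (-Complex.I * lam) :=
  h.elim (fun h => h.2.1) fun h => absurd h.1 hlam.ne

end

end Kuramoto

open Kuramoto in
theorem theorem5p10_general (g : ℝ → ℝ) (G : ℂ → ℂ) (δ : ℝ) (hg : IsGaussianType g G δ) :
    (∀ C α : ℝ, 0 ≤ C →
      (topologyOn weakDualTopology (boundedImage hg C α) =
          topologyOn projectiveTopology (boundedImage hg C α) ∧
        topologyOn projectiveTopology (boundedImage hg C α) =
          topologyOn strongDualTopology (boundedImage hg C α)) ∧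
      (∀ τ ∈ ({weakDualTopology, projectiveTopology, strongDualTopology} :
          Set (TopologicalSpace ExpPlusDual)),
        @IsConnected _ τ (@closure _ τ (boundedImage hg C α)) ∧
        @IsCompact _ τ (@closure _ τ (boundedImage hg C α)) ∧
        ∃ M : MetricSpace (@closure _ τ (boundedImage hg C α)),
          M.toPseudoMetricSpace.toUniformSpace.toTopologicalSpace =
            topologyOn τ (@closure _ τ (boundedImage hg C α)) ∧
          ∀ x y : @closure _ τ (boundedImage hg C α), dist x y = dualDist x y) ∧
      (∀ lam : ℂ, lam.re ≤ 0 → (lam.re < 0 → AnalyticAt ℂ G (-Complex.I * lam)) →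
        ∃ μ : ExpPlusDual, IsGeneralizedEigenfunction g G lam μ ∧
          ∀ c : ℂ, ∃ P : boundedImage hg C α → ExpPlusDual,
            (∀ (ψ : ExpPlus) (hψ : ψ ∈ boundedSet C α),
              P ⟨canonicalInclusion hg ψ, Set.mem_image_of_mem _ hψ⟩ = (c * μ ψ) • μ) ∧
            @Continuous _ _ (topologyOn projectiveTopology (boundedImage hg C α))
              projectiveTopology P ∧
            @SeqContinuous _ _ (topologyOn weakDualTopology (boundedImage hg C α))
              weakDualTopology P)) ∧
    (∀ (K : ℝ) (h : MeasureTheory.Measure (AddCircle (2 * Real.pi))),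
      MeasureTheory.IsProbabilityMeasure h →
      ∀ ρ : ℝ → ProbabilityTheory.Kernel ℝ (AddCircle (2 * Real.pi)),
        IsKuramotoSolution K g h ρ → ∀ t : ℝ, 0 ≤ t → ∀ j : ℕ,
          ∃ φ ∈ boundedSet 1 0, ∀ ω : ℝ, φ ω = circleMoment ρ j t ω) := by
  refine ⟨fun C α hC => ⟨⟨?_, ?_⟩, fun τ hτ => ?_, fun lam hlam _ => ?_⟩,
    fun K h _ ρ hρ t ht j =>
      hρ.exists_expPlus hg.integrable hg.nonneg hg.integral_eq_one.le ht j⟩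
  · exact topologyOn_weak_eq_projective hg hC α (boundedImage_subset_dominatedSet hg C α)
  · rw [projective_eq_strong]
  · have hτ' : projectiveTopology ≤ τ ∧ τ ≤ weakDualTopology := by
      rcases hτ with rfl | rfl | rfl
      · exact ⟨projective_le_weak, le_rfl⟩
      · exact ⟨le_rfl, projective_le_weak⟩
      · exact ⟨projective_eq_strong.le, projective_eq_strong.ge.trans projective_le_weak⟩
    exact ⟨(isConnected_boundedImage hg hC α hτ'.1).closure,
      isCompact_closure_boundedImage hg hC α hτ'.1 hτ'.2, dualMetricOn _,
      dualMetricOn_closure_boundedImage_topology hg hC α hτ'.1 hτ'.2, fun _ _ => rfl⟩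
  · obtain ⟨μ, hμ, hreg⟩ := exists_eigenfunction hg hlam
    exact ⟨μ, hμ, exists_projection hg hC α hreg⟩

open Kuramoto in
theorem theorem5p10 (g : ℝ → ℝ) (G : ℂ → ℂ) (δ : ℝ) (hg : IsGaussianType g G δ) (K : ℝ) :
    (∀ C α : ℝ, 1 ≤ C → 0 ≤ α →
      -- (i) the three topologies coincide on `i(V_{C,α})`
      (topologyOn weakDualTopology (boundedImage hg C α) =
          topologyOn projectiveTopology (boundedImage hg C α) ∧
        topologyOn projectiveTopology (boundedImage hg C α) =
          topologyOn strongDualTopology (boundedImage hg C α)) ∧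
      -- (ii) for each of them, the closure is connected, compact, and metrized by `d`
      (∀ τ ∈ ({weakDualTopology, projectiveTopology, strongDualTopology} :
          Set (TopologicalSpace ExpPlusDual)),
        @IsConnected _ τ (@closure _ τ (boundedImage hg C α)) ∧
        @IsCompact _ τ (@closure _ τ (boundedImage hg C α)) ∧
        ∃ M : MetricSpace (@closure _ τ (boundedImage hg C α)),
          M.toPseudoMetricSpace.toUniformSpace.toTopologicalSpace =
            topologyOn τ (@closure _ τ (boundedImage hg C α)) ∧
          ∀ x y : @closure _ τ (boundedImage hg C α), dist x y = dualDist x y) ∧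
      -- (iii) the projection to the generalized eigenspace of a simple resonance pole
      (((K : ℂ) : OnePoint ℂ) ∉ exceptionalCouplings g G δ →
        ∀ lam Dn : ℂ, IsResonancePole K g G lam → HasPoleConstant K g G lam Dn → Dn ≠ 0 →
          ∃ μ : ExpPlusDual, IsGeneralizedEigenfunction g G lam μ ∧
            ∃ P : boundedImage hg C α → ExpPlusDual,
              (∀ (ψ : ExpPlus) (hψ : ψ ∈ boundedSet C α),
                P ⟨canonicalInclusion hg ψ, Set.mem_image_of_mem _ hψ⟩ =
                  (K / (2 * Dn) * μ ψ) • μ) ∧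
              @Continuous _ _ (topologyOn projectiveTopology (boundedImage hg C α))
                projectiveTopology P ∧
              @SeqContinuous _ _ (topologyOn weakDualTopology (boundedImage hg C α))
                weakDualTopology P)) ∧
    -- (iv) the solutions of the Kuramoto model stay in `V_{1,0}`
    (∀ h : MeasureTheory.Measure (AddCircle (2 * Real.pi)), MeasureTheory.IsProbabilityMeasure h →
      ∀ ρ : ℝ → ProbabilityTheory.Kernel ℝ (AddCircle (2 * Real.pi)),
        IsKuramotoSolution K g h ρ → ∀ t : ℝ, 0 ≤ t → ∀ j : ℕ, 1 ≤ j →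
          ∃ φ ∈ boundedSet 1 0, ∀ ω : ℝ, φ ω = circleMoment ρ j t ω) := by
  refine ⟨fun C α hC _ => ?_, fun h hh ρ hρ t ht j _ =>
    (theorem5p10_general g G δ hg).2 K h hh ρ hρ t ht j⟩
  obtain ⟨htop, hclosure, hproj⟩ := (theorem5p10_general g G δ hg).1 C α (zero_le_one.trans hC)
  refine ⟨htop, hclosure, fun _ lam Dn hlam _ _ => ?_⟩
  obtain ⟨μ, hμ, hP⟩ := hproj lam hlam.re_nonpos hlam.analyticAt
  exact ⟨μ, hμ, hP _⟩
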